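/- **Setting.** Let $X$ be an $N$-dimensional complex torus, $X\cong\mathbb C^N/\Lambda$ with $\Lambda$ a lattice, with a Kähler metric whose curvature vanishes (a flat Kähler torus). Let $T$ be its holomorphic tangent bundle, $E=T^{\oplus a}\oplus (T^*)^{\oplus b}$ and $F=T^{\oplus c}\oplus (T^*)^{\oplus d}$ with $a,b,c,d\ge 0$. Give $T^*$, $E$, $F$ the Hermitian metrics induced from that of $X$. Let $m\ge 0$ be an integer. *The bundle $A_m(E,F)$.* For holomorphic coordinates $y=(y_i)$ and holomorphic frames $e=(e_i)$ of $E$ and $f=(f_i)$ of $F$ on an open set $U\subseteq X$, put $$R_m(y,e,f)=\mathbb C[y_i^{(l)},\,1\le l\le m]\otimes\mathbb C[e_i^{(l)},\,0\le l\le m]\otimes\textstyle\bigwedge_{\mathbb C}[f_i^{(l)},\,0\le l\le m],\qquad R_\infty=\bigcup_m R_m,$$ where the $y_i^{(l)},e_i^{(l)},f_i^{(l)}$ are new variables. Let $D=\sum_i\frac{\partial}{\partial y_i}\otimes y_i^{(1)}+1\otimes\tilde D$ on functions on $U$ with values in $R_\infty$, where $\tilde D$ is the derivation of $R_\infty$ that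 raises the upper index $l$ of each generator by one. If $(U_\alpha,y_\alpha,e_\alpha,f_\alpha)$ and $(U_\beta,y_\beta,e_\beta,f_\beta)$ are two such data, with $e_{\alpha,i}=\sum_j g_{ij}e_{\beta,j}$ and $f_{\alpha,i}=\sum_j h_{ij}f_{\beta,j}$ on $U_\alpha\cap U_\beta$, then for $x\in U_\alpha\cap U_\beta$ the algebra isomorphism $$r_{\alpha\beta}^x:\quad y_{\alpha,i}^{(l)}\mapsto (D^l y_{\alpha,i})(x),\quad e_{\alpha,i}^{(l)}\mapsto D^l\Big(\sum_j g_{ij}e_{\beta,j}^{(0)}\Big)(x),\quad f_{\alpha,i}^{(l)}\mapsto D^l\Big(\sum_j h_{ij}f_{\beta,j}^{(0)}\Big)(x)$$ (with $D$ formed in the coordinates $y_\beta$) maps $R_m(y_\alpha,e_\alpha,f_\alpha)$ to $R_m(y_\beta,e_\beta,f_\beta)$. $A_m(E,F)$ is the holomorphic bundle of algebras with fibres $R_m$ and these transition functions. Its smooth (holomorphic) sections are the sections that are locally finite sums $\sum\varphi_k w_k$ with $w_k\in R_m(y,e,f)$ and smooth (holomorphic) functions $\varphi_k$. *The connection $\tilde\nabla$.*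 Let $H_{ij}=(dy_i,dy_j)$, $H^E_{ij}=(e_i,e_j)$, $H^F_{ij}=(f_i,f_j)$, with inverse matrices $(H^{ij})$, $(H_E^{ij})$, $(H_F^{ij})$, and for $l\ge 0$ $$Y_i^{(l+1)}=\sum_{j,s}H_{ij}D^l(H^{js}y_s^{(1)}),\quad E_i^{(l)}=\sum_{j,s}H^E_{ij}D^l(H_E^{js}e_s^{(0)}),\quad F_i^{(l)}=\sum_{j,s}H^F_{ij}D^l(H_F^{js}f_s^{(0)}).$$ The algebra isomorphism with $Y_i^{(l)}\mapsto y_i^{(l)}$, $E_i^{(l)}\mapsto e_i^{(l)}$, $F_i^{(l)}\mapsto f_i^{(l)}$ identifies $A_m(E,F)$, as a smooth bundle, with the bundle $$B_m(E,F)=\mathrm{Sym}^*\Big(\bigoplus_{1\le l\le m}T^*\Big)\otimes\mathrm{Sym}^*\Big(\bigoplus_{0\le l\le m}E\Big)\otimes\textstyle\bigwedge^*\Big(\bigoplus_{0\le l\le m}F\Big),$$ in which $y_i^{(l)},e_i^{(l)},f_i^{(l)}$ stand for $dy_i,e_i,f_i$ in the $l$-th summands. $\tilde\nabla$ is the connection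 on $A_m(E,F)$ that corresponds to the connection of $B_m(E,F)$ induced from the Chern connections of $T^*$, $E$ and $F$; that is, $\tilde\nabla$ satisfies the Leibniz rule and $$\tilde\nabla Y_i^{(l)}=\sum_j\theta^{T^*}_{ij}Y_j^{(l)},\quad \tilde\nabla E_i^{(l)}=\sum_j\theta^{E}_{ij}E_j^{(l)},\quad \tilde\nabla F_i^{(l)}=\sum_j\theta^{F}_{ij}F_j^{(l)},$$ with the connection matrices $\theta^{T^*}=\partial H\cdot H^{-1}$, $\theta^E=\partial H^E\cdot (H^E)^{-1}$, $\theta^F=\partial H^F\cdot (H^F)^{-1}$. **Statement.** A smooth section $s$ of $A_m(E,F)$ is holomorphic if and only if $\tilde\nabla s=0$. Moreover, for every $x\in X$ the restriction map $s\mapsto s(x)$, from the space of holomorphic sections of $A_m(E,F)$ on $X$ to the fibre $A_m(E,F)|_x$, is an isomorphism of complex vector spaces. -/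

import Mathlib

open scoped Manifold ContDiff TensorProduct Bundle

noncomputable section

namespace JetBundle

/-! ### The algebra `R_∞(y, e, f)` and its subalgebras `R_m(y, e, f)` -/

/-- The model space `ℂ^N` of complex manifolds of dimension `N`. -/
abbrev Cn (N : ℕ) : Type := Fin N → ℂ

section Algebra

variable (N : ℕ) (ιE ιF : Type)

/-- Indices of the even generators: `Sum.inl (i, l)` stands for `y_i^{(l+1)}` and
`Sum.inr (i, l)` stands for `e_i^{(l)}`. -/
abbrev EvenIdx : Type := (Fin N × ℕ) ⊕ (ιE × ℕ)

/-- Indices of the odd generators: `(i, l)` stands for `f_i^{(l)}`. -/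
abbrev OddIdx : Type := ιF × ℕ

/-- Indices of all generators. -/
abbrev GenIdx : Type := EvenIdx N ιE ⊕ OddIdx ιF

/-- The algebra `R_∞(y, e, f) = ℂ[y_i^{(l)} (l ≥ 1), e_i^{(l)} (l ≥ 0)] ⊗ ⋀_ℂ[f_i^{(l)} (l ≥ 0)]`. -/
abbrev RAlg : Type :=
  MvPolynomial (EvenIdx N ιE) ℂ ⊗[ℂ] ExteriorAlgebra ℂ (OddIdx ιF →₀ ℂ)

variable {N ιE ιF}

/-- The generators of `R_∞`. -/
def gen : GenIdx N ιE ιF → RAlg N ιE ιF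
  | .inl s => MvPolynomial.X s ⊗ₜ[ℂ] 1
  | .inr t => 1 ⊗ₜ[ℂ] ExteriorAlgebra.ι ℂ (Finsupp.single t 1)

/-- The generator `y_i^{(l+1)}`. -/
def yGen (i : Fin N) (l : ℕ) : RAlg N ιE ιF := gen (.inl (.inl (i, l)))

/-- The generator `e_i^{(l)}`. -/
def eGen (i : ιE) (l : ℕ) : RAlg N ιE ιF := gen (.inl (.inr (i, l)))

/-- The generator `f_i^{(l)}`. -/
def fGen (i : ιF) (l : ℕ) : RAlg N ιE ιF := gen (.inr (i, l))

variable (N ιE ιF) in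
/-- `R_m ⊆ R_∞`, the subalgebra generated by the `y_i^{(l)}` with `1 ≤ l ≤ m` and by the
`e_i^{(l)}`, `f_i^{(l)}` with `0 ≤ l ≤ m`. -/
def Rm (m : ℕ) : Subalgebra ℂ (RAlg N ιE ιF) :=
  Algebra.adjoin ℂ
    ({r | ∃ i l, l < m ∧ r = yGen i l} ∪ {r | ∃ i l, l ≤ m ∧ r = eGen i l} ∪
      {r | ∃ i l, l ≤ m ∧ r = fGen i l})

/-- The algebra homomorphism `v ↦ v + ε L v` from the exterior algebra of `M` to its dual numbers,
for a linear endomorphism `L` of `M`. -/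
def extDualHom {M : Type} [AddCommGroup M] [Module ℂ M] (L : M →ₗ[ℂ] M) :
    ExteriorAlgebra ℂ M →ₐ[ℂ] TrivSqZeroExt (ExteriorAlgebra ℂ M) (ExteriorAlgebra ℂ M) :=
  ExteriorAlgebra.lift ℂ
    ⟨(TrivSqZeroExt.inlAlgHom ℂ (ExteriorAlgebra ℂ M) (ExteriorAlgebra ℂ M)).toLinearMap ∘ₗ
        ExteriorAlgebra.ι ℂ +
      (TrivSqZeroExt.inrHom (ExteriorAlgebra ℂ M) (ExteriorAlgebra ℂ M)).restrictScalars ℂ ∘ₗ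
        ExteriorAlgebra.ι ℂ ∘ₗ L, by
      intro v
      ext
      · simp
      · simp [add_comm]⟩

/-- The derivation of the exterior algebra of `M` that extends a linear endomorphism `L` of `M`:
the `ε`-component of `extDualHom L`. -/
def extDer {M : Type} [AddCommGroup M] [Module ℂ M] (L : M →ₗ[ℂ] M) :
    ExteriorAlgebra ℂ M →ₗ[ℂ] ExteriorAlgebra ℂ M :=
  (TrivSqZeroExt.sndHom (ExteriorAlgebra ℂ M) (ExteriorAlgebra ℂ M)).restrictScalars ℂ ∘ₗ
    (extDualHom L).toLinearMap

/-- The derivation of `R_∞` that maps each even generator `s` to the polynomial `p s` and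
restricts to the linear map `L` on the span of the odd generators. -/
def algDer (p : EvenIdx N ιE → MvPolynomial (EvenIdx N ιE) ℂ)
    (L : (OddIdx ιF →₀ ℂ) →ₗ[ℂ] (OddIdx ιF →₀ ℂ)) :
    RAlg N ιE ιF →ₗ[ℂ] RAlg N ιE ιF :=
  LinearMap.rTensor _ (MvPolynomial.mkDerivation ℂ p).toLinearMap +
    LinearMap.lTensor _ (extDer L)

/-- The derivation `D̃` of `R_∞` with `D̃ y_i^{(l)} = y_i^{(l+1)}`, `D̃ e_i^{(l)} = e_i^{(l+1)}`
and `D̃ f_i^{(l)} = f_i^{(l+1)}`. -/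
def shiftDer : RAlg N ιE ιF →ₗ[ℂ] RAlg N ιE ιF :=
  algDer
    (fun s => MvPolynomial.X (s.map (fun t => (t.1, t.2 + 1)) (fun t => (t.1, t.2 + 1))))
    (Finsupp.lmapDomain ℂ ℂ (fun t => (t.1, t.2 + 1)))

/-- The derivation of `R_∞` with `y_i^{(l)} ↦ ∑_j A_ij y_j^{(l)}`, `e_i^{(l)} ↦ ∑_j B_ij e_j^{(l)}`
and `f_i^{(l)} ↦ ∑_j C_ij f_j^{(l)}`. -/
def matrixDer [Fintype ιE] [Fintype ιF] (A : Matrix (Fin N) (Fin N) ℂ) (B : Matrix ιE ιE ℂ)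
    (C : Matrix ιF ιF ℂ) : RAlg N ιE ιF →ₗ[ℂ] RAlg N ιE ιF :=
  algDer
    (Sum.elim (fun t => ∑ j, A t.1 j • MvPolynomial.X (Sum.inl (j, t.2)))
      (fun t => ∑ j, B t.1 j • MvPolynomial.X (Sum.inr (j, t.2))))
    (Finsupp.linearCombination ℂ (fun t => ∑ j, C t.1 j • Finsupp.single (j, t.2) 1))

open Classical in
/-- The homomorphism of `ℂ`-algebras `R_∞ → R_∞` that maps `u g` to `v g` for all `g`. It is only
used where exactly one such homomorphism exists (and is the identity where none exists). -/
def homOfValues (u v : GenIdx N ιE ιF → RAlg N ιE ιF) : RAlg N ιE ιF →ₐ[ℂ] RAlg N ιE ιF :=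
  if h : ∃ φ : RAlg N ιE ιF →ₐ[ℂ] RAlg N ιE ιF, ∀ g, φ (u g) = v g then h.choose
  else AlgHom.id ℂ _

end Algebra

/-! ### Differentiation of scalar functions and of functions with values in a vector space -/

section Calculus

variable {N : ℕ} {W : Type} [AddCommGroup W] [Module ℂ W]

/-- The `(1,0)`-derivative `(∂φ)(v)` at `z`; for `v` the `i`-th standard vector it is the Wirtinger
derivative `∂φ/∂z_i`. -/
def del (φ : Cn N → ℂ) (z v : Cn N) : ℂ :=
  (fderiv ℝ φ z v - Complex.I * fderiv ℝ φ z (Complex.I • v)) / 2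

/-- The `(0,1)`-derivative `(∂̄φ)(v)` at `z`. -/
def delBar (φ : Cn N → ℂ) (z v : Cn N) : ℂ :=
  (fderiv ℝ φ z v + Complex.I * fderiv ℝ φ z (Complex.I • v)) / 2

open Classical in
/-- The extension of an operator `δ` on scalar functions to functions `g` with values in a complex
vector space `W`: the vector `w` with `ℓ w = δ (ℓ ∘ g)` for all linear forms `ℓ` on `W`. Hence
`∑ φ_k w_k` (a finite sum, near the point where `δ` differentiates) goes to `∑ δ(φ_k) w_k`. -/
def coeffwise (δ : (Cn N → ℂ) → ℂ) (g : Cn N → W) : W :=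
  if h : ∃ w : W, ∀ l : W →ₗ[ℂ] ℂ, l w = δ (fun z => l (g z)) then h.choose else 0

/-- `g` is locally on the open set `U` a finite sum `∑ φ_k w_k` with `w_k ∈ W` and scalar functions
`φ_k` satisfying `P`. -/
def LocallyFiniteSum (P : (Cn N → ℂ) → Set (Cn N) → Prop) (g : Cn N → W) (U : Set (Cn N)) : Prop :=
  ∀ z ∈ U, ∃ O : Set (Cn N), IsOpen O ∧ z ∈ O ∧ ∃ (n : ℕ) (φ : Fin n → Cn N → ℂ) (w : Fin n → W),
    (∀ k, P (φ k) O) ∧ ∀ z' ∈ O, g z' = ∑ k, φ k z' • w k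

/-- Smooth functions on `U` with values in `W`, i.e. sections of the sheaf `C^∞ ⊗ W`. -/
def SmoothOn (g : Cn N → W) (U : Set (Cn N)) : Prop :=
  LocallyFiniteSum (fun φ O => ContDiffOn ℝ ∞ φ O) g U

/-- Holomorphic functions on `U` with values in `W`, i.e. sections of the sheaf `𝒪 ⊗ W`. -/
def HolomorphicOn (g : Cn N → W) (U : Set (Cn N)) : Prop :=
  LocallyFiniteSum (fun φ O => DifferentiableOn ℂ φ O) g U

theorem HolomorphicOn.add {g g' : Cn N → W} {U : Set (Cn N)} (h : HolomorphicOn g U)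
    (h' : HolomorphicOn g' U) : HolomorphicOn (fun z => g z + g' z) U := by
  intro z hz
  obtain ⟨O, hO, hzO, n, φ, w, hφ, hg⟩ := h z hz
  obtain ⟨O', hO', hzO', n', φ', w', hφ', hg'⟩ := h' z hz
  refine ⟨O ∩ O', hO.inter hO', ⟨hzO, hzO'⟩, n + n', Fin.append φ φ', Fin.append w w', ?_, ?_⟩
  · intro k
    refine Fin.addCases (fun i => ?_) (fun i => ?_) k
    · simpa using (hφ i).mono Set.inter_subset_left
    · simpa using (hφ' i).mono Set.inter_subset_right
  · rintro z' ⟨h1, h2⟩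
    simp [Fin.sum_univ_add, hg z' h1, hg' z' h2]

theorem HolomorphicOn.smul {g : Cn N → W} {U : Set (Cn N)} (c : ℂ) (h : HolomorphicOn g U) :
    HolomorphicOn (fun z => c • g z) U := by
  intro z hz
  obtain ⟨O, hO, hzO, n, φ, w, hφ, hg⟩ := h z hz
  refine ⟨O, hO, hzO, n, φ, fun k => c • w k, hφ, fun z' hz' => ?_⟩
  simp only [hg z' hz', Finset.smul_sum]
  exact Finset.sum_congr rfl fun k _ => smul_comm _ _ _

theorem HolomorphicOn.zero {U : Set (Cn N)} : HolomorphicOn (fun _ => (0 : W)) U :=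
  fun _ _ => ⟨Set.univ, isOpen_univ, trivial, 0, Fin.elim0, Fin.elim0, fun k => k.elim0,
    fun _ _ => by simp⟩

variable {ιE ιF : Type}

/-- The derivation `D = ∑_i ∂/∂y_i ⊗ y_i^{(1)} + 1 ⊗ D̃` on functions with values in `R_∞`. -/
def totalD (G : Cn N → RAlg N ιE ιF) : Cn N → RAlg N ιE ιF := fun z =>
  ∑ i, coeffwise (fun φ => del φ z (Pi.single i 1)) G * yGen i 0 + shiftDer (G z)

end Calculus

/-! ### The bundle `A_m(E, F)` on a complex manifold -/

section Bundles

variable {N : ℕ} {X : Type*} [TopologicalSpace X] [ChartedSpace (Cn N) X]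

variable (N) in
/-- The holomorphic tangent space of the complex manifold `X` at `x`. -/
abbrev TX (x : X) : Type := TangentSpace 𝓘(ℂ, Cn N) x

variable (N) in
/-- The holomorphic cotangent space of the complex manifold `X` at `x`. -/
abbrev TXDual (x : X) : Type _ := TX N x →L[ℂ] ℂ

variable
  (FE : Type*) [NormedAddCommGroup FE] [NormedSpace ℂ FE]
  (E : X → Type*) [TopologicalSpace (Bundle.TotalSpace FE E)]
  [∀ x, AddCommGroup (E x)] [∀ x, Module ℂ (E x)] [∀ x, TopologicalSpace (E x)]
  [FiberBundle FE E]
  (FF : Type*) [NormedAddCommGroup FF] [NormedSpace ℂ FF]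
  (F : X → Type*) [TopologicalSpace (Bundle.TotalSpace FF F)]
  [∀ x, AddCommGroup (F x)] [∀ x, Module ℂ (F x)] [∀ x, TopologicalSpace (F x)]
  [FiberBundle FF F]
  (ιE ιF : Type)

variable (N) in
/-- The set `𝒰` of all `(U, y, e, f)` with a holomorphic coordinate system `y` on the open set `U`
(a chart of the maximal atlas with source `U`) and holomorphic frames `e` of `E` and `f` of `F`
on `U`. The index types `ιE` and `ιF` of the frames have as many elements as the ranks. -/
structure LocalData where
  /-- the coordinate system -/
  y : OpenPartialHomeomorph X (Cn N)
  y_mem : y ∈ IsManifold.maximalAtlas 𝓘(ℂ, Cn N) ω X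
  /-- the frame of `E` -/
  e : ιE → (x : X) → E x
  e_frame : IsLocalFrameOn 𝓘(ℂ, Cn N) FE ω e y.source
  /-- the frame of `F` -/
  f : ιF → (x : X) → F x
  f_frame : IsLocalFrameOn 𝓘(ℂ, Cn N) FF ω f y.source

variable {FE E FF F ιE ιF} [Fintype ιE] [Fintype ιF]

/-- The values of the transition function on the generators, for `x ∈ U_α ∩ U_β`:
`y_{α,i}^{(l)} ↦ D^l(y_{α,i})(x)`, `e_{α,i}^{(l)} ↦ D^l(∑_j g_ij e_{β,j}^{(0)})(x)` and
`f_{α,i}^{(l)} ↦ D^l(∑_j h_ij f_{β,j}^{(0)})(x)`, where `e_{α,i} = ∑_j g_ij e_{β,j}`,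
`f_{α,i} = ∑_j h_ij f_{β,j}` and all functions are expressed in the coordinates `y_β`. -/
def transValues (α β : LocalData N FE E FF F ιE ιF) (x : X) : GenIdx N ιE ιF → RAlg N ιE ιF
  | .inl (.inl (i, l)) =>
    totalD^[l + 1] (fun z => algebraMap ℂ _ (α.y (β.y.symm z) i)) (β.y x)
  | .inl (.inr (i, l)) =>
    totalD^[l] (fun z => ∑ j, β.e_frame.coeff j (β.y.symm z) (α.e i (β.y.symm z)) • eGen j 0)
      (β.y x)
  | .inr (i, l) =>
    totalD^[l] (fun z => ∑ j, β.f_frame.coeff j (β.y.symm z) (α.f i (β.y.symm z)) • fGen j 0)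
      (β.y x)

/-- The transition function `r_{αβ}^x : R_∞(y_α, e_α, f_α) → R_∞(y_β, e_β, f_β)` of `A_∞(E, F)`. -/
def trans (α β : LocalData N FE E FF F ιE ιF) (x : X) : RAlg N ιE ιF →ₐ[ℂ] RAlg N ιE ιF :=
  homOfValues gen (transValues α β x)

variable (N FE E FF F ιE ιF) in
/-- The fibre of `A_m(E, F)` at `x`: an element is given by its representatives in
`R_m(y_α, e_α, f_α)` for all `(U_α, y_α, e_α, f_α) ∈ 𝒰` with `x ∈ U_α`, and these are related by
the transition functions. -/
def Fibre (m : ℕ) (x : X) :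
    Subalgebra ℂ ({α : LocalData N FE E FF F ιE ιF // x ∈ α.y.source} → RAlg N ιE ιF) where
  carrier := {r | (∀ α, r α ∈ Rm N ιE ιF m) ∧ ∀ α β, r β = trans α.1 β.1 x (r α)}
  mul_mem' := by
    rintro r s ⟨hr, hr'⟩ ⟨hs, hs'⟩
    refine ⟨fun α => mul_mem (hr α) (hs α), fun α β => ?_⟩
    rw [Pi.mul_apply, Pi.mul_apply, map_mul, ← hr' α β, ← hs' α β]
  add_mem' := by
    rintro r s ⟨hr, hr'⟩ ⟨hs, hs'⟩
    refine ⟨fun α => add_mem (hr α) (hs α), fun α β => ?_⟩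
    rw [Pi.add_apply, Pi.add_apply, map_add, ← hr' α β, ← hs' α β]
  algebraMap_mem' c :=
    ⟨fun α => (Rm N ιE ιF m).algebraMap_mem c, fun α β => ((trans α.1 β.1 x).commutes c).symm⟩

open Classical in
/-- The representative `U → R_∞(y, e, f)` of a section `s` of `A_m(E, F)` with respect to
`(U, y, e, f) ∈ 𝒰`, as a function of the coordinates `z = y(x)`. -/
def localRep {m : ℕ} (s : ∀ x, Fibre N FE E FF F ιE ιF m x) (α : LocalData N FE E FF F ιE ιF)
    (z : Cn N) : RAlg N ιE ιF :=
  if h : α.y.symm z ∈ α.y.source then (s (α.y.symm z)).1 ⟨α, h⟩ else 0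

/-- Smooth sections of `A_m(E, F)`. -/
def IsSmoothSection {m : ℕ} (s : ∀ x, Fibre N FE E FF F ιE ιF m x) : Prop :=
  ∀ α, SmoothOn (localRep s α) α.y.target

/-- Holomorphic sections of `A_m(E, F)`. -/
def IsHolomorphicSection {m : ℕ} (s : ∀ x, Fibre N FE E FF F ιE ιF m x) : Prop :=
  ∀ α, HolomorphicOn (localRep s α) α.y.target

variable (N FE E FF F ιE ιF) in
/-- The space of holomorphic sections of `A_m(E, F)` over `X`. -/
def HolomorphicSections (m : ℕ) : Submodule ℂ (∀ x, Fibre N FE E FF F ιE ιF m x) where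
  carrier := {s | IsHolomorphicSection s}
  add_mem' := by
    intro s t hs ht α
    convert (hs α).add (ht α) using 1
    funext z
    unfold localRep
    split_ifs <;> simp
  zero_mem' := by
    intro α
    convert HolomorphicOn.zero using 1
    funext z
    unfold localRep
    split_ifs <;> rfl
  smul_mem' := by
    intro c s hs α
    convert (hs α).smul c using 1
    funext z
    unfold localRep
    split_ifs <;> simp

variable (N FE E FF F ιE ιF) in
/-- Restriction of holomorphic sections of `A_m(E, F)` to the fibre at `x`. -/
def restriction (m : ℕ) (x : X) :
    HolomorphicSections N FE E FF F ιE ιF m →ₗ[ℂ] Fibre N FE E FF F ιE ιF m x :=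
  LinearMap.proj x ∘ₗ (HolomorphicSections N FE E FF F ιE ιF m).subtype

/-! ### Hermitian metrics and the connection `∇̃` -/

/-- The coordinate vector field `∂/∂y_i` at the point with coordinates `z`. -/
def coordVec (y : OpenPartialHomeomorph X (Cn N)) (z : Cn N) (i : Fin N) : TX N (y.symm z) :=
  mfderiv 𝓘(ℂ, Cn N) 𝓘(ℂ, Cn N) y.symm z (Pi.single i 1 : Cn N)

/-- The coordinate form `dy_i` at `x`. -/
def coordForm (y : OpenPartialHomeomorph X (Cn N)) (x : X) (i : Fin N) : TXDual N x :=
  (ContinuousLinearMap.proj i : Cn N →L[ℂ] ℂ).comp (mfderiv 𝓘(ℂ, Cn N) 𝓘(ℂ, Cn N) y x)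

/-- The connection matrix `θ(v)` at `z`, with `θ_ij = ∑_l ∂H_il H^{lj}`, of the Chern connection
for the metric with matrix `H_ij = (e_i, e_j)` in a holomorphic frame `e`. -/
def chernForm {κ : Type} [Fintype κ] [DecidableEq κ] (H : Cn N → Matrix κ κ ℂ) (z v : Cn N) :
    Matrix κ κ ℂ :=
  Matrix.of (fun i j => del (fun z' => H z' i j) z v) * (H z)⁻¹

section Connection

variable (hT' : ∀ x : X, TXDual N x → TXDual N x → ℂ) (hE : ∀ x, E x → E x → ℂ)
  (hF : ∀ x, F x → F x → ℂ) (α : LocalData N FE E FF F ιE ιF)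

/-- `H_ij = (dy_i, dy_j)` as a function of the coordinates. -/
def HMat (z : Cn N) : Matrix (Fin N) (Fin N) ℂ :=
  Matrix.of fun i j =>
    hT' (α.y.symm z) (coordForm α.y (α.y.symm z) i) (coordForm α.y (α.y.symm z) j)

/-- `H^E_ij = (e_i, e_j)` as a function of the coordinates. -/
def HMatE (z : Cn N) : Matrix ιE ιE ℂ :=
  Matrix.of fun i j => hE (α.y.symm z) (α.e i (α.y.symm z)) (α.e j (α.y.symm z))

/-- `H^F_ij = (f_i, f_j)` as a function of the coordinates. -/
def HMatF (z : Cn N) : Matrix ιF ιF ℂ :=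
  Matrix.of fun i j => hF (α.y.symm z) (α.f i (α.y.symm z)) (α.f j (α.y.symm z))

variable [DecidableEq ιE] [DecidableEq ιF]

/-- The elements `Y_i^{(l+1)} = ∑_j H_ij D^l(∑_s H^{js} y_s^{(1)})`,
`E_i^{(l)} = ∑_j H^E_ij D^l(∑_s H_E^{js} e_s^{(0)})` and
`F_i^{(l)} = ∑_j H^F_ij D^l(∑_s H_F^{js} f_s^{(0)})` of `R_∞(y, e, f)` at the point with
coordinates `z`. -/
def adaptedGen (z : Cn N) : GenIdx N ιE ιF → RAlg N ιE ιF
  | .inl (.inl (i, l)) =>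
    ∑ j, HMat hT' α z i j • totalD^[l] (fun z' => ∑ s, (HMat hT' α z')⁻¹ j s • yGen s 0) z
  | .inl (.inr (i, l)) =>
    ∑ j, HMatE hE α z i j • totalD^[l] (fun z' => ∑ s, (HMatE hE α z')⁻¹ j s • eGen s 0) z
  | .inr (i, l) =>
    ∑ j, HMatF hF α z i j • totalD^[l] (fun z' => ∑ s, (HMatF hF α z')⁻¹ j s • fGen s 0) z

/-- The isomorphism `Φ` from `A_∞(E, F)` to the bundle `B_∞(E, F)` (which is
`Sym^*(⨁_{l ≥ 1} T^*) ⊗ Sym^*(⨁_{l ≥ 0} E) ⊗ ⋀^*(⨁_{l ≥ 0} F)`), in local coordinates: the algebra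
homomorphism with `Y_i^{(l)} ↦ y_i^{(l)}`, `E_i^{(l)} ↦ e_i^{(l)}`, `F_i^{(l)} ↦ f_i^{(l)}`. -/
def isoAB (z : Cn N) : RAlg N ιE ιF →ₐ[ℂ] RAlg N ιE ιF :=
  homOfValues (adaptedGen hT' hE hF α z) gen

/-- `∇̃_v s` at the point with coordinates `z`, for a tangent vector `v`, where `∇̃` is the connection
of the bundle `B_m(E, F)` induced from the Chern connections of `T^*`, `E` and `F`, carried over to
`A_m(E, F)` by `Φ`. Thus `b = Φ s` has `∇̃_v b = db(v) + θ(v) b`, where the connection form `θ(v)`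
acts as the derivation with `y_i^{(l)} ↦ ∑_j θ^{T^*}_ij(v) y_j^{(l)}`,
`e_i^{(l)} ↦ ∑_j θ^E_ij(v) e_j^{(l)}`, `f_i^{(l)} ↦ ∑_j θ^F_ij(v) f_j^{(l)}`. The value is
expressed in `B_m(E, F)`, i.e. it is `Φ(∇̃_v s)`. -/
def nablaTilde {m : ℕ} (s : ∀ x, Fibre N FE E FF F ιE ιF m x) (z v : Cn N) : RAlg N ιE ιF :=
  coeffwise (fun φ => fderiv ℝ φ z v) (fun z' => isoAB hT' hE hF α z' (localRep s α z')) +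
    matrixDer (chernForm (HMat hT' α) z v) (chernForm (HMatE hE α) z v)
      (chernForm (HMatF hF α) z v) (isoAB hT' hE hF α z (localRep s α z))

/-- `∇̃ s = 0`. -/
def IsParallel {m : ℕ} (s : ∀ x, Fibre N FE E FF F ιE ιF m x) : Prop :=
  ∀ α : LocalData N FE E FF F ιE ιF, ∀ z ∈ α.y.target, ∀ v, nablaTilde hT' hE hF α s z v = 0

end Connection

end Bundles

/-! ### Flat Kähler tori -/

section Torus

variable (N : ℕ) (X : Type*) [TopologicalSpace X] [ChartedSpace (Cn N) X]

/-- `X` is a complex torus `ℂ^N / Λ`: there is a surjective local biholomorphism `ℂ^N → X` whose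
fibres are the cosets of a lattice `Λ`. -/
def IsComplexTorus : Prop :=
  ∃ (Λ : Submodule ℤ (Cn N)) (_ : DiscreteTopology Λ) (_ : IsZLattice ℝ Λ) (p : Cn N → X),
    Function.Surjective p ∧ IsLocalDiffeomorph 𝓘(ℂ, Cn N) 𝓘(ℂ, Cn N) ω p ∧
      ∀ z w, p z = p w ↔ z - w ∈ Λ

/-- Hermitian metrics on `X`, i.e. smooth Hermitian metrics on the holomorphic tangent bundle,
linear in the first and conjugate-linear in the second argument. -/
structure HermitianMetric where
  /-- the Hermitian form on the tangent space at `x` -/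
  form (x : X) : TX N x →ₗ[ℂ] TX N x →ₗ⋆[ℂ] ℂ
  conj_symm (x : X) (v w : TX N x) : starRingEnd ℂ (form x v w) = form x w v
  pos (x : X) (v : TX N x) (hv : v ≠ 0) : 0 < (form x v v).re
  smooth (y : OpenPartialHomeomorph X (Cn N)) (hy : y ∈ IsManifold.maximalAtlas 𝓘(ℂ, Cn N) ω X)
    (i j : Fin N) :
    ContDiffOn ℝ ∞ (fun z => form (y.symm z) (coordVec y z i) (coordVec y z j)) y.target

variable {N X}

namespace HermitianMetric

variable (h : HermitianMetric N X)

/-- The matrix `G_ij = (∂/∂y_i, ∂/∂y_j)` in the coordinate system `y`. -/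
def gram (y : OpenPartialHomeomorph X (Cn N)) (z : Cn N) : Matrix (Fin N) (Fin N) ℂ :=
  Matrix.of fun i j => h.form (y.symm z) (coordVec y z i) (coordVec y z j)

/-- The metric is Kähler: the form with coefficients `G_ij` is closed, i.e.
`∂G_ij/∂y_k = ∂G_kj/∂y_i` in every coordinate system. -/
def IsKahler : Prop :=
  ∀ y ∈ IsManifold.maximalAtlas 𝓘(ℂ, Cn N) ω X, ∀ z ∈ y.target, ∀ i j k : Fin N,
    del (fun z' => h.gram y z' i j) z (Pi.single k 1) =
      del (fun z' => h.gram y z' k j) z (Pi.single i 1)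

/-- The metric is flat: the curvature `Θ = ∂̄θ` of its Chern connection vanishes. -/
def IsFlat : Prop :=
  ∀ y ∈ IsManifold.maximalAtlas 𝓘(ℂ, Cn N) ω X, ∀ z ∈ y.target, ∀ (i j : Fin N) (v w : Cn N),
    delBar (fun z' => chernForm (h.gram y) z' v i j) z w = 0

open Classical in
/-- The tangent vector `u` with `a(v) = (v, u)` for all tangent vectors `v`. -/
def riesz (x : X) (a : TXDual N x) : TX N x :=
  if hu : ∃ u, ∀ v, a v = h.form x v u then hu.choose else 0

/-- The induced Hermitian metric on the cotangent bundle. -/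
def dual (x : X) (a b : TXDual N x) : ℂ := h.form x (h.riesz x b) (h.riesz x a)

end HermitianMetric

variable (N) in
/-- The holomorphic vector bundle `T^{⊕ a} ⊕ (T^*)^{⊕ b}` on `X`, with `T^{⊕ a} = Hom(ℂ^a, T)` and
`(T^*)^{⊕ b} = Hom(T, ℂ^b)`. -/
abbrev SumBundle (a b : ℕ) (x : X) : Type :=
  (Cn a →L[ℂ] TX N x) × (TX N x →L[ℂ] Cn b)

variable (N) in
/-- The model fibre of `T^{⊕ a} ⊕ (T^*)^{⊕ b}`. -/
abbrev SumFibre (a b : ℕ) : Type := (Cn a →L[ℂ] Cn N) × (Cn N →L[ℂ] Cn b)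

variable (N) in
/-- An index set for the frames of `T^{⊕ a} ⊕ (T^*)^{⊕ b}`, a bundle of rank `aN + bN`. -/
abbrev SumIdx (a b : ℕ) : Type := (Fin a × Fin N) ⊕ (Fin b × Fin N)

/-- The Hermitian metric on `T^{⊕ a} ⊕ (T^*)^{⊕ b}` induced by a Hermitian metric on `X`, the
orthogonal sum of the metrics on the summands. -/
def HermitianMetric.sum (h : HermitianMetric N X) (a b : ℕ) (x : X) (u v : SumBundle N a b x) : ℂ :=
  ∑ k, h.form x (u.1 (Pi.single k 1)) (v.1 (Pi.single k 1)) +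
    ∑ k, h.dual x ((ContinuousLinearMap.proj k : Cn b →L[ℂ] ℂ).comp u.2)
      ((ContinuousLinearMap.proj k : Cn b →L[ℂ] ℂ).comp v.2)

end Torus

end JetBundle

end

open JetBundle

/-!
A flat Hermitian metric on a complex torus is constant, so `A_m(E, F)` has a global trivialization
in which `∇̃` is the trivial connection `d`; then both holomorphic and parallel sections are the
constant ones.

*The metric is constant.* Let `p : ℂ^N → X` be the covering map and `G` the matrix of the pulled
back metric, a function that is periodic with respect to the lattice. Flatness says that the
connection form `θ(v) = ∂_v G · G⁻¹` is holomorphic. It is also periodic, hence constant by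
Liouville's theorem. From `∂_v G = θ(v) G` and `∂̄_v G = G θ(v)^*` one gets
`∂_v ∂̄_v G = θ(v) G θ(v)^*`, so that each diagonal entry of `G` is subharmonic on every complex
line; at a point where it is maximal this forces the corresponding row of `θ(v)` to vanish. Thus
`θ = 0` and `G` is constant (`metric_const_of_flat_of_periodic`).

*The trivialization.* The local inverses of `p`, with the frames of `E` and `F` that come from the
standard vector fields and one-forms of `ℂ^N`, are local data of which any two are related by a
translation of the coordinates and the identity on the frames. Hence the transition functions of
`A_m(E, F)` between them are the identity (`IsTorusCover.trans_eq_id_of_isStandard`), and the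
matrices of all metrics are constant (`IsTorusCover.isFlat_of_isStandard`). Call the latter
property of local data flat.

*The connection.* Let `β` be flat and `α` arbitrary, with `g` the matrix of the change of one of
the frames (of `T^*`, `E` or `F`) from `α` to `β`, and `H`, `C` the matrices of the metric for `α`
and `β`. Then `H⁻¹ = g^* C⁻¹ g`, where `g^*` is antiholomorphic, so that `D` is linear over its
entries. Therefore the elements `Y`, `E`, `F` for `α` are the images of the generators for `β`
under the transition function, up to the substitution `g⁻¹` that does not see the upper index
(`adapted_eq`, `isoAB_trans`). So a section whose representative in `β` is constant corresponds to
a section of `B_m(E, F)` that is constant in the frames of `β`, and such a section is parallel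
for the Chern connections since `θ = -g⁻¹ ∂g` (`nablaTilde_eq_zero`). With `α = β` it follows that
`∇̃` is `d` in flat data (`nablaTilde_of_isFlat`). This uses that the transition functions satisfy
the cocycle condition (`trans_trans`), which holds because `D` is natural under changes of
coordinates (`totalD_natural`).

*Conclusion.* In the global trivialization a holomorphic section has as coefficients holomorphic
functions on a torus, and a parallel section functions with vanishing differential; both are
constant. Conversely, constant sections are parallel by the above, and they are holomorphic since
the transition functions are. Restriction to a fibre is injective on constant sections, and it is
surjective because every element of a fibre extends to a constant section, again by the cocycle
condition.
-/

noncomputable section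

set_option linter.unusedSectionVars false

namespace JetBundle

section AlgebraLemmas

/-! ### Generators and endomorphisms of `R_∞` -/

variable {N : ℕ} {ιE ιF : Type}

/-- Induction on `R_∞`: it is generated by the generators as an algebra. -/
theorem RAlg.induction {C : RAlg N ιE ιF → Prop} (h0 : ∀ c : ℂ, C (algebraMap ℂ _ c))
    (hg : ∀ g, C (gen g)) (ha : ∀ a b, C a → C b → C (a + b))
    (hm : ∀ a b, C a → C b → C (a * b)) (r : RAlg N ιE ιF) : C r := by
  have hz : C 0 := by simpa using h0 0
  induction r using TensorProduct.induction_on with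
  | zero => exact hz
  | add x y hx hy => exact ha _ _ hx hy
  | tmul p q =>
    have e : p ⊗ₜ[ℂ] q = (p ⊗ₜ[ℂ] (1 : ExteriorAlgebra ℂ (OddIdx ιF →₀ ℂ))) *
        ((1 : MvPolynomial (EvenIdx N ιE) ℂ) ⊗ₜ[ℂ] q) := by
      simp [Algebra.TensorProduct.tmul_mul_tmul]
    rw [e]
    clear e
    refine hm _ _ ?_ ?_
    · induction p using MvPolynomial.induction_on with
      | C a => exact h0 a
      | add p q hp hq => rw [TensorProduct.add_tmul]; exact ha _ _ hp hq
      | mul_X p s hp =>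
        have : (p * MvPolynomial.X s) ⊗ₜ[ℂ] (1 : ExteriorAlgebra ℂ (OddIdx ιF →₀ ℂ)) =
            p ⊗ₜ[ℂ] 1 * gen (.inl s) := by
          simp [gen, Algebra.TensorProduct.tmul_mul_tmul]
        rw [this]
        exact hm _ _ hp (hg _)
    · induction q using ExteriorAlgebra.induction with
      | algebraMap c =>
        have : (1 : MvPolynomial (EvenIdx N ιE) ℂ) ⊗ₜ[ℂ]
            (algebraMap ℂ (ExteriorAlgebra ℂ (OddIdx ιF →₀ ℂ)) c) =
            algebraMap ℂ (RAlg N ιE ιF) c := by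
          rw [Algebra.TensorProduct.algebraMap_apply, Algebra.algebraMap_eq_smul_one,
            Algebra.algebraMap_eq_smul_one, TensorProduct.smul_tmul]
        rw [this]; exact h0 c
      | ι v =>
        induction v using Finsupp.induction_linear with
        | zero => simpa using hz
        | add v w hv hw => rw [map_add, TensorProduct.tmul_add]; exact ha _ _ hv hw
        | single t c =>
          have : (1 : MvPolynomial (EvenIdx N ιE) ℂ) ⊗ₜ[ℂ]
              (ExteriorAlgebra.ι ℂ (Finsupp.single t c)) =
              algebraMap ℂ (RAlg N ιE ιF) c * gen (.inr t) := by
            rw [← mul_one c, ← smul_eq_mul, ← Finsupp.smul_single, map_smul,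
              TensorProduct.tmul_smul, ← Algebra.smul_def]
            simp [gen]
          rw [this]
          exact hm _ _ (h0 c) (hg _)
      | mul a b ha' hb' =>
        have : (1 : MvPolynomial (EvenIdx N ιE) ℂ) ⊗ₜ[ℂ] (a * b) = (1 ⊗ₜ[ℂ] a) * (1 ⊗ₜ[ℂ] b) := by
          simp [Algebra.TensorProduct.tmul_mul_tmul]
        rw [this]; exact hm _ _ ha' hb'
      | add a b ha' hb' => rw [TensorProduct.tmul_add]; exact ha _ _ ha' hb'

theorem RAlg.algHom_ext {A : Type*} [Semiring A] [Algebra ℂ A] {φ ψ : RAlg N ιE ιF →ₐ[ℂ] A}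
    (h : ∀ g, φ (gen g) = ψ (gen g)) : φ = ψ := by
  refine AlgHom.ext fun r => ?_
  induction r using RAlg.induction with
  | h0 c => rw [AlgHom.commutes, AlgHom.commutes]
  | hg g => exact h g
  | ha a b h1 h2 => simp [h1, h2]
  | hm a b h1 h2 => simp [h1, h2]

variable (N ιE ιF) in
/-- The polynomial part `ℂ[y, e] ⊗ 1` of `R_∞`, a central subalgebra that contains the even
generators. -/
def evenPart : Subalgebra ℂ (RAlg N ιE ιF) :=
  (Algebra.TensorProduct.includeLeft (R := ℂ) (S := ℂ) (A := MvPolynomial (EvenIdx N ιE) ℂ)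
    (B := ExteriorAlgebra ℂ (OddIdx ιF →₀ ℂ))).range

variable (N ιE ιF) in
/-- The part `ℂ[y, e] ⊗ ⋀¹` of `R_∞` that is linear in the odd generators. -/
def oddPart : Submodule ℂ (RAlg N ιE ιF) :=
  Submodule.span ℂ {r | ∃ p v, r = p ⊗ₜ[ℂ] ExteriorAlgebra.ι ℂ v}

theorem mem_evenPart {r : RAlg N ιE ιF} : r ∈ evenPart N ιE ιF ↔ ∃ p, p ⊗ₜ[ℂ] 1 = r := Iff.rfl

theorem tmul_one_mul_comm (p : MvPolynomial (EvenIdx N ιE) ℂ) (r : RAlg N ιE ιF) :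
    (p ⊗ₜ[ℂ] 1) * r = r * (p ⊗ₜ[ℂ] 1) := by
  induction r using TensorProduct.induction_on with
  | zero => simp
  | add x y hx hy => rw [mul_add, add_mul, hx, hy]
  | tmul a b => simp [Algebra.TensorProduct.tmul_mul_tmul, mul_comm]

theorem mul_comm_of_mem_evenPart {a : RAlg N ιE ιF} (ha : a ∈ evenPart N ιE ιF)
    (r : RAlg N ιE ιF) : a * r = r * a := by
  obtain ⟨p, rfl⟩ := mem_evenPart.1 ha
  exact tmul_one_mul_comm p r

theorem yGen_mem_evenPart (i : Fin N) (l : ℕ) :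
    (yGen i l : RAlg N ιE ιF) ∈ evenPart N ιE ιF := ⟨_, rfl⟩

theorem yGen_comm (i : Fin N) (l : ℕ) (r : RAlg N ιE ιF) : yGen i l * r = r * yGen i l :=
  mul_comm_of_mem_evenPart (yGen_mem_evenPart i l) r

theorem eGen_mem_evenPart (i : ιE) (l : ℕ) :
    (eGen i l : RAlg N ιE ιF) ∈ evenPart N ιE ιF := ⟨_, rfl⟩

theorem fGen_mem_oddPart (i : ιF) (l : ℕ) :
    (fGen i l : RAlg N ιE ιF) ∈ oddPart N ιE ιF :=
  Submodule.subset_span ⟨1, _, rfl⟩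

theorem evenPart_mul_oddPart {a b : RAlg N ιE ιF} (ha : a ∈ evenPart N ιE ιF)
    (hb : b ∈ oddPart N ιE ιF) : a * b ∈ oddPart N ιE ιF := by
  obtain ⟨q, rfl⟩ := mem_evenPart.1 ha
  induction hb using Submodule.span_induction with
  | mem x hx =>
    obtain ⟨p, v, rfl⟩ := hx
    refine Submodule.subset_span ⟨q * p, v, ?_⟩
    simp [Algebra.TensorProduct.tmul_mul_tmul]
  | zero => simp
  | add x y _ _ hx hy => rw [mul_add]; exact add_mem hx hy
  | smul c x _ hx => rw [mul_smul_comm]; exact Submodule.smul_mem _ _ hx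

theorem oddPart_anticomm {a b : RAlg N ιE ιF} (ha : a ∈ oddPart N ιE ιF)
    (hb : b ∈ oddPart N ιE ιF) : a * b + b * a = 0 := by
  induction ha, hb using Submodule.span_induction₂ with
  | mem_mem x y hx hy =>
    obtain ⟨p, v, rfl⟩ := hx
    obtain ⟨q, w, rfl⟩ := hy
    rw [Algebra.TensorProduct.tmul_mul_tmul, Algebra.TensorProduct.tmul_mul_tmul, mul_comm q p,
      ← TensorProduct.tmul_add]
    have : ExteriorAlgebra.ι ℂ v * ExteriorAlgebra.ι ℂ w +
        ExteriorAlgebra.ι ℂ w * ExteriorAlgebra.ι ℂ v = 0 := by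
      simp
    rw [this, TensorProduct.tmul_zero]
  | zero_left y hy => simp
  | zero_right x hx => simp
  | add_left x y z _ _ _ h1 h2 =>
    rw [add_mul, mul_add, add_add_add_comm, h1, h2, add_zero]
  | add_right x y z _ _ _ h1 h2 =>
    rw [add_mul, mul_add, add_add_add_comm, h1, h2, add_zero]
  | smul_left c x y _ _ h => rw [smul_mul_assoc, mul_smul_comm, ← smul_add, h, smul_zero]
  | smul_right c x y _ _ h => rw [smul_mul_assoc, mul_smul_comm, ← smul_add, h, smul_zero]

theorem oddPart_mul_self {a : RAlg N ιE ιF} (ha : a ∈ oddPart N ιE ιF) : a * a = 0 := by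
  have h := oddPart_anticomm ha ha
  rw [← two_smul ℂ] at h
  exact (smul_eq_zero.1 h).resolve_left two_ne_zero

/-- An algebra endomorphism of `R_∞` may be prescribed on the generators, provided that parities
are respected. -/
theorem exists_algHom_gen (v : GenIdx N ιE ιF → RAlg N ιE ιF)
    (he : ∀ s, v (.inl s) ∈ evenPart N ιE ιF) (ho : ∀ t, v (.inr t) ∈ oddPart N ιE ιF) :
    ∃ φ : RAlg N ιE ιF →ₐ[ℂ] RAlg N ιE ιF, ∀ g, φ (gen g) = v g := by
  choose p hp using fun s => mem_evenPart.1 (he s)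
  have hlin : ∀ x, Finsupp.linearCombination ℂ (fun t => v (.inr t)) x ∈ oddPart N ιE ιF := by
    intro x
    rw [Finsupp.linearCombination_apply]
    exact Submodule.sum_mem _ fun t _ => Submodule.smul_mem _ _ (ho t)
  let F : ExteriorAlgebra ℂ (OddIdx ιF →₀ ℂ) →ₐ[ℂ] RAlg N ιE ιF :=
    ExteriorAlgebra.lift ℂ ⟨Finsupp.linearCombination ℂ (fun t => v (.inr t)),
      fun x => oddPart_mul_self (hlin x)⟩
  let E : MvPolynomial (EvenIdx N ιE) ℂ →ₐ[ℂ] RAlg N ιE ιF :=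
    (Algebra.TensorProduct.includeLeft (R := ℂ) (S := ℂ)).comp (MvPolynomial.aeval p)
  refine ⟨Algebra.TensorProduct.lift E F fun x y => ?_, ?_⟩
  · exact mul_comm_of_mem_evenPart (mem_evenPart.2 ⟨MvPolynomial.aeval p x, rfl⟩) _
  · rintro (s | t)
    · simp [gen, E, hp]
    · refine (Algebra.TensorProduct.lift_tmul _ _ _ _ _).trans ?_
      rw [map_one, one_mul]
      simp [F]

theorem homOfValues_apply {u v : GenIdx N ιE ιF → RAlg N ιE ιF}
    (h : ∃ φ : RAlg N ιE ιF →ₐ[ℂ] RAlg N ιE ιF, ∀ g, φ (u g) = v g) (g : GenIdx N ιE ιF) :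
    homOfValues u v (u g) = v g := by
  unfold homOfValues
  rw [dif_pos h]
  exact h.choose_spec g

/-! ### Derivations of `R_∞` -/

section ExtDer

variable {M : Type} [AddCommGroup M] [Module ℂ M] (L : M →ₗ[ℂ] M)

theorem fst_extDualHom (a : ExteriorAlgebra ℂ M) : (extDualHom L a).fst = a := by
  have : (TrivSqZeroExt.fstHom ℂ (ExteriorAlgebra ℂ M) (ExteriorAlgebra ℂ M)).comp (extDualHom L) =
      AlgHom.id ℂ _ := by
    ext v
    simp [extDualHom]
  exact DFunLike.congr_fun this a

theorem extDer_mul (a b : ExteriorAlgebra ℂ M) :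
    extDer L (a * b) = extDer L a * b + a * extDer L b := by
  have h := congrArg TrivSqZeroExt.snd (map_mul (extDualHom L) a b)
  rw [TrivSqZeroExt.snd_mul, fst_extDualHom, fst_extDualHom] at h
  simpa [extDer, add_comm] using h

theorem extDer_ι (v : M) : extDer L (ExteriorAlgebra.ι ℂ v) = ExteriorAlgebra.ι ℂ (L v) := by
  simp [extDer, extDualHom]

theorem extDer_one : extDer L 1 = 0 := by
  simp [extDer]

end ExtDer

section AlgDer

variable (p : EvenIdx N ιE → MvPolynomial (EvenIdx N ιE) ℂ)
  (L : (OddIdx ιF →₀ ℂ) →ₗ[ℂ] (OddIdx ιF →₀ ℂ))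

theorem algDer_tmul (a : MvPolynomial (EvenIdx N ιE) ℂ)
    (b : ExteriorAlgebra ℂ (OddIdx ιF →₀ ℂ)) :
    algDer p L (a ⊗ₜ[ℂ] b) = MvPolynomial.mkDerivation ℂ p a ⊗ₜ[ℂ] b + a ⊗ₜ[ℂ] extDer L b := by
  simp [algDer]

theorem algDer_mul (a b : RAlg N ιE ιF) :
    algDer p L (a * b) = algDer p L a * b + a * algDer p L b := by
  induction a using TensorProduct.induction_on with
  | zero => simp
  | add x y hx hy => rw [add_mul, map_add, hx, hy, map_add]; noncomm_ring
  | tmul a a' =>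
    induction b using TensorProduct.induction_on with
    | zero => simp
    | add x y hx hy => rw [mul_add, map_add, hx, hy, map_add]; noncomm_ring
    | tmul b b' =>
      simp only [Algebra.TensorProduct.tmul_mul_tmul, algDer_tmul, extDer_mul, Derivation.leibniz,
        TensorProduct.add_tmul, TensorProduct.tmul_add, add_mul, mul_add, smul_eq_mul]
      rw [mul_comm b]
      abel

theorem algDer_one : algDer p L (1 : RAlg N ιE ιF) = 0 := by
  rw [Algebra.TensorProduct.one_def, algDer_tmul]
  simp [extDer_one]

theorem algDer_algebraMap (c : ℂ) : algDer p L (algebraMap ℂ (RAlg N ιE ιF) c) = 0 := by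
  rw [Algebra.algebraMap_eq_smul_one, map_smul, algDer_one, smul_zero]

theorem algDer_gen_inl (s : EvenIdx N ιE) :
    algDer p L (gen (.inl s) : RAlg N ιE ιF) = p s ⊗ₜ[ℂ] 1 := by
  simp [gen, algDer_tmul, extDer_one]

theorem algDer_gen_inr (t : OddIdx ιF) :
    algDer p L (gen (.inr t) : RAlg N ιE ιF) =
      1 ⊗ₜ[ℂ] ExteriorAlgebra.ι ℂ (L (Finsupp.single t 1)) := by
  simp [gen, algDer_tmul, extDer_ι]

theorem algDer_mem_evenPart {a : RAlg N ιE ιF} (ha : a ∈ evenPart N ιE ιF) :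
    algDer p L a ∈ evenPart N ιE ιF := by
  obtain ⟨q, rfl⟩ := mem_evenPart.1 ha
  rw [algDer_tmul, extDer_one, TensorProduct.tmul_zero, add_zero]
  exact ⟨_, rfl⟩

theorem algDer_mem_oddPart {a : RAlg N ιE ιF} (ha : a ∈ oddPart N ιE ιF) :
    algDer p L a ∈ oddPart N ιE ιF := by
  induction ha using Submodule.span_induction with
  | mem x hx =>
    obtain ⟨q, v, rfl⟩ := hx
    rw [algDer_tmul, extDer_ι]
    exact add_mem (Submodule.subset_span ⟨_, _, rfl⟩) (Submodule.subset_span ⟨_, _, rfl⟩)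
  | zero => simp
  | add x y _ _ hx hy => rw [map_add]; exact add_mem hx hy
  | smul c x _ hx => rw [map_smul]; exact Submodule.smul_mem _ _ hx

end AlgDer

theorem shiftDer_mul (a b : RAlg N ιE ιF) :
    shiftDer (a * b) = shiftDer a * b + a * shiftDer b := algDer_mul _ _ a b

theorem shiftDer_algebraMap (c : ℂ) : shiftDer (algebraMap ℂ (RAlg N ιE ιF) c) = 0 :=
  algDer_algebraMap _ _ c

theorem shiftDer_yGen (i : Fin N) (l : ℕ) :
    shiftDer (yGen i l : RAlg N ιE ιF) = yGen i (l + 1) := algDer_gen_inl _ _ _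

theorem shiftDer_eGen (i : ιE) (l : ℕ) :
    shiftDer (eGen i l : RAlg N ιE ιF) = eGen i (l + 1) := algDer_gen_inl _ _ _

theorem shiftDer_fGen (i : ιF) (l : ℕ) :
    shiftDer (fGen i l : RAlg N ιE ιF) = fGen i (l + 1) := by
  refine (algDer_gen_inr _ _ _).trans ?_
  simp [fGen, gen, Finsupp.mapDomain_single]

section MatrixDer

variable [Fintype ιE] [Fintype ιF] (A : Matrix (Fin N) (Fin N) ℂ) (B : Matrix ιE ιE ℂ)
  (C : Matrix ιF ιF ℂ)

theorem matrixDer_mul (a b : RAlg N ιE ιF) :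
    matrixDer A B C (a * b) = matrixDer A B C a * b + a * matrixDer A B C b := algDer_mul _ _ a b

theorem matrixDer_algebraMap (c : ℂ) : matrixDer A B C (algebraMap ℂ (RAlg N ιE ιF) c) = 0 :=
  algDer_algebraMap _ _ c

theorem matrixDer_yGen (i : Fin N) (l : ℕ) :
    matrixDer A B C (yGen i l : RAlg N ιE ιF) = ∑ j, A i j • yGen j l := by
  refine (algDer_gen_inl _ _ _).trans ?_
  simp [yGen, gen, TensorProduct.sum_tmul, TensorProduct.smul_tmul']

theorem matrixDer_eGen (i : ιE) (l : ℕ) :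
    matrixDer A B C (eGen i l : RAlg N ιE ιF) = ∑ j, B i j • eGen j l := by
  refine (algDer_gen_inl _ _ _).trans ?_
  simp [eGen, gen, TensorProduct.sum_tmul, TensorProduct.smul_tmul']

theorem matrixDer_fGen (i : ιF) (l : ℕ) :
    matrixDer A B C (fGen i l : RAlg N ιE ιF) = ∑ j, C i j • fGen j l := by
  refine (algDer_gen_inr _ _ _).trans ?_
  simp only [fGen, gen, Finsupp.linearCombination_single, one_smul, map_sum, map_smul,
    TensorProduct.tmul_sum, TensorProduct.tmul_smul]

end MatrixDer

/-! ### The subalgebras `R_m` -/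

theorem Rm_mono {m n : ℕ} (h : m ≤ n) : Rm N ιE ιF m ≤ Rm N ιE ιF n := by
  refine Algebra.adjoin_mono ?_
  rintro r ((⟨i, l, hl, rfl⟩ | ⟨i, l, hl, rfl⟩) | ⟨i, l, hl, rfl⟩)
  · exact Or.inl (Or.inl ⟨i, l, by omega, rfl⟩)
  · exact Or.inl (Or.inr ⟨i, l, by omega, rfl⟩)
  · exact Or.inr ⟨i, l, by omega, rfl⟩

theorem yGen_mem_Rm {i : Fin N} {l m : ℕ} (h : l < m) : yGen i l ∈ Rm N ιE ιF m :=
  Algebra.subset_adjoin (Or.inl (Or.inl ⟨i, l, h, rfl⟩))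

theorem eGen_mem_Rm {i : ιE} {l m : ℕ} (h : l ≤ m) : eGen i l ∈ Rm N ιE ιF m :=
  Algebra.subset_adjoin (Or.inl (Or.inr ⟨i, l, h, rfl⟩))

theorem fGen_mem_Rm {i : ιF} {l m : ℕ} (h : l ≤ m) : fGen i l ∈ Rm N ιE ιF m :=
  Algebra.subset_adjoin (Or.inr ⟨i, l, h, rfl⟩)

theorem shiftDer_mem_Rm {m : ℕ} {r : RAlg N ιE ιF} (hr : r ∈ Rm N ιE ιF m) :
    shiftDer r ∈ Rm N ιE ιF (m + 1) := by
  induction hr using Algebra.adjoin_induction with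
  | mem x hx =>
    rcases hx with (⟨i, l, hl, rfl⟩ | ⟨i, l, hl, rfl⟩) | ⟨i, l, hl, rfl⟩
    · rw [shiftDer_yGen]; exact yGen_mem_Rm (by omega)
    · rw [shiftDer_eGen]; exact eGen_mem_Rm (by omega)
    · rw [shiftDer_fGen]; exact fGen_mem_Rm (by omega)
  | algebraMap c => rw [shiftDer_algebraMap]; exact zero_mem _
  | add x y _ _ hx hy => rw [map_add]; exact add_mem hx hy
  | mul x y hx' hy' hx hy =>
    rw [shiftDer_mul]
    exact add_mem (mul_mem hx (Rm_mono (Nat.le_succ m) hy'))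
      (mul_mem (Rm_mono (Nat.le_succ m) hx') hy)

/-- An endomorphism of `R_∞` preserves `R_m` if it maps the generators of `R_m` to `R_m`. -/
theorem algHom_mem_Rm {m : ℕ} (φ : RAlg N ιE ιF →ₐ[ℂ] RAlg N ιE ιF)
    (hy : ∀ i l, l < m → φ (yGen i l) ∈ Rm N ιE ιF m)
    (he : ∀ i l, l ≤ m → φ (eGen i l) ∈ Rm N ιE ιF m)
    (hf : ∀ i l, l ≤ m → φ (fGen i l) ∈ Rm N ιE ιF m) {r : RAlg N ιE ιF}
    (hr : r ∈ Rm N ιE ιF m) : φ r ∈ Rm N ιE ιF m := by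
  induction hr using Algebra.adjoin_induction with
  | mem x hx =>
    rcases hx with (⟨i, l, hl, rfl⟩ | ⟨i, l, hl, rfl⟩) | ⟨i, l, hl, rfl⟩
    · exact hy i l hl
    · exact he i l hl
    · exact hf i l hl
  | algebraMap c => rw [AlgHom.commutes]; exact Subalgebra.algebraMap_mem _ c
  | add x y _ _ hx hy => rw [map_add]; exact add_mem hx hy
  | mul x y _ _ hx hy => rw [map_mul]; exact mul_mem hx hy

end AlgebraLemmas

section CalculusLemmas

open Filter Topology

variable {N : ℕ}

/-! ### Wirtinger derivatives of scalar functions -/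

/-- `(∂φ)(v)` at a point as a linear function of the real differential of `φ` there. -/
def delForm (v : Cn N) : (Cn N →L[ℝ] ℂ) →ₗ[ℂ] ℂ where
  toFun A := (A v - Complex.I * A (Complex.I • v)) / 2
  map_add' A B := by simp only [add_apply]; ring
  map_smul' c A := by simp only [smul_apply, smul_eq_mul, RingHom.id_apply]; ring

/-- An operator on scalar functions that depends `ℂ`-linearly on the real differential at `z` only,
such as a directional or a Wirtinger derivative at `z`. -/
def IsFirstOrderAt (δ : (Cn N → ℂ) → ℂ) (z : Cn N) : Prop :=
  ∃ Λ : (Cn N →L[ℝ] ℂ) →ₗ[ℂ] ℂ, ∀ φ, δ φ = Λ (fderiv ℝ φ z)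

theorem isFirstOrderAt_del (z v : Cn N) : IsFirstOrderAt (fun φ => del φ z v) z :=
  ⟨delForm v, fun _ => rfl⟩

theorem isFirstOrderAt_fderiv (z v : Cn N) : IsFirstOrderAt (fun φ => fderiv ℝ φ z v) z :=
  ⟨{ toFun := fun A => A v, map_add' := fun _ _ => rfl, map_smul' := fun _ _ => rfl },
    fun _ => rfl⟩

namespace IsFirstOrderAt

variable {δ : (Cn N → ℂ) → ℂ} {z : Cn N} (hδ : IsFirstOrderAt δ z)
include hδ

theorem congr {φ ψ : Cn N → ℂ} (h : φ =ᶠ[𝓝 z] ψ) : δ φ = δ ψ := by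
  obtain ⟨Λ, hΛ⟩ := hδ
  rw [hΛ, hΛ, h.fderiv_eq]

theorem const (c : ℂ) : δ (fun _ => c) = 0 := by
  obtain ⟨Λ, hΛ⟩ := hδ
  rw [hΛ, fderiv_fun_const, Pi.zero_apply, map_zero]

theorem mul {φ ψ : Cn N → ℂ} (hφ : DifferentiableAt ℝ φ z) (hψ : DifferentiableAt ℝ ψ z) :
    δ (fun z' => φ z' * ψ z') = δ φ * ψ z + φ z * δ ψ := by
  obtain ⟨Λ, hΛ⟩ := hδ
  rw [hΛ, hΛ, hΛ, fderiv_fun_mul hφ hψ, map_add, map_smul, map_smul, smul_eq_mul, smul_eq_mul]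
  ring

theorem sum_mul {κ : Type*} [Fintype κ] {φ : κ → Cn N → ℂ} (hφ : ∀ k, DifferentiableAt ℝ (φ k) z)
    (c : κ → ℂ) : δ (fun z' => ∑ k, φ k z' * c k) = ∑ k, δ (φ k) * c k := by
  have h1 : ∀ k, δ (fun z' => φ k z' * c k) = δ (φ k) * c k := fun k => by
    rw [hδ.mul (hφ k) (differentiableAt_const _), hδ.const, mul_zero, add_zero]
  simp_rw [← h1]
  obtain ⟨Λ, hΛ⟩ := hδ
  simp_rw [hΛ]
  rw [fderiv_fun_sum (A := fun k z' => φ k z' * c k)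
    fun k _ => (hφ k).mul (differentiableAt_const _), map_sum]

end IsFirstOrderAt

theorem del_add_vec (φ : Cn N → ℂ) (z v w : Cn N) : del φ z (v + w) = del φ z v + del φ z w := by
  simp only [del, map_add, smul_add]; ring

theorem map_complex_smul (A : Cn N →L[ℝ] ℂ) (c : ℂ) (v : Cn N) :
    A (c • v) = c.re * A v + c.im * A (Complex.I • v) := by
  have : c • v = c.re • v + c.im • (Complex.I • v) := by
    rw [← Complex.coe_smul, ← Complex.coe_smul, smul_smul, ← add_smul, Complex.re_add_im]
  rw [this, map_add, map_smul, map_smul, Complex.real_smul, Complex.real_smul]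

theorem del_smul_vec (φ : Cn N → ℂ) (z v : Cn N) (c : ℂ) : del φ z (c • v) = c * del φ z v := by
  simp only [del, smul_smul, map_complex_smul _ c, map_complex_smul _ (Complex.I * c)]
  have : c = c.re + c.im * Complex.I := (Complex.re_add_im c).symm
  simp only [Complex.mul_re, Complex.mul_im, Complex.I_re, Complex.I_im]
  generalize fderiv ℝ φ z v = a
  generalize fderiv ℝ φ z (Complex.I • v) = b
  rw [this]
  simp only [Complex.add_re, Complex.mul_re, Complex.ofReal_re, Complex.ofReal_im, Complex.I_re,
    Complex.I_im, Complex.add_im, Complex.mul_im]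
  push_cast
  linear_combination (b * c.im / 2) * Complex.I_mul_I

theorem del_eq_sum (φ : Cn N → ℂ) (z v : Cn N) :
    del φ z v = ∑ j, v j * del φ z (Pi.single j 1) := by
  let A : Cn N →ₗ[ℂ] ℂ :=
    { toFun := del φ z, map_add' := del_add_vec φ z, map_smul' := fun c v => del_smul_vec φ z v c }
  have h := congrArg A (pi_eq_sum_univ' v)
  simp only [map_sum, map_smul, smul_eq_mul] at h
  refine h.trans (Finset.sum_congr rfl fun j _ => ?_)
  congr 2

theorem del_of_differentiableAt {φ : Cn N → ℂ} {z : Cn N} (h : DifferentiableAt ℂ φ z)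
    (v : Cn N) : del φ z v = fderiv ℂ φ z v := by
  have e : fderiv ℝ φ z = (fderiv ℂ φ z).restrictScalars ℝ :=
    (h.hasFDerivAt.restrictScalars ℝ).fderiv
  simp only [del, e, ContinuousLinearMap.coe_restrictScalars', map_smul, smul_eq_mul]
  linear_combination (-(fderiv ℂ φ z v) / 2) * Complex.I_mul_I

theorem fderiv_real_eq_del {φ : Cn N → ℂ} {z : Cn N} (h : DifferentiableAt ℂ φ z)
    (v : Cn N) : fderiv ℝ φ z v = del φ z v := by
  rw [del_of_differentiableAt h, (h.hasFDerivAt.restrictScalars ℝ).fderiv]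
  rfl

/-- `∂` annihilates antiholomorphic functions. -/
theorem del_conj {φ : Cn N → ℂ} {z : Cn N} (h : DifferentiableAt ℂ φ z) (v : Cn N) :
    del (fun z' => starRingEnd ℂ (φ z')) z v = 0 := by
  have e : fderiv ℝ (fun z' => starRingEnd ℂ (φ z')) z =
      (Complex.conjCLE : ℂ →L[ℝ] ℂ).comp ((fderiv ℂ φ z).restrictScalars ℝ) :=
    ((Complex.conjCLE : ℂ →L[ℝ] ℂ).hasFDerivAt.comp z
      (h.hasFDerivAt.restrictScalars ℝ)).fderiv
  simp only [del, e, ContinuousLinearMap.comp_apply, ContinuousLinearMap.coe_restrictScalars',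
    map_smul, smul_eq_mul, ContinuousLinearEquiv.coe_coe, Complex.conjCLE_apply, map_mul,
    Complex.conj_I]
  linear_combination (starRingEnd ℂ (fderiv ℂ φ z v) / 2) * Complex.I_mul_I

theorem del_comp {φ : Cn N → ℂ} {τ : Cn N → Cn N} {z : Cn N} (hφ : DifferentiableAt ℝ φ (τ z))
    (hτ : DifferentiableAt ℂ τ z) (v : Cn N) :
    del (fun z' => φ (τ z')) z v =
      ∑ j, del φ (τ z) (Pi.single j 1) * del (fun z' => τ z' j) z v := by
  have e : fderiv ℝ (fun z' => φ (τ z')) z =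
      (fderiv ℝ φ (τ z)).comp ((fderiv ℂ τ z).restrictScalars ℝ) :=
    (hφ.hasFDerivAt.comp z (hτ.hasFDerivAt.restrictScalars ℝ)).fderiv
  have h1 : del (fun z' => φ (τ z')) z v = del φ (τ z) (fderiv ℂ τ z v) := by
    simp only [del, e, ContinuousLinearMap.comp_apply, ContinuousLinearMap.coe_restrictScalars',
      map_smul]
  rw [h1, del_eq_sum]
  refine Finset.sum_congr rfl fun j _ => ?_
  rw [del_of_differentiableAt (differentiableAt_pi.1 hτ j), fderiv_apply hτ j, mul_comm]
  rfl

theorem _root_.AnalyticAt.del {φ : Cn N → ℂ} {z : Cn N} (h : AnalyticAt ℂ φ z) (v : Cn N) :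
    AnalyticAt ℂ (fun z' => JetBundle.del φ z' v) z := by
  have h1 : AnalyticAt ℂ (fun z' => fderiv ℂ φ z' v) z :=
    ((ContinuousLinearMap.apply ℂ ℂ v).analyticAt _).comp h.fderiv
  refine h1.congr ?_
  filter_upwards [h.eventually_analyticAt] with z' hz'
  exact (del_of_differentiableAt hz'.differentiableAt v).symm

/-! ### Finite sums of scalar functions times vectors -/

variable {W : Type} [AddCommGroup W] [Module ℂ W]

theorem sum_smul_mul_sum_smul {A : Type} [Ring A] [Algebra ℂ A] {κ κ' : Type*} [Fintype κ]
    [Fintype κ'] (a : κ → ℂ) (b : κ' → ℂ) (u : κ → A) (v : κ' → A) :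
    (∑ k, a k • u k) * (∑ k, b k • v k) =
      ∑ k : κ × κ', (a k.1 * b k.2) • (u k.1 * v k.2) := by
  rw [Finset.sum_mul_sum, Fintype.sum_prod_type]
  exact Finset.sum_congr rfl fun k _ => Finset.sum_congr rfl fun k' _ => smul_mul_smul_comm _ _ _ _

/-- Near `z`, the function `g` is a finite sum `∑ φ_k w_k` with `w_k ∈ W` and scalar functions
`φ_k` that satisfy `P` at `z`. -/
def FinSumAt (P : (Cn N → ℂ) → Cn N → Prop) (g : Cn N → W) (z : Cn N) : Prop :=
  ∃ (n : ℕ) (φ : Fin n → Cn N → ℂ) (w : Fin n → W),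
    (∀ k, P (φ k) z) ∧ g =ᶠ[𝓝 z] fun z' => ∑ k, φ k z' • w k

/-- `g` is near `z` a finite sum `∑ φ_k w_k` with `φ_k` real differentiable at `z`. -/
abbrev Dif (g : Cn N → W) (z : Cn N) : Prop := FinSumAt (fun φ z => DifferentiableAt ℝ φ z) g z

/-- `g` is near `z` a finite sum `∑ φ_k w_k` with `φ_k` complex analytic at `z`. -/
abbrev Hol (g : Cn N → W) (z : Cn N) : Prop := FinSumAt (fun φ z => AnalyticAt ℂ φ z) g z

theorem FinSumAt.of_fintype {P : (Cn N → ℂ) → Cn N → Prop} {g : Cn N → W} {z : Cn N}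
    {κ : Type*} [Fintype κ] (φ : κ → Cn N → ℂ) (w : κ → W) (hφ : ∀ k, P (φ k) z)
    (hg : g =ᶠ[𝓝 z] fun z' => ∑ k, φ k z' • w k) : FinSumAt P g z := by
  let e := Fintype.equivFin κ
  refine ⟨Fintype.card κ, fun k => φ (e.symm k), fun k => w (e.symm k), fun k => hφ _, ?_⟩
  filter_upwards [hg] with z' hz'
  rw [hz']
  exact (Equiv.sum_comp e.symm (fun k => φ k z' • w k)).symm

namespace FinSumAt

variable {P : (Cn N → ℂ) → Cn N → Prop} {g h : Cn N → W} {z : Cn N}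

theorem congr (hg : FinSumAt P g z) (e : h =ᶠ[𝓝 z] g) : FinSumAt P h z := by
  obtain ⟨n, φ, w, hφ, hw⟩ := hg
  exact ⟨n, φ, w, hφ, e.trans hw⟩

theorem add (hg : FinSumAt P g z) (hh : FinSumAt P h z) : FinSumAt P (fun z' => g z' + h z') z := by
  obtain ⟨n, φ, w, hφ, hw⟩ := hg
  obtain ⟨n', φ', w', hφ', hw'⟩ := hh
  refine of_fintype (κ := Fin n ⊕ Fin n') (Sum.elim φ φ') (Sum.elim w w') ?_ ?_
  · rintro (k | k)
    · exact hφ k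
    · exact hφ' k
  · filter_upwards [hw, hw'] with z' h1 h2
    simp [h1, h2]

theorem zero : FinSumAt P (fun _ => (0 : W)) z :=
  ⟨0, Fin.elim0, Fin.elim0, fun k => k.elim0, Eventually.of_forall fun _ => by simp⟩

theorem sum {κ : Type*} {s : Finset κ} {g : κ → Cn N → W} (hg : ∀ k ∈ s, FinSumAt P (g k) z) :
    FinSumAt P (fun z' => ∑ k ∈ s, g k z') z := by
  classical
  induction s using Finset.induction_on with
  | empty => simpa using zero
  | insert a s ha ih =>
    simp_rw [Finset.sum_insert ha]
    exact (hg a (Finset.mem_insert_self _ _)).add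
      (ih fun k hk => hg k (Finset.mem_insert_of_mem hk))

theorem smul_const {φ : Cn N → ℂ} (hφ : P φ z) (w : W) : FinSumAt P (fun z' => φ z' • w) z :=
  of_fintype (κ := Unit) (fun _ => φ) (fun _ => w) (fun _ => hφ) (by simp)

theorem map {W' : Type} [AddCommGroup W'] [Module ℂ W'] (L : W →ₗ[ℂ] W') (hg : FinSumAt P g z) :
    FinSumAt P (fun z' => L (g z')) z := by
  obtain ⟨n, φ, w, hφ, hw⟩ := hg
  refine ⟨n, φ, fun k => L (w k), hφ, ?_⟩
  filter_upwards [hw] with z' h1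
  simp [h1]

theorem mul {A : Type} [Ring A] [Algebra ℂ A] {g h : Cn N → A}
    (hP : ∀ φ ψ, P φ z → P ψ z → P (fun z' => φ z' * ψ z') z) (hg : FinSumAt P g z)
    (hh : FinSumAt P h z) : FinSumAt P (fun z' => g z' * h z') z := by
  obtain ⟨n, φ, w, hφ, hw⟩ := hg
  obtain ⟨n', φ', w', hφ', hw'⟩ := hh
  refine of_fintype (κ := Fin n × Fin n') (fun k z' => φ k.1 z' * φ' k.2 z')
    (fun k => w k.1 * w' k.2) (fun k => hP _ _ (hφ _) (hφ' _)) ?_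
  filter_upwards [hw, hw'] with z' h1 h2
  rw [h1, h2, sum_smul_mul_sum_smul]

end FinSumAt

theorem Dif.const (w : W) (z : Cn N) : Dif (fun _ => w) z :=
  (FinSumAt.smul_const (φ := fun _ => 1) (differentiableAt_const _) w).congr (by simp)

theorem Hol.const (w : W) (z : Cn N) : Hol (fun _ => w) z :=
  (FinSumAt.smul_const (φ := fun _ => 1) analyticAt_const w).congr (by simp)

theorem Dif.mul {A : Type} [Ring A] [Algebra ℂ A] {g h : Cn N → A} {z : Cn N} (hg : Dif g z)
    (hh : Dif h z) : Dif (fun z' => g z' * h z') z :=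
  FinSumAt.mul (fun _ _ h1 h2 => h1.mul h2) hg hh

theorem Hol.mul {A : Type} [Ring A] [Algebra ℂ A] {g h : Cn N → A} {z : Cn N} (hg : Hol g z)
    (hh : Hol h z) : Hol (fun z' => g z' * h z') z :=
  FinSumAt.mul (fun _ _ h1 h2 => h1.mul h2) hg hh

theorem Hol.dif {g : Cn N → W} {z : Cn N} (hg : Hol g z) : Dif g z := by
  obtain ⟨n, φ, w, hφ, hw⟩ := hg
  exact ⟨n, φ, w, fun k => (hφ k).differentiableAt.restrictScalars ℝ, hw⟩

theorem Hol.holomorphicOn {g : Cn N → W} {U : Set (Cn N)} (hg : ∀ z ∈ U, Hol g z) :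
    HolomorphicOn g U := by
  intro z hz
  obtain ⟨n, φ, w, hφ, hw⟩ := hg z hz
  obtain ⟨O, hO, hO', hzO⟩ := eventually_nhds_iff.1
    ((eventually_all.2 fun k => (hφ k).eventually_analyticAt).and hw)
  exact ⟨O, hO', hzO, n, φ, w,
    fun k z' hz' => ((hO z' hz').1 k).differentiableAt.differentiableWithinAt,
    fun z' hz' => (hO z' hz').2⟩

theorem SmoothOn.dif {g : Cn N → W} {U : Set (Cn N)} (hg : SmoothOn g U) {z : Cn N} (hz : z ∈ U) :
    Dif g z := by
  obtain ⟨O, hO, hzO, n, φ, w, hφ, hw⟩ := hg z hz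
  refine ⟨n, φ, w, fun k => ?_, eventually_of_mem (hO.mem_nhds hzO) hw⟩
  exact ((hφ k).contDiffAt (hO.mem_nhds hzO)).differentiableAt (by simp)

theorem Dif.differentiableAt {g : Cn N → W} {z : Cn N} (hg : Dif g z) (l : W →ₗ[ℂ] ℂ) :
    DifferentiableAt ℝ (fun z' => l (g z')) z := by
  obtain ⟨n, φ, w, hφ, hw⟩ := hg
  have : DifferentiableAt ℝ (fun z' => ∑ k, φ k z' * l (w k)) z :=
    DifferentiableAt.fun_sum fun k _ => (hφ k).mul (differentiableAt_const _)
  refine this.congr_of_eventuallyEq ?_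
  filter_upwards [hw] with z' h
  simp [h]

/-! ### The operator `coeffwise` -/

theorem coeffwise_eq {δ : (Cn N → ℂ) → ℂ} {g : Cn N → W} {w : W}
    (h : ∀ l : W →ₗ[ℂ] ℂ, l w = δ (fun z => l (g z))) : coeffwise δ g = w := by
  have hex : ∃ w : W, ∀ l : W →ₗ[ℂ] ℂ, l w = δ (fun z => l (g z)) := ⟨w, h⟩
  unfold coeffwise
  rw [dif_pos hex, ← sub_eq_zero, ← Module.forall_dual_apply_eq_zero_iff ℂ]
  intro l
  rw [map_sub, hex.choose_spec l, h l, sub_self]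

theorem coeffwise_eq_sum {δ : (Cn N → ℂ) → ℂ} {z : Cn N} (hδ : IsFirstOrderAt δ z)
    {g : Cn N → W} {κ : Type*} [Fintype κ] {φ : κ → Cn N → ℂ} {w : κ → W}
    (hφ : ∀ k, DifferentiableAt ℝ (φ k) z) (hg : g =ᶠ[𝓝 z] fun z' => ∑ k, φ k z' • w k) :
    coeffwise δ g = ∑ k, δ (φ k) • w k := by
  refine coeffwise_eq fun l => ?_
  have : (fun z' => l (g z')) =ᶠ[𝓝 z] fun z' => ∑ k, φ k z' * l (w k) := by
    filter_upwards [hg] with z' h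
    simp [h]
  rw [hδ.congr this, hδ.sum_mul hφ]
  simp

section

variable {δ : (Cn N → ℂ) → ℂ} {z : Cn N} (hδ : IsFirstOrderAt δ z)
include hδ

theorem coeffwise_congr {g h : Cn N → W} (e : g =ᶠ[𝓝 z] h) : coeffwise δ g = coeffwise δ h := by
  have e' : ∀ l : W →ₗ[ℂ] ℂ, δ (fun z => l (g z)) = δ (fun z => l (h z)) := fun l =>
    hδ.congr (by filter_upwards [e] with z' h'; rw [h'])
  by_cases hex : ∃ w : W, ∀ l : W →ₗ[ℂ] ℂ, l w = δ (fun z => l (g z))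
  · obtain ⟨w, hw⟩ := hex
    rw [coeffwise_eq hw, coeffwise_eq fun l => (hw l).trans (e' l)]
  · have hex' := hex
    simp_rw [e'] at hex'
    unfold coeffwise
    rw [dif_neg hex, dif_neg hex']

theorem coeffwise_apply {g : Cn N → W} (hg : Dif g z) (l : W →ₗ[ℂ] ℂ) :
    l (coeffwise δ g) = δ (fun z' => l (g z')) := by
  obtain ⟨n, φ, w, hφ, hw⟩ := hg
  have : (fun z' => l (g z')) =ᶠ[𝓝 z] fun z' => ∑ k, φ k z' * l (w k) := by
    filter_upwards [hw] with z' h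
    simp [h]
  rw [coeffwise_eq_sum hδ hφ hw, hδ.congr this, hδ.sum_mul hφ]
  simp

theorem coeffwise_const (w : W) : coeffwise δ (fun _ => w) = 0 :=
  coeffwise_eq fun l => by rw [map_zero, hδ.const]

/-- A derivative of a function with values in a subspace lies in the subspace, because the linear forms
that vanish on the subspace cut it out. No regularity of `g` is needed: where the derivative does
not exist, `coeffwise` takes the value `0`. -/
theorem coeffwise_mem {g : Cn N → W} (V : Submodule ℂ W) (hg : ∀ᶠ z' in 𝓝 z, g z' ∈ V) :
    coeffwise δ g ∈ V := by
  by_cases hex : ∃ w : W, ∀ l : W →ₗ[ℂ] ℂ, l w = δ (fun z => l (g z))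
  · obtain ⟨w, hw⟩ := hex
    rw [coeffwise_eq hw]
    by_contra hwV
    obtain ⟨l, hl, hlV⟩ := Submodule.exists_dual_map_eq_bot_of_notMem hwV inferInstance
    refine hl ?_
    rw [hw l, hδ.congr (ψ := fun _ => 0), hδ.const]
    filter_upwards [hg] with z' hz'
    exact (LinearMap.le_ker_iff_map).2 hlV hz'
  · unfold coeffwise
    rw [dif_neg hex]
    exact zero_mem _

theorem coeffwise_mul {A : Type} [Ring A] [Algebra ℂ A] {g h : Cn N → A} (hg : Dif g z)
    (hh : Dif h z) :
    coeffwise δ (fun z' => g z' * h z') = coeffwise δ g * h z + g z * coeffwise δ h := by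
  obtain ⟨n, φ, w, hφ, hw⟩ := hg
  obtain ⟨n', φ', w', hφ', hw'⟩ := hh
  have e : (fun z' => g z' * h z') =ᶠ[𝓝 z]
      fun z' => ∑ k : Fin n × Fin n', (φ k.1 z' * φ' k.2 z') • (w k.1 * w' k.2) := by
    filter_upwards [hw, hw'] with z' h1 h2
    rw [h1, h2, sum_smul_mul_sum_smul]
  have hd : ∀ k : Fin n × Fin n', DifferentiableAt ℝ (fun z' => φ k.1 z' * φ' k.2 z') z :=
    fun k => (hφ k.1).fun_mul (hφ' k.2)
  have hm : ∀ k : Fin n × Fin n', δ (fun z' => φ k.1 z' * φ' k.2 z') =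
      δ (φ k.1) * φ' k.2 z + φ k.1 z * δ (φ' k.2) := fun k => hδ.mul (hφ k.1) (hφ' k.2)
  rw [coeffwise_eq_sum hδ hd e, coeffwise_eq_sum hδ hφ hw,
    coeffwise_eq_sum hδ hφ' hw', hw.eq_of_nhds, hw'.eq_of_nhds, sum_smul_mul_sum_smul,
    sum_smul_mul_sum_smul, ← Finset.sum_add_distrib]
  exact Finset.sum_congr rfl fun k _ => by rw [hm, add_smul]

theorem coeffwise_add {g h : Cn N → W} (hg : Dif g z) (hh : Dif h z) :
    coeffwise δ (fun z' => g z' + h z') = coeffwise δ g + coeffwise δ h := by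
  obtain ⟨n, φ, w, hφ, hw⟩ := hg
  obtain ⟨n', φ', w', hφ', hw'⟩ := hh
  have e : (fun z' => g z' + h z') =ᶠ[𝓝 z]
      fun z' => ∑ k, Sum.elim φ φ' k z' • Sum.elim w w' k := by
    filter_upwards [hw, hw'] with z' h1 h2
    simp [h1, h2]
  rw [coeffwise_eq_sum hδ _ e, coeffwise_eq_sum hδ hφ hw, coeffwise_eq_sum hδ hφ' hw']
  · simp
  · rintro (k | k)
    · exact hφ k
    · exact hφ' k

end

/-! ### The derivation `D` -/

variable {ιE ιF : Type}

theorem totalD_congr {G H : Cn N → RAlg N ιE ιF} {z : Cn N} (h : G =ᶠ[𝓝 z] H) :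
    totalD G z = totalD H z := by
  unfold totalD
  rw [h.eq_of_nhds]
  congr 1
  exact Finset.sum_congr rfl fun i _ => by rw [coeffwise_congr (isFirstOrderAt_del _ _) h]

theorem totalD_iterate_congr {G H : Cn N → RAlg N ιE ιF} {z : Cn N} (h : G =ᶠ[𝓝 z] H) (l : ℕ) :
    totalD^[l] G =ᶠ[𝓝 z] totalD^[l] H := by
  induction l with
  | zero => exact h
  | succ l ih =>
    rw [Function.iterate_succ_apply', Function.iterate_succ_apply']
    filter_upwards [ih.eventually_nhds] with z' hz'
    exact totalD_congr hz'

theorem totalD_const (r : RAlg N ιE ιF) (z : Cn N) : totalD (fun _ => r) z = shiftDer r := by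
  simp [totalD, coeffwise_const (isFirstOrderAt_del _ _)]

theorem totalD_add {G H : Cn N → RAlg N ιE ιF} {z : Cn N} (hG : Dif G z) (hH : Dif H z) :
    totalD (fun z' => G z' + H z') z = totalD G z + totalD H z := by
  simp only [totalD, coeffwise_add (isFirstOrderAt_del _ _) hG hH, add_mul,
    Finset.sum_add_distrib, map_add]
  abel

theorem totalD_mul {G H : Cn N → RAlg N ιE ιF} {z : Cn N} (hG : Dif G z) (hH : Dif H z) :
    totalD (fun z' => G z' * H z') z = totalD G z * H z + G z * totalD H z := by
  simp only [totalD, coeffwise_mul (isFirstOrderAt_del _ _) hG hH, add_mul, mul_add,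
    Finset.sum_add_distrib, shiftDer_mul, Finset.sum_mul, Finset.mul_sum]
  simp only [mul_assoc, yGen_comm]
  abel

theorem totalD_sum {κ : Type*} {s : Finset κ} {G : κ → Cn N → RAlg N ιE ιF} {z : Cn N}
    (hG : ∀ k ∈ s, Dif (G k) z) :
    totalD (fun z' => ∑ k ∈ s, G k z') z = ∑ k ∈ s, totalD (G k) z := by
  classical
  induction s using Finset.induction_on with
  | empty => simpa using totalD_const (0 : RAlg N ιE ιF) z
  | insert a s ha ih =>
    simp_rw [Finset.sum_insert ha]
    rw [totalD_add (hG a (Finset.mem_insert_self _ _))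
      (FinSumAt.sum fun k hk => hG k (Finset.mem_insert_of_mem hk)),
      ih fun k hk => hG k (Finset.mem_insert_of_mem hk)]

theorem totalD_algebraMap {φ : Cn N → ℂ} {z : Cn N} (hφ : DifferentiableAt ℝ φ z) :
    totalD (fun z' => algebraMap ℂ (RAlg N ιE ιF) (φ z')) z =
      ∑ i, del φ z (Pi.single i 1) • yGen i 0 := by
  unfold totalD
  rw [shiftDer_algebraMap, add_zero]
  refine Finset.sum_congr rfl fun i _ => ?_
  rw [coeffwise_eq_sum (isFirstOrderAt_del z _) (κ := Unit) (φ := fun _ => φ) (w := fun _ => 1)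
    (fun _ => hφ) (Eventually.of_forall fun z' => by simp [Algebra.algebraMap_eq_smul_one])]
  simp

theorem Dif.algebraMap {φ : Cn N → ℂ} {z : Cn N} (hφ : DifferentiableAt ℝ φ z) :
    Dif (fun z' => algebraMap ℂ (RAlg N ιE ιF) (φ z')) z :=
  (FinSumAt.smul_const hφ (1 : RAlg N ιE ιF)).congr
    (Eventually.of_forall fun z' => by simp [Algebra.algebraMap_eq_smul_one])

theorem Hol.algebraMap {φ : Cn N → ℂ} {z : Cn N} (hφ : AnalyticAt ℂ φ z) :
    Hol (fun z' => algebraMap ℂ (RAlg N ιE ιF) (φ z')) z :=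
  (FinSumAt.smul_const hφ (1 : RAlg N ιE ιF)).congr
    (Eventually.of_forall fun z' => by simp [Algebra.algebraMap_eq_smul_one])

/-- `D` is linear over functions `ψ` with `∂ψ = 0`. -/
theorem totalD_smul_of_del_eq_zero {ψ : Cn N → ℂ} {G : Cn N → RAlg N ιE ιF} {z : Cn N}
    (hψ : DifferentiableAt ℝ ψ z) (h0 : ∀ v, del ψ z v = 0) (hG : Dif G z) :
    totalD (fun z' => ψ z' • G z') z = ψ z • totalD G z := by
  simp only [Algebra.smul_def (A := RAlg N ιE ιF)]
  rw [totalD_mul (Dif.algebraMap hψ) hG, totalD_algebraMap hψ]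
  simp [h0]

theorem Hol.totalD {G : Cn N → RAlg N ιE ιF} {z : Cn N} (hG : Hol G z) :
    Hol (JetBundle.totalD G) z := by
  have hc : ∀ v, Hol (fun z' => coeffwise (fun φ => del φ z' v) G) z := by
    intro v
    obtain ⟨n, φ, w, hφ, hw⟩ := hG
    refine ⟨n, fun k z' => del (φ k) z' v, w, fun k => (hφ k).del v, ?_⟩
    filter_upwards [eventually_all.2 fun k => (hφ k).eventually_analyticAt,
      hw.eventually_nhds] with z' h1 h2
    exact coeffwise_eq_sum (isFirstOrderAt_del z' v)
      (fun k => (h1 k).differentiableAt.restrictScalars ℝ) h2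
  unfold JetBundle.totalD
  exact (FinSumAt.sum fun i _ => (hc _).mul (Hol.const _ _)).add (hG.map shiftDer)

theorem Hol.totalD_iterate {G : Cn N → RAlg N ιE ιF} {z : Cn N} (hG : Hol G z) (l : ℕ) :
    Hol (JetBundle.totalD^[l] G) z := by
  induction l with
  | zero => exact hG
  | succ l ih => rw [Function.iterate_succ_apply']; exact ih.totalD

/-- `D` respects parity. Functions of arbitrary regularity are allowed, by the junk value of
`coeffwise`. -/
theorem totalD_mem_evenPart {G : Cn N → RAlg N ιE ιF} (hG : ∀ z, G z ∈ evenPart N ιE ιF)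
    (z : Cn N) : totalD G z ∈ evenPart N ιE ιF := by
  refine add_mem (sum_mem fun i _ => mul_mem ?_ (yGen_mem_evenPart i 0))
    (algDer_mem_evenPart _ _ (hG z))
  exact coeffwise_mem (isFirstOrderAt_del _ _) (Subalgebra.toSubmodule (evenPart N ιE ιF))
    (Eventually.of_forall hG)

theorem totalD_mem_oddPart {G : Cn N → RAlg N ιE ιF} (hG : ∀ z, G z ∈ oddPart N ιE ιF)
    (z : Cn N) : totalD G z ∈ oddPart N ιE ιF := by
  refine add_mem (sum_mem fun i _ => ?_) (algDer_mem_oddPart _ _ (hG z))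
  rw [← yGen_comm]
  exact evenPart_mul_oddPart (yGen_mem_evenPart i 0)
    (coeffwise_mem (isFirstOrderAt_del _ _) _ (Eventually.of_forall hG))

theorem totalD_mem_Rm {G : Cn N → RAlg N ιE ιF} {m : ℕ} (hG : ∀ z, G z ∈ Rm N ιE ιF m)
    (z : Cn N) : totalD G z ∈ Rm N ιE ιF (m + 1) := by
  refine add_mem (sum_mem fun i _ => mul_mem ?_ (yGen_mem_Rm (Nat.succ_pos m)))
    (shiftDer_mem_Rm (hG z))
  exact coeffwise_mem (isFirstOrderAt_del _ _) (Subalgebra.toSubmodule (Rm N ιE ιF (m + 1)))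
    (Eventually.of_forall fun z => Rm_mono (Nat.le_succ m) (hG z))

theorem totalD_iterate_mem_evenPart {G : Cn N → RAlg N ιE ιF} (hG : ∀ z, G z ∈ evenPart N ιE ιF)
    (l : ℕ) (z : Cn N) : totalD^[l] G z ∈ evenPart N ιE ιF := by
  induction l generalizing z with
  | zero => exact hG z
  | succ l ih => rw [Function.iterate_succ_apply']; exact totalD_mem_evenPart ih z

theorem totalD_iterate_mem_oddPart {G : Cn N → RAlg N ιE ιF} (hG : ∀ z, G z ∈ oddPart N ιE ιF)
    (l : ℕ) (z : Cn N) : totalD^[l] G z ∈ oddPart N ιE ιF := by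
  induction l generalizing z with
  | zero => exact hG z
  | succ l ih => rw [Function.iterate_succ_apply']; exact totalD_mem_oddPart ih z

theorem totalD_iterate_mem_Rm {G : Cn N → RAlg N ιE ιF} {m : ℕ} (hG : ∀ z, G z ∈ Rm N ιE ιF m)
    (l : ℕ) (z : Cn N) : totalD^[l] G z ∈ Rm N ιE ιF (m + l) := by
  induction l generalizing z with
  | zero => exact hG z
  | succ l ih => rw [Function.iterate_succ_apply', ← add_assoc]; exact totalD_mem_Rm ih z

/-! ### Naturality of `D` -/

theorem RAlg.smul_def (c : ℂ) (r : RAlg N ιE ιF) :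
    c • r = algebraMap ℂ (RAlg N ιE ιF) c * r :=
  Algebra.smul_def (R := ℂ) (A := RAlg N ιE ιF) c r

theorem hol_algHom {R : Cn N → RAlg N ιE ιF →ₐ[ℂ] RAlg N ιE ιF} {z : Cn N}
    (hR : ∀ g, Hol (fun z' => R z' (gen g)) z) (r : RAlg N ιE ιF) : Hol (fun z' => R z' r) z := by
  induction r using RAlg.induction with
  | h0 c => simp only [AlgHom.commutes]; exact Hol.const _ _
  | hg g => exact hR g
  | ha a b h1 h2 => simp only [map_add]; exact h1.add h2
  | hm a b h1 h2 => simp only [map_mul]; exact h1.mul h2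

theorem totalD_algHom {R : Cn N → RAlg N ιE ιF →ₐ[ℂ] RAlg N ιE ιF} {z : Cn N}
    (hR : ∀ g, Hol (fun z' => R z' (gen g)) z)
    (hD : ∀ g, totalD (fun z' => R z' (gen g)) z = R z (shiftDer (gen g))) (r : RAlg N ιE ιF) :
    totalD (fun z' => R z' r) z = R z (shiftDer r) := by
  induction r using RAlg.induction with
  | h0 c => simp only [AlgHom.commutes]; rw [totalD_const, shiftDer_algebraMap, map_zero]
  | hg g => exact hD g
  | ha a b h1 h2 =>
    simp only [map_add]
    rw [totalD_add (hol_algHom hR a).dif (hol_algHom hR b).dif, h1, h2]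
  | hm a b h1 h2 =>
    simp only [map_mul, shiftDer_mul, map_add]
    rw [totalD_mul (hol_algHom hR a).dif (hol_algHom hR b).dif, h1, h2]

/-- `D` commutes with `g ↦ R (g ∘ τ)` for a holomorphic coordinate change `τ` and a family `R` of
algebra homomorphisms, if it does so on coordinates and generators: both `D ∘ R` and `R ∘ D` are
derivations along `R`, and the chain rule compares them on scalar functions. -/
theorem totalD_natural {τ : Cn N → Cn N} {R : Cn N → RAlg N ιE ιF →ₐ[ℂ] RAlg N ιE ιF} {z : Cn N}
    (hτ : DifferentiableAt ℂ τ z) (hR : ∀ g, Hol (fun z' => R z' (gen g)) z)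
    (hD : ∀ g, totalD (fun z' => R z' (gen g)) z = R z (shiftDer (gen g)))
    (hy : ∀ j, R z (yGen j 0) = ∑ i, del (fun z' => τ z' j) z (Pi.single i 1) • yGen i 0)
    {G : Cn N → RAlg N ιE ιF} (hG : Dif G (τ z)) :
    totalD (fun z' => R z' (G (τ z'))) z = R z (totalD G (τ z)) := by
  obtain ⟨n, φ, w, hφ, hw⟩ := hG
  have hτR : DifferentiableAt ℝ τ z := hτ.restrictScalars ℝ
  have e1 : (fun z' => R z' (G (τ z'))) =ᶠ[𝓝 z] fun z' => ∑ k,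
      algebraMap ℂ (RAlg N ιE ιF) (φ k (τ z')) * R z' (w k) := by
    filter_upwards [hτ.continuousAt.eventually hw] with z' h
    rw [h, map_sum]
    exact Finset.sum_congr rfl fun k _ => by rw [map_smul, RAlg.smul_def]
  have e2 : G =ᶠ[𝓝 (τ z)] fun z' => ∑ k, algebraMap ℂ (RAlg N ιE ιF) (φ k z') * w k := by
    filter_upwards [hw] with z' h
    rw [h]
    exact Finset.sum_congr rfl fun k _ => RAlg.smul_def _ _
  have hφτ : ∀ k, DifferentiableAt ℝ (fun z' => φ k (τ z')) z := fun k => (hφ k).comp z hτR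
  rw [totalD_congr e1, totalD_congr e2,
    totalD_sum fun k _ => (Dif.algebraMap (hφτ k)).mul (hol_algHom hR _).dif,
    totalD_sum fun k _ => (Dif.algebraMap (hφ k)).mul (Dif.const _ _), map_sum]
  refine Finset.sum_congr rfl fun k _ => ?_
  rw [totalD_mul (Dif.algebraMap (hφτ k)) (hol_algHom hR _).dif,
    totalD_mul (Dif.algebraMap (hφ k)) (Dif.const _ _), totalD_algebraMap (hφτ k),
    totalD_algebraMap (hφ k), totalD_algHom hR hD, totalD_const, map_add, map_mul, map_mul,
    AlgHom.commutes]
  congr 2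
  simp only [map_sum, map_smul, hy, del_comp (hφ k) hτ, Finset.sum_smul, Finset.smul_sum, smul_smul]
  exact Finset.sum_comm

theorem totalD_iterate_natural {τ : Cn N → Cn N} {R : Cn N → RAlg N ιE ιF →ₐ[ℂ] RAlg N ιE ιF}
    {V : Set (Cn N)} (hV : IsOpen V)
    (hτ : ∀ z ∈ V, DifferentiableAt ℂ τ z) (hR : ∀ z ∈ V, ∀ g, Hol (fun z' => R z' (gen g)) z)
    (hD : ∀ z ∈ V, ∀ g, totalD (fun z' => R z' (gen g)) z = R z (shiftDer (gen g)))
    (hy : ∀ z ∈ V, ∀ j,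
      R z (yGen j 0) = ∑ i, del (fun z' => τ z' j) z (Pi.single i 1) • yGen i 0)
    {G : Cn N → RAlg N ιE ιF} (hG : ∀ z ∈ V, Hol G (τ z)) (l : ℕ) :
    ∀ z ∈ V, totalD^[l] (fun z' => R z' (G (τ z'))) z = R z (totalD^[l] G (τ z)) := by
  induction l with
  | zero => intro z _; rfl
  | succ l ih =>
    intro z hz
    rw [Function.iterate_succ_apply', Function.iterate_succ_apply',
      totalD_congr (eventually_of_mem (hV.mem_nhds hz) ih),
      totalD_natural (hτ z hz) (hR z hz) (hD z hz) (hy z hz) ((hG z hz).totalD_iterate l).dif]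

end CalculusLemmas

section BundleLemmas

open Filter Topology

variable {N : ℕ} {X : Type*} [TopologicalSpace X] [ChartedSpace (Cn N) X]

/-! ### Holomorphy of coordinate and frame changes -/

/-- The coefficients of a holomorphic section in a holomorphic frame are holomorphic: in a
trivialization they arise by inverting the holomorphic matrix of the frame. -/
theorem analyticAt_coeff {FE : Type*} [NormedAddCommGroup FE] [NormedSpace ℂ FE]
    [FiniteDimensional ℂ FE] {E : X → Type*} [TopologicalSpace (Bundle.TotalSpace FE E)]
    [∀ x, AddCommGroup (E x)] [∀ x, Module ℂ (E x)] [∀ x, TopologicalSpace (E x)]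
    [FiberBundle FE E] [VectorBundle ℂ FE E] [ContMDiffVectorBundle ω FE E 𝓘(ℂ, Cn N)]
    {ι : Type*} [Fintype ι] {u : Set X} {e : ι → (x : X) → E x}
    (he : IsLocalFrameOn 𝓘(ℂ, Cn N) FE ω e u) {s : (x : X) → E x} {σ : Cn N → X} {z : Cn N}
    (hσ : ContMDiffAt 𝓘(ℂ, Cn N) 𝓘(ℂ, Cn N) ω σ z) (hu : u ∈ 𝓝 (σ z))
    (hs : ContMDiffAt 𝓘(ℂ, Cn N) (𝓘(ℂ, Cn N).prod 𝓘(ℂ, FE)) ω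
      (fun x => (⟨x, s x⟩ : Bundle.TotalSpace FE E)) (σ z)) (j : ι) :
    AnalyticAt ℂ (fun z' => he.coeff j (σ z') (s (σ z'))) z := by
  set t := trivializationAt FE E (σ z) with ht
  have hbase : σ z ∈ t.baseSet := FiberBundle.mem_baseSet_trivializationAt' _
  have key : ∀ s : (x : X) → E x, ContMDiffAt 𝓘(ℂ, Cn N) (𝓘(ℂ, Cn N).prod 𝓘(ℂ, FE)) ω
      (fun x => (⟨x, s x⟩ : Bundle.TotalSpace FE E)) (σ z) →
      ContDiffAt ℂ ω (fun z' => (t ⟨σ z', s (σ z')⟩).2) z := by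
    intro s hs
    exact (((Bundle.contMDiffAt_section (σ z)).1 hs).comp z hσ).contDiffAt
  have hev : ∀ᶠ z' in 𝓝 z, σ z' ∈ u ∧ σ z' ∈ t.baseSet :=
    hσ.continuousAt.eventually (inter_mem hu (t.open_baseSet.mem_nhds hbase))
  let A : Cn N → (ι → ℂ) →L[ℂ] FE := fun z' =>
    ∑ j, (ContinuousLinearMap.proj j : (ι → ℂ) →L[ℂ] ℂ).smulRight (t ⟨σ z', e j (σ z')⟩).2
  have hA : ContDiffAt ℂ ω A z := by
    refine ContDiffAt.sum fun j _ => ?_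
    exact ContDiffAt.smulRight (f := fun _ => (ContinuousLinearMap.proj j : (ι → ℂ) →L[ℂ] ℂ))
      contDiffAt_const (key _ ((he.contMDiffOn j).contMDiffAt hu))
  have hAe : ∀ z', ∀ h : σ z' ∈ u ∧ σ z' ∈ t.baseSet,
      A z' = (((he.toBasisAt h.1).equivFun.symm ≪≫ₗ
        t.linearEquivAt ℂ (σ z') h.2).toContinuousLinearEquiv : (ι → ℂ) →L[ℂ] FE) := by
    intro z' h
    ext c
    simp [A, Module.Basis.equivFun_symm_apply, map_sum]
  have hfin : AnalyticAt ℂ (fun z' => (A z').inverse ((t ⟨σ z', s (σ z')⟩).2) j) z := by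
    have h1 : ContDiffAt ℂ ω (fun z' => (A z').inverse) z := by
      have h0 := hev.self_of_nhds
      refine ContDiffAt.comp
        (g := (ContinuousLinearMap.inverse : ((ι → ℂ) →L[ℂ] FE) → (FE →L[ℂ] (ι → ℂ)))) z ?_ hA
      rw [hAe z h0]
      exact contDiffAt_map_inverse _
    have h2 := h1.clm_apply (key s hs)
    exact ((contDiffAt_pi.1 h2) j).analyticAt
  refine hfin.congr ?_
  filter_upwards [hev] with z' h
  have hinv : (A z').inverse = (((he.toBasisAt h.1).equivFun.symm ≪≫ₗ
        t.linearEquivAt ℂ (σ z') h.2).toContinuousLinearEquiv.symm : FE →L[ℂ] (ι → ℂ)) := by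
    rw [hAe z' h, ContinuousLinearMap.inverse_equiv]
  rw [hinv, he.coeff_apply_of_mem h.1]
  have : (t ⟨σ z', s (σ z')⟩).2 = t.linearEquivAt ℂ (σ z') h.2 (s (σ z')) := by simp
  rw [this]
  change (he.toBasisAt h.1).equivFun ((t.linearEquivAt ℂ (σ z') h.2).symm
    (t.linearEquivAt ℂ (σ z') h.2 (s (σ z')))) j = _
  rw [LinearEquiv.symm_apply_apply]
  rfl

variable [IsManifold 𝓘(ℂ, Cn N) ω X]
  {FE : Type*} [NormedAddCommGroup FE] [NormedSpace ℂ FE]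
  {E : X → Type*} [TopologicalSpace (Bundle.TotalSpace FE E)]
  [∀ x, AddCommGroup (E x)] [∀ x, Module ℂ (E x)] [∀ x, TopologicalSpace (E x)]
  [FiberBundle FE E]
  {FF : Type*} [NormedAddCommGroup FF] [NormedSpace ℂ FF]
  {F : X → Type*} [TopologicalSpace (Bundle.TotalSpace FF F)]
  [∀ x, AddCommGroup (F x)] [∀ x, Module ℂ (F x)] [∀ x, TopologicalSpace (F x)]
  [FiberBundle FF F]
  {ιE ιF : Type}

/-- The coordinates, in the system of `β`, of the points of `U_α ∩ U_β`. -/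
def overlap (α β : LocalData N FE E FF F ιE ιF) : Set (Cn N) :=
  β.y.target ∩ β.y.symm ⁻¹' α.y.source

/-- The coordinate change `y_α ∘ y_β⁻¹`. -/
def coordChange (α β : LocalData N FE E FF F ιE ιF) (z : Cn N) : Cn N := α.y (β.y.symm z)

variable {α β γ : LocalData N FE E FF F ιE ιF}

theorem isOpen_overlap (α β : LocalData N FE E FF F ιE ιF) : IsOpen (overlap α β) :=
  β.y.isOpen_inter_preimage_symm α.y.open_source

theorem mem_overlap_of_mem {x : X} (hα : x ∈ α.y.source) (hβ : x ∈ β.y.source) :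
    β.y x ∈ overlap α β :=
  ⟨β.y.map_source hβ, by simpa [β.y.left_inv hβ] using hα⟩

theorem coordChange_mem {z : Cn N} (hz : z ∈ overlap α β) : coordChange α β z ∈ overlap β α :=
  mem_overlap_of_mem (β.y.map_target hz.1) hz.2

theorem symm_coordChange {z : Cn N} (hz : z ∈ overlap α β) :
    α.y.symm (coordChange α β z) = β.y.symm z := α.y.left_inv hz.2

theorem LocalData.contMDiffAt_symm (β : LocalData N FE E FF F ιE ιF) {z : Cn N}
    (hz : z ∈ β.y.target) : ContMDiffAt 𝓘(ℂ, Cn N) 𝓘(ℂ, Cn N) ω β.y.symm z :=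
  contMDiffAt_symm_of_mem_maximalAtlas β.y_mem hz

theorem analyticAt_coordChange {z : Cn N} (hz : z ∈ overlap α β) :
    AnalyticAt ℂ (coordChange α β) z := by
  have h1 := (contMDiffAt_of_mem_maximalAtlas α.y_mem hz.2).comp z (β.contMDiffAt_symm hz.1)
  exact h1.contDiffAt.analyticAt

theorem coordChange_coordChange {z : Cn N} (hβ : z ∈ overlap β γ) :
    coordChange α β (coordChange β γ z) = coordChange α γ z := by
  unfold coordChange
  rw [β.y.left_inv hβ.2]

/-- The Jacobian matrix of the coordinate change: `dy_{α,i} = ∑_j J_ij dy_{β,j}`. -/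
def jacobian (α β : LocalData N FE E FF F ιE ιF) (z : Cn N) : Matrix (Fin N) (Fin N) ℂ :=
  Matrix.of fun i j => del (fun z' => coordChange α β z' i) z (Pi.single j 1)

section
variable [Fintype ιE] [Fintype ιF]

/-- The matrix `g` of the frame change `e_{α,i} = ∑_j g_ij e_{β,j}`, in the coordinates of `β`. -/
def frameChangeE (α β : LocalData N FE E FF F ιE ιF) (z : Cn N) : Matrix ιE ιE ℂ :=
  Matrix.of fun i j => β.e_frame.coeff j (β.y.symm z) (α.e i (β.y.symm z))

/-- The matrix `h` of the frame change `f_{α,i} = ∑_j h_ij f_{β,j}`, in the coordinates of `β`. -/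
def frameChangeF (α β : LocalData N FE E FF F ιE ιF) (z : Cn N) : Matrix ιF ιF ℂ :=
  Matrix.of fun i j => β.f_frame.coeff j (β.y.symm z) (α.f i (β.y.symm z))

/-- The values of the transition function on the generators, as functions of the coordinates
of `β`. -/
def transFun (α β : LocalData N FE E FF F ιE ιF) : GenIdx N ιE ιF → Cn N → RAlg N ιE ιF
  | .inl (.inl (i, l)) => totalD^[l + 1] (fun z => algebraMap ℂ _ (coordChange α β z i))
  | .inl (.inr (i, l)) => totalD^[l] (fun z => ∑ j, frameChangeE α β z i j • eGen j 0)
  | .inr (i, l) => totalD^[l] (fun z => ∑ j, frameChangeF α β z i j • fGen j 0)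

theorem transValues_eq (α β : LocalData N FE E FF F ιE ιF) (x : X) (g : GenIdx N ιE ιF) :
    transValues α β x g = transFun α β g (β.y x) := by
  rcases g with (⟨i, l⟩ | ⟨i, l⟩) | ⟨i, l⟩ <;> rfl

theorem trans_gen (α β : LocalData N FE E FF F ιE ιF) (x : X) (g : GenIdx N ιE ιF) :
    trans α β x (gen g) = transFun α β g (β.y x) := by
  unfold trans
  rw [homOfValues_apply, transValues_eq]
  refine exists_algHom_gen _ ?_ ?_
  · rintro (⟨i, l⟩ | ⟨i, l⟩)
    · exact totalD_iterate_mem_evenPart (fun z => Subalgebra.algebraMap_mem _ _) _ _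
    · exact totalD_iterate_mem_evenPart
        (fun z => sum_mem fun j _ => Subalgebra.smul_mem _ (eGen_mem_evenPart j 0) _) _ _
  · rintro ⟨i, l⟩
    exact totalD_iterate_mem_oddPart
      (fun z => sum_mem fun j _ => Submodule.smul_mem _ _ (fGen_mem_oddPart j 0)) _ _

theorem trans_mem_Rm (α β : LocalData N FE E FF F ιE ιF) (x : X) {m : ℕ} {r : RAlg N ιE ιF}
    (hr : r ∈ Rm N ιE ιF m) : trans α β x r ∈ Rm N ιE ιF m := by
  refine algHom_mem_Rm _ ?_ ?_ ?_ hr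
  · intro i l hl
    refine Rm_mono (show 0 + (l + 1) ≤ m by omega) ?_
    refine (trans_gen α β x _).symm ▸ ?_
    exact totalD_iterate_mem_Rm (fun z => Subalgebra.algebraMap_mem _ _) _ _
  · intro i l hl
    refine Rm_mono (show 0 + l ≤ m by omega) ?_
    refine (trans_gen α β x _).symm ▸ ?_
    exact totalD_iterate_mem_Rm
      (fun z => sum_mem fun j _ => Subalgebra.smul_mem _ (eGen_mem_Rm le_rfl) _) _ _
  · intro i l hl
    refine Rm_mono (show 0 + l ≤ m by omega) ?_
    refine (trans_gen α β x _).symm ▸ ?_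
    exact totalD_iterate_mem_Rm
      (fun z => sum_mem fun j _ => Subalgebra.smul_mem _ (fGen_mem_Rm le_rfl) _) _ _

/-- `D` raises the upper index of the values of a transition function, as `D̃` does for the
generators. -/
theorem totalD_transFun (α β : LocalData N FE E FF F ιE ιF) (g : GenIdx N ιE ιF) :
    ∃ g', shiftDer (gen g : RAlg N ιE ιF) = gen g' ∧
      totalD (transFun α β g) = transFun α β g' := by
  rcases g with (⟨i, l⟩ | ⟨i, l⟩) | ⟨i, l⟩
  · exact ⟨.inl (.inl (i, l + 1)), shiftDer_yGen i l, (Function.iterate_succ_apply' _ _ _).symm⟩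
  · exact ⟨.inl (.inr (i, l + 1)), shiftDer_eGen i l, (Function.iterate_succ_apply' _ _ _).symm⟩
  · exact ⟨.inr (i, l + 1), shiftDer_fGen i l, (Function.iterate_succ_apply' _ _ _).symm⟩

theorem totalD_coordChange {z : Cn N} (hz : z ∈ overlap α β) (i : Fin N) :
    totalD (fun z => algebraMap ℂ (RAlg N ιE ιF) (coordChange α β z i)) z =
      ∑ j, jacobian α β z i j • yGen j 0 := by
  rw [totalD_algebraMap]
  · rfl
  · exact differentiableAt_pi.1 ((analyticAt_coordChange hz).differentiableAt.restrictScalars ℝ) i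

theorem trans_yGen_zero {z : Cn N} (hz : z ∈ overlap α β) (i : Fin N) :
    trans α β (β.y.symm z) (yGen i 0) = ∑ j, jacobian α β z i j • yGen j 0 := by
  refine (trans_gen α β _ _).trans ?_
  rw [β.y.right_inv hz.1]
  exact totalD_coordChange hz i

theorem frameChangeE_mul {z : Cn N} (hβ : z ∈ overlap β γ) :
    frameChangeE α β (coordChange β γ z) * frameChangeE β γ z = frameChangeE α γ z := by
  ext i j
  have hx : ∀ k, frameChangeE α β (coordChange β γ z) i k =
      β.e_frame.coeff k (γ.y.symm z) (α.e i (γ.y.symm z)) := fun k =>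
    congrArg (fun x => β.e_frame.coeff k x (α.e i x)) (symm_coordChange hβ)
  simp only [Matrix.mul_apply, hx]
  simp only [frameChangeE, Matrix.of_apply]
  conv_rhs => rw [β.e_frame.coeff_sum_eq (α.e i) hβ.2]
  simp only [map_sum, map_smul, smul_eq_mul]

theorem frameChangeF_mul {z : Cn N} (hβ : z ∈ overlap β γ) :
    frameChangeF α β (coordChange β γ z) * frameChangeF β γ z = frameChangeF α γ z := by
  ext i j
  have hx : ∀ k, frameChangeF α β (coordChange β γ z) i k =
      β.f_frame.coeff k (γ.y.symm z) (α.f i (γ.y.symm z)) := fun k =>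
    congrArg (fun x => β.f_frame.coeff k x (α.f i x)) (symm_coordChange hβ)
  simp only [Matrix.mul_apply, hx]
  simp only [frameChangeF, Matrix.of_apply]
  conv_rhs => rw [β.f_frame.coeff_sum_eq (α.f i) hβ.2]
  simp only [map_sum, map_smul, smul_eq_mul]

theorem jacobian_mul {z : Cn N} (hα : z ∈ overlap α γ) (hβ : z ∈ overlap β γ) :
    jacobian α β (coordChange β γ z) * jacobian β γ z = jacobian α γ z := by
  have hαβ : coordChange β γ z ∈ overlap α β :=
    ⟨(coordChange_mem hβ).1, by
      rw [Set.mem_preimage, symm_coordChange hβ]; exact hα.2⟩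
  ext i j
  simp only [Matrix.mul_apply, jacobian, Matrix.of_apply]
  rw [← del_comp (φ := fun z' => coordChange α β z' i) (τ := coordChange β γ)
    (differentiableAt_pi.1 ((analyticAt_coordChange hαβ).differentiableAt.restrictScalars ℝ) i)
    (analyticAt_coordChange hβ).differentiableAt]
  refine (isFirstOrderAt_del _ _).congr ?_
  filter_upwards [(isOpen_overlap β γ).mem_nhds hβ] with z' hz'
  rw [coordChange_coordChange hz']

theorem jacobian_self {z : Cn N} (hz : z ∈ overlap α α) : jacobian α α z = 1 := by
  classical
  ext i j
  have e : (fun z' => coordChange α α z' i) =ᶠ[𝓝 z] fun z' => z' i := by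
    filter_upwards [(isOpen_overlap α α).mem_nhds hz] with z' hz'
    rw [coordChange, α.y.right_inv hz'.1]
  rw [jacobian, Matrix.of_apply, (isFirstOrderAt_del _ _).congr e,
    del_of_differentiableAt (by fun_prop), Matrix.one_apply]
  have : fderiv ℂ (fun z' : Cn N => z' i) z = ContinuousLinearMap.proj i :=
    (ContinuousLinearMap.proj (R := ℂ) (φ := fun _ : Fin N => ℂ) i).fderiv
  rw [this]
  simp [Pi.single_apply]

theorem frameChangeE_self [DecidableEq ιE] {z : Cn N} (hz : z ∈ overlap α α) :
    frameChangeE α α z = 1 := by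
  ext i j
  rw [frameChangeE, Matrix.of_apply, α.e_frame.coeff_apply_of_mem hz.2,
    ← α.e_frame.toBasisAt_coe hz.2, Module.Basis.repr_self, Matrix.one_apply,
    Finsupp.single_apply]

theorem frameChangeF_self [DecidableEq ιF] {z : Cn N} (hz : z ∈ overlap α α) :
    frameChangeF α α z = 1 := by
  ext i j
  rw [frameChangeF, Matrix.of_apply, α.f_frame.coeff_apply_of_mem hz.2,
    ← α.f_frame.toBasisAt_coe hz.2, Module.Basis.repr_self, Matrix.one_apply,
    Finsupp.single_apply]

theorem analyticAt_jacobian {z : Cn N} (hz : z ∈ overlap α β) (i j : Fin N) :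
    AnalyticAt ℂ (fun z' => jacobian α β z' i j) z :=
  AnalyticAt.del (φ := fun z' => coordChange α β z' i)
    (((ContinuousLinearMap.proj (R := ℂ) (φ := fun _ : Fin N => ℂ) i).analyticAt _).comp
      (analyticAt_coordChange hz)) _

variable [VectorBundle ℂ FE E] [ContMDiffVectorBundle ω FE E 𝓘(ℂ, Cn N)] [FiniteDimensional ℂ FE]
  [VectorBundle ℂ FF F] [ContMDiffVectorBundle ω FF F 𝓘(ℂ, Cn N)] [FiniteDimensional ℂ FF]

theorem analyticAt_frameChangeE {z : Cn N} (hz : z ∈ overlap α β) (i j : ιE) :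
    AnalyticAt ℂ (fun z' => frameChangeE α β z' i j) z :=
  analyticAt_coeff β.e_frame (β.contMDiffAt_symm hz.1)
    (β.y.open_source.mem_nhds (β.y.map_target hz.1))
    ((α.e_frame.contMDiffOn i).contMDiffAt (α.y.open_source.mem_nhds hz.2)) j

theorem analyticAt_frameChangeF {z : Cn N} (hz : z ∈ overlap α β) (i j : ιF) :
    AnalyticAt ℂ (fun z' => frameChangeF α β z' i j) z :=
  analyticAt_coeff β.f_frame (β.contMDiffAt_symm hz.1)
    (β.y.open_source.mem_nhds (β.y.map_target hz.1))
    ((α.f_frame.contMDiffOn i).contMDiffAt (α.y.open_source.mem_nhds hz.2)) j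

/-! ### The cocycle condition -/

theorem hol_transFun {z : Cn N} (hz : z ∈ overlap α β) (g : GenIdx N ιE ιF) :
    Hol (transFun α β g) z := by
  rcases g with (⟨i, l⟩ | ⟨i, l⟩) | ⟨i, l⟩
  · refine (Hol.algebraMap ?_).totalD_iterate _
    exact ((ContinuousLinearMap.proj (R := ℂ) (φ := fun _ : Fin N => ℂ) i).analyticAt _).comp
      (analyticAt_coordChange hz)
  · exact Hol.totalD_iterate (FinSumAt.sum fun j _ =>
      FinSumAt.smul_const (analyticAt_frameChangeE hz i j) _) _
  · exact Hol.totalD_iterate (FinSumAt.sum fun j _ =>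
      FinSumAt.smul_const (analyticAt_frameChangeF hz i j) _) _

theorem trans_symm_eventuallyEq {z : Cn N} (hz : z ∈ overlap α β) (g : GenIdx N ιE ιF) :
    (fun z' => trans α β (β.y.symm z') (gen g)) =ᶠ[𝓝 z] transFun α β g := by
  filter_upwards [(isOpen_overlap α β).mem_nhds hz] with z' hz'
  rw [trans_gen, β.y.right_inv hz'.1]

theorem hol_trans {z : Cn N} (hz : z ∈ overlap α β) (r : RAlg N ιE ιF) :
    Hol (fun z' => trans α β (β.y.symm z') r) z :=
  hol_algHom (fun g => (hol_transFun hz g).congr (trans_symm_eventuallyEq hz g)) r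

/-- The transition functions commute with `D`. -/
theorem totalD_iterate_trans {G : Cn N → RAlg N ιE ιF} {V : Set (Cn N)} (hV : IsOpen V)
    (hVo : V ⊆ overlap α β) (hG : ∀ z ∈ V, Hol G (coordChange α β z)) (l : ℕ) {z : Cn N}
    (hz : z ∈ V) :
    totalD^[l] (fun z' => trans α β (β.y.symm z') (G (coordChange α β z'))) z =
      trans α β (β.y.symm z) (totalD^[l] G (coordChange α β z)) := by
  refine totalD_iterate_natural hV
    (R := fun z' => trans α β (β.y.symm z')) (τ := coordChange α β)
    (fun z hz => (analyticAt_coordChange (hVo hz)).differentiableAt)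
    (fun z hz g => hol_trans (hVo hz) _) ?_ (fun z hz j => trans_yGen_zero (hVo hz) j) hG l z hz
  intro z hz g
  obtain ⟨g', h1, h2⟩ := totalD_transFun α β g
  rw [h1, totalD_congr (trans_symm_eventuallyEq (hVo hz) g), h2, trans_gen,
    β.y.right_inv (hVo hz).1]

/-- The cocycle condition. Both sides are determined by their values on the generators, and
`r_{βγ}` maps `D^l` of a coordinate or frame of `α`, formed in the coordinates of `β`, to the same
expression in the coordinates of `γ`. -/
theorem trans_trans {x : X} (hα : x ∈ α.y.source) (hβ : x ∈ β.y.source) (hγ : x ∈ γ.y.source)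
    (r : RAlg N ιE ιF) : trans β γ x (trans α β x r) = trans α γ x r := by
  suffices h : (trans β γ x).comp (trans α β x) = trans α γ x from DFunLike.congr_fun h r
  refine RAlg.algHom_ext fun g => ?_
  set z := γ.y x with hz
  have hx : γ.y.symm z = x := γ.y.left_inv hγ
  have hzV : z ∈ overlap α γ ∩ overlap β γ :=
    ⟨mem_overlap_of_mem hα hγ, mem_overlap_of_mem hβ hγ⟩
  have hV : IsOpen (overlap α γ ∩ overlap β γ) := (isOpen_overlap α γ).inter (isOpen_overlap β γ)
  have hαβ : ∀ z ∈ overlap α γ ∩ overlap β γ, coordChange β γ z ∈ overlap α β := fun z hz =>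
    ⟨(coordChange_mem hz.2).1, by
      rw [Set.mem_preimage, symm_coordChange hz.2]; exact hz.1.2⟩
  have hβx : β.y x = coordChange β γ z := by rw [coordChange, hx]
  rw [AlgHom.comp_apply, trans_gen, trans_gen, hβx, ← hz]
  have key : ∀ {G H : Cn N → RAlg N ιE ιF} (l : ℕ), (∀ z ∈ overlap α β, Hol G z) →
      (∀ z' ∈ overlap α γ ∩ overlap β γ,
        trans β γ (γ.y.symm z') (G (coordChange β γ z')) = H z') →
      trans β γ x (totalD^[l] G (coordChange β γ z)) = totalD^[l] H z := by
    intro G H l hG hGH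
    rw [← hx, ← totalD_iterate_trans hV Set.inter_subset_right (fun z hz => hG _ (hαβ z hz)) l hzV]
    refine (totalD_iterate_congr ?_ l).eq_of_nhds
    filter_upwards [hV.mem_nhds hzV] with z' hz'
    exact hGH z' hz'
  rcases g with (⟨i, l⟩ | ⟨i, l⟩) | ⟨i, l⟩
  · refine key (l + 1) (fun z hz => Hol.algebraMap ?_) ?_
    · exact ((ContinuousLinearMap.proj (R := ℂ) (φ := fun _ : Fin N => ℂ) i).analyticAt _).comp
        (analyticAt_coordChange hz)
    · intro z' hz'
      rw [AlgHom.commutes, coordChange_coordChange hz'.2]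
  · refine key l (fun z hz => FinSumAt.sum fun j _ =>
      FinSumAt.smul_const (analyticAt_frameChangeE hz i j) _) ?_
    intro z' hz'
    have h0 : ∀ j, trans β γ (γ.y.symm z') (eGen j 0) =
        ∑ k, frameChangeE β γ z' j k • eGen k 0 := fun j => by
      refine (trans_gen _ _ _ _).trans ?_
      rw [γ.y.right_inv hz'.1.1]
      rfl
    have h1 : ∀ k, frameChangeE α γ z' i k =
        ∑ j, frameChangeE α β (coordChange β γ z') i j * frameChangeE β γ z' j k := fun k => by
      rw [← frameChangeE_mul hz'.2, Matrix.mul_apply]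
    simp only [map_sum, map_smul, h0, h1,
      Finset.sum_smul, Finset.smul_sum, smul_smul]
    exact Finset.sum_comm
  · refine key l (fun z hz => FinSumAt.sum fun j _ =>
      FinSumAt.smul_const (analyticAt_frameChangeF hz i j) _) ?_
    intro z' hz'
    have h0 : ∀ j, trans β γ (γ.y.symm z') (fGen j 0) =
        ∑ k, frameChangeF β γ z' j k • fGen k 0 := fun j => by
      refine (trans_gen _ _ _ _).trans ?_
      rw [γ.y.right_inv hz'.1.1]
      rfl
    have h1 : ∀ k, frameChangeF α γ z' i k =
        ∑ j, frameChangeF α β (coordChange β γ z') i j * frameChangeF β γ z' j k := fun k => by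
      rw [← frameChangeF_mul hz'.2, Matrix.mul_apply]
    simp only [map_sum, map_smul, h0, h1,
      Finset.sum_smul, Finset.smul_sum, smul_smul]
    exact Finset.sum_comm

end

end BundleLemmas

section ConnectionLemmas

open Filter Topology

/-! ### Hermitian forms and Gram matrices -/

/-- `q` is a positive definite Hermitian form, linear in its first argument. -/
structure IsHermitianForm {V : Type*} [AddCommGroup V] [Module ℂ V] (q : V → V → ℂ) : Prop where
  add_left (u v w : V) : q (u + v) w = q u w + q v w
  smul_left (c : ℂ) (u w : V) : q (c • u) w = c * q u w
  conj_symm (u v : V) : starRingEnd ℂ (q u v) = q v u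
  pos (v : V) (hv : v ≠ 0) : 0 < (q v v).re

namespace IsHermitianForm

variable {V : Type*} [AddCommGroup V] [Module ℂ V] {q : V → V → ℂ} (hq : IsHermitianForm q)
  {κ κ' : Type*} [Fintype κ] [Fintype κ']
include hq

theorem sum_left (c : κ → ℂ) (e : κ → V) (w : V) :
    q (∑ k, c k • e k) w = ∑ k, c k * q (e k) w := by
  let L : V →ₗ[ℂ] ℂ :=
    { toFun := fun u => q u w
      map_add' := fun u v => hq.add_left u v w
      map_smul' := fun c u => hq.smul_left c u w }
  have h : L (∑ k, c k • e k) = ∑ k, c k * L (e k) := by simp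
  exact h

theorem sum_right (c : κ → ℂ) (e : κ → V) (w : V) :
    q w (∑ k, c k • e k) = ∑ k, starRingEnd ℂ (c k) * q w (e k) := by
  rw [← hq.conj_symm, hq.sum_left, map_sum]
  exact Finset.sum_congr rfl fun k _ => by rw [map_mul, hq.conj_symm]

theorem gram_eq {ι : Type*} (g : Matrix ι κ ℂ) (e : κ → V) (f : ι → V)
    (hf : ∀ i, f i = ∑ k, g i k • e k) :
    (Matrix.of fun i j => q (f i) (f j)) =
      g * (Matrix.of fun i j => q (e i) (e j)) * g.conjTranspose := by
  ext i j
  simp only [Matrix.mul_apply, Matrix.of_apply, Matrix.conjTranspose_apply, hf, hq.sum_left,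
    hq.sum_right, Finset.sum_mul, Finset.mul_sum]
  rw [Finset.sum_comm]
  refine Finset.sum_congr rfl fun k _ => Finset.sum_congr rfl fun l _ => ?_
  rw [starRingEnd_apply]
  ring

theorem isUnit_gram [DecidableEq κ] {e : κ → V} (he : LinearIndependent ℂ e) :
    IsUnit (Matrix.of fun i j => q (e i) (e j)) := by
  rw [← Matrix.vecMul_injective_iff_isUnit]
  refine (injective_iff_map_eq_zero
    (Matrix.vecMulLinear (Matrix.of fun i j => q (e i) (e j)))).2 fun c hc => ?_
  have h1 : ∀ j, q (∑ k, c k • e k) (e j) = 0 := fun j => by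
    rw [hq.sum_left]
    exact congrFun hc j
  have h2 : q (∑ k, c k • e k) (∑ k, c k • e k) = 0 := by
    rw [hq.sum_right]
    simp [h1]
  have h3 : ∑ k, c k • e k = 0 := by
    by_contra h
    have := hq.pos _ h
    rw [h2] at this
    simp at this
  funext k
  exact Fintype.linearIndependent_iff.1 he c h3 k

end IsHermitianForm

/-! ### The Chern connection of a metric that is constant in some holomorphic frame -/

variable {N : ℕ} {ιE ιF : Type}

theorem IsFirstOrderAt.sum {δ : (Cn N → ℂ) → ℂ} {z : Cn N} (hδ : IsFirstOrderAt δ z)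
    {κ : Type*} [Fintype κ] {φ : κ → Cn N → ℂ} (hφ : ∀ k, DifferentiableAt ℝ (φ k) z) :
    δ (fun z' => ∑ k, φ k z') = ∑ k, δ (φ k) := by
  simpa using hδ.sum_mul hφ (fun _ => 1)

section Frame

variable {κ : Type} [Fintype κ] [DecidableEq κ] {V : Set (Cn N)} {g g' H : Cn N → Matrix κ κ ℂ}
  {C : Matrix κ κ ℂ}

theorem metric_eq {g g' H C : Matrix κ κ ℂ} (hgg : g' * g = 1)
    (hH : g * H * g.conjTranspose = C) : H = g' * C * g'.conjTranspose := by
  have h1 : g.conjTranspose * g'.conjTranspose = 1 := by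
    rw [← Matrix.conjTranspose_mul, hgg, Matrix.conjTranspose_one]
  calc H = (g' * g) * H * (g.conjTranspose * g'.conjTranspose) := by rw [hgg, h1]; simp
    _ = _ := by rw [← hH]; simp only [Matrix.mul_assoc]

theorem metric_inv_eq {g g' H C : Matrix κ κ ℂ} (hgg : g' * g = 1)
    (hH : g * H * g.conjTranspose = C) (hC : IsUnit C) : H⁻¹ = g.conjTranspose * C⁻¹ * g := by
  have hd : IsUnit C.det := (Matrix.isUnit_iff_isUnit_det C).1 hC
  have h1 : g'.conjTranspose * g.conjTranspose = 1 := by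
    rw [← Matrix.conjTranspose_mul, mul_eq_one_comm.1 hgg, Matrix.conjTranspose_one]
  refine Matrix.inv_eq_right_inv ?_
  rw [metric_eq hgg hH]
  calc g' * C * g'.conjTranspose * (g.conjTranspose * C⁻¹ * g)
      = g' * (C * (g'.conjTranspose * g.conjTranspose) * C⁻¹) * g := by
        simp only [Matrix.mul_assoc]
    _ = 1 := by rw [h1, Matrix.mul_one, Matrix.mul_nonsing_inv _ hd, Matrix.mul_one, hgg]

theorem differentiableAt_conj {φ : Cn N → ℂ} {z : Cn N} (h : DifferentiableAt ℝ φ z) :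
    DifferentiableAt ℝ (fun z' => starRingEnd ℂ (φ z')) z :=
  ((Complex.conjCLE : ℂ →L[ℝ] ℂ).differentiableAt).comp z h

theorem totalD_iterate_sum_smul (hV : IsOpen V) {ψ : κ → Cn N → ℂ} {G : κ → Cn N → RAlg N ιE ιF}
    (hψ : ∀ t, ∀ z ∈ V, DifferentiableAt ℝ (ψ t) z) (h0 : ∀ t, ∀ z ∈ V, ∀ v, del (ψ t) z v = 0)
    (hG : ∀ t, ∀ z ∈ V, Hol (G t) z) (l : ℕ) : ∀ z ∈ V,
    totalD^[l] (fun z' => ∑ t, ψ t z' • G t z') z = ∑ t, ψ t z • totalD^[l] (G t) z := by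
  induction l with
  | zero => intro z _; rfl
  | succ l ih =>
    intro z hz
    have hGl : ∀ t, Dif (totalD^[l] (G t)) z := fun t => ((hG t z hz).totalD_iterate l).dif
    have hs : ∀ t, Dif (fun z' => ψ t z' • totalD^[l] (G t) z') z := fun t =>
      ((Dif.algebraMap (hψ t z hz)).mul (hGl t)).congr
        (Eventually.of_forall fun z' => RAlg.smul_def _ _)
    rw [Function.iterate_succ_apply', totalD_congr (eventually_of_mem (hV.mem_nhds hz) ih),
      totalD_sum fun t _ => hs t]
    refine Finset.sum_congr rfl fun t _ => ?_
    rw [totalD_smul_of_del_eq_zero (hψ t z hz) (h0 t z hz) (hGl t), Function.iterate_succ_apply']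

variable (hV : IsOpen V) (hg : ∀ z ∈ V, ∀ i j, AnalyticAt ℂ (fun z' => g z' i j) z)
  (hgg : ∀ z ∈ V, g' z * g z = 1)
  (hH : ∀ z ∈ V, g z * H z * (g z).conjTranspose = C) (hC : IsUnit C)
include hV hg hgg hH hC

/-- If `g` transforms a frame with metric `H` into a frame with constant metric `C`, then
`∑ H_ij D^l(∑ H^{js} b_s)` differs from `D^l(∑ g_is b_s)` by the factor `g⁻¹` only: in
`H⁻¹ = g^* C⁻¹ g` the factor `g^*` is antiholomorphic, so that `D` does not see it. -/
theorem adapted_eq (base : κ → RAlg N ιE ιF) (l : ℕ) {z : Cn N} (hz : z ∈ V) (i : κ) :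
    ∑ j, H z i j • totalD^[l] (fun z' => ∑ s, (H z')⁻¹ j s • base s) z =
      ∑ t, g' z i t • totalD^[l] (fun z' => ∑ s, g z' t s • base s) z := by
  set ψ : κ → κ → Cn N → ℂ := fun j t z' => ((g z').conjTranspose * C⁻¹) j t with hψdef
  have hψc : ∀ j t, ψ j t = fun z' =>
      starRingEnd ℂ (∑ k, g z' k j * starRingEnd ℂ (C⁻¹ k t)) := by
    intro j t
    funext z'
    simp only [hψdef, Matrix.mul_apply, Matrix.conjTranspose_apply, map_sum, map_mul,
      Complex.conj_conj]
    rfl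
  have hd : ∀ j t, ∀ z ∈ V,
      DifferentiableAt ℂ (fun z' => ∑ k, g z' k j * starRingEnd ℂ (C⁻¹ k t)) z := fun j t z hz =>
    DifferentiableAt.fun_sum fun k _ => (hg z hz k j).differentiableAt.mul_const _
  have hj : ∀ j, totalD^[l] (fun z' => ∑ s, (H z')⁻¹ j s • base s) z =
      ∑ t, ψ j t z • totalD^[l] (fun z' => ∑ s, g z' t s • base s) z := by
    intro j
    rw [← totalD_iterate_sum_smul hV (ψ := ψ j) (G := fun t z' => ∑ s, g z' t s • base s) _ _ _ l
      z hz]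
    · refine (totalD_iterate_congr ?_ l).eq_of_nhds
      filter_upwards [hV.mem_nhds hz] with z' hz'
      rw [metric_inv_eq (hgg z' hz') (hH z' hz') hC]
      simp only [hψdef, Finset.smul_sum, smul_smul]
      rw [Finset.sum_comm]
      refine Finset.sum_congr rfl fun s _ => ?_
      rw [← Finset.sum_smul, ← Matrix.mul_apply]
    · intro t z hz
      rw [hψc]
      exact differentiableAt_conj ((hd j t z hz).restrictScalars ℝ)
    · intro t z hz v
      rw [hψc]
      exact del_conj (hd j t z hz) v
    · intro t z hz
      exact FinSumAt.sum fun s _ => FinSumAt.smul_const (hg z hz t s) _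
  have hm : H z * ((g z).conjTranspose * C⁻¹) = g' z := by
    have hdC : IsUnit C.det := (Matrix.isUnit_iff_isUnit_det C).1 hC
    have h1 : (g' z).conjTranspose * (g z).conjTranspose = 1 := by
      rw [← Matrix.conjTranspose_mul, mul_eq_one_comm.1 (hgg z hz), Matrix.conjTranspose_one]
    rw [metric_eq (hgg z hz) (hH z hz)]
    calc g' z * C * (g' z).conjTranspose * ((g z).conjTranspose * C⁻¹)
        = g' z * (C * ((g' z).conjTranspose * (g z).conjTranspose) * C⁻¹) := by
          simp only [Matrix.mul_assoc]
      _ = g' z := by rw [h1, Matrix.mul_one, Matrix.mul_nonsing_inv _ hdC, Matrix.mul_one]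
  simp only [hj, Finset.smul_sum, smul_smul]
  rw [Finset.sum_comm]
  refine Finset.sum_congr rfl fun t _ => ?_
  rw [← Finset.sum_smul, ← hm, Matrix.mul_apply]

/-- The connection matrix of a metric that `g` transforms into a constant one is
`θ = -g⁻¹ ∂g`. -/
theorem mul_chernForm (hg' : ∀ z ∈ V, ∀ i j, AnalyticAt ℂ (fun z' => g' z' i j) z) {z : Cn N}
    (hz : z ∈ V) (v : Cn N) :
    g z * chernForm H z v = -Matrix.of (fun i j => del (fun z' => g z' i j) z v) := by
  have hδ := isFirstOrderAt_del z v
  set dg := Matrix.of (fun i j => del (fun z' => g z' i j) z v) with hdg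
  set dg' := Matrix.of (fun i j => del (fun z' => g' z' i j) z v) with hdg'
  have hR : ∀ i j, DifferentiableAt ℝ (fun z' => g z' i j) z := fun i j =>
    (hg z hz i j).differentiableAt.restrictScalars ℝ
  have hR' : ∀ i j, DifferentiableAt ℝ (fun z' => g' z' i j) z := fun i j =>
    (hg' z hz i j).differentiableAt.restrictScalars ℝ
  -- `∂H = ∂g' C g'^*`
  have hdH : Matrix.of (fun i j => del (fun z' => H z' i j) z v) =
      dg' * (C * (g' z).conjTranspose) := by
    ext i j
    have hψ : ∀ k, (fun z' => (C * (g' z').conjTranspose) k j) = fun z' =>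
        starRingEnd ℂ (∑ l, starRingEnd ℂ (C k l) * g' z' j l) := by
      intro k
      funext z'
      simp only [Matrix.mul_apply, Matrix.conjTranspose_apply, map_sum, map_mul,
        Complex.conj_conj]
      rfl
    have hψd : ∀ k, DifferentiableAt ℂ (fun z' => ∑ l, starRingEnd ℂ (C k l) * g' z' j l) z :=
      fun k => DifferentiableAt.fun_sum fun l _ => (hg' z hz j l).differentiableAt.const_mul _
    have hψR : ∀ k, DifferentiableAt ℝ (fun z' => (C * (g' z').conjTranspose) k j) z := fun k => by
      rw [hψ]
      exact differentiableAt_conj ((hψd k).restrictScalars ℝ)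
    have e : (fun z' => H z' i j) =ᶠ[𝓝 z]
        fun z' => ∑ k, g' z' i k * (C * (g' z').conjTranspose) k j := by
      filter_upwards [hV.mem_nhds hz] with z' hz'
      rw [metric_eq (hgg z' hz') (hH z' hz'), Matrix.mul_assoc, Matrix.mul_apply]
    rw [Matrix.of_apply, hδ.congr e,
      hδ.sum (φ := fun k z' => g' z' i k * (C * (g' z').conjTranspose) k j)
        fun k => (hR' i k).mul (hψR k), Matrix.mul_apply]
    refine Finset.sum_congr rfl fun k _ => ?_
    rw [hδ.mul (hR' i k) (hψR k), hψ k, del_conj (hψd k), mul_zero, add_zero, hdg',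
      Matrix.of_apply, congrFun (hψ k) z]
  -- the derivative of `g g' = 1`
  have hprod : dg * g' z + g z * dg' = 0 := by
    ext i j
    have e : (fun z' => ∑ k, g z' i k * g' z' k j) =ᶠ[𝓝 z] fun _ => (1 : Matrix κ κ ℂ) i j := by
      filter_upwards [hV.mem_nhds hz] with z' hz'
      rw [← mul_eq_one_comm.1 (hgg z' hz'), Matrix.mul_apply]
    have h1 := hδ.congr e
    rw [hδ.const, hδ.sum (φ := fun k z' => g z' i k * g' z' k j)
      fun k => (hR i k).mul (hR' k j)] at h1
    rw [Matrix.add_apply, Matrix.mul_apply, Matrix.mul_apply, ← Finset.sum_add_distrib,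
      Matrix.zero_apply, ← h1]
    exact Finset.sum_congr rfl fun k _ => (hδ.mul (hR i k) (hR' k j)).symm
  have hdC : IsUnit C.det := (Matrix.isUnit_iff_isUnit_det C).1 hC
  have h1 : (g' z).conjTranspose * (g z).conjTranspose = 1 := by
    rw [← Matrix.conjTranspose_mul, mul_eq_one_comm.1 (hgg z hz), Matrix.conjTranspose_one]
  have hθ : chernForm H z v = dg' * g z := by
    unfold chernForm
    rw [hdH, metric_inv_eq (hgg z hz) (hH z hz) hC]
    calc dg' * (C * (g' z).conjTranspose) * ((g z).conjTranspose * C⁻¹ * g z)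
        = dg' * (C * ((g' z).conjTranspose * (g z).conjTranspose) * C⁻¹) * g z := by
          simp only [Matrix.mul_assoc]
      _ = dg' * g z := by rw [h1, Matrix.mul_one, Matrix.mul_nonsing_inv _ hdC, Matrix.mul_one]
  calc g z * chernForm H z v = (g z * dg') * g z := by rw [hθ, Matrix.mul_assoc]
    _ = (-(dg * g' z)) * g z := by rw [eq_neg_of_add_eq_zero_right hprod]
    _ = -dg := by rw [Matrix.neg_mul, Matrix.mul_assoc, hgg z hz, Matrix.mul_one]

end Frame

/-! ### Linear substitutions in the generators -/

section Subst

variable [Fintype ιE] [Fintype ιF]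

/-- The values `∑_j A_ij y_j^{(l)}`, `∑_j B_ij e_j^{(l)}`, `∑_j C_ij f_j^{(l)}`. -/
def substValues (A : Matrix (Fin N) (Fin N) ℂ) (B : Matrix ιE ιE ℂ) (C : Matrix ιF ιF ℂ) :
    GenIdx N ιE ιF → RAlg N ιE ιF
  | .inl (.inl (i, l)) => ∑ j, A i j • yGen j l
  | .inl (.inr (i, l)) => ∑ j, B i j • eGen j l
  | .inr (i, l) => ∑ j, C i j • fGen j l

/-- The endomorphism of `R_∞` with `y_i^{(l)} ↦ ∑_j A_ij y_j^{(l)}`,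
`e_i^{(l)} ↦ ∑_j B_ij e_j^{(l)}`, `f_i^{(l)} ↦ ∑_j C_ij f_j^{(l)}`. -/
def substHom (A : Matrix (Fin N) (Fin N) ℂ) (B : Matrix ιE ιE ℂ) (C : Matrix ιF ιF ℂ) :
    RAlg N ιE ιF →ₐ[ℂ] RAlg N ιE ιF :=
  homOfValues gen (substValues A B C)

theorem substHom_gen (A : Matrix (Fin N) (Fin N) ℂ) (B : Matrix ιE ιE ℂ) (C : Matrix ιF ιF ℂ)
    (g : GenIdx N ιE ιF) : substHom A B C (gen g) = substValues A B C g := by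
  refine homOfValues_apply (exists_algHom_gen _ ?_ ?_) g
  · rintro (⟨i, l⟩ | ⟨i, l⟩)
    · exact sum_mem fun j _ => Subalgebra.smul_mem _ (yGen_mem_evenPart j l) _
    · exact sum_mem fun j _ => Subalgebra.smul_mem _ (eGen_mem_evenPart j l) _
  · rintro ⟨i, l⟩
    exact sum_mem fun j _ => Submodule.smul_mem _ _ (fGen_mem_oddPart j l)

theorem sum_one_smul {κ : Type*} [Fintype κ] [DecidableEq κ] {W : Type*} [AddCommGroup W]
    [Module ℂ W] (i : κ) (w : κ → W) : ∑ j, (1 : Matrix κ κ ℂ) i j • w j = w i := by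
  simp [Matrix.one_apply]

theorem substHom_one [DecidableEq ιE] [DecidableEq ιF] :
    substHom (1 : Matrix (Fin N) (Fin N) ℂ) (1 : Matrix ιE ιE ℂ) (1 : Matrix ιF ιF ℂ) =
      AlgHom.id ℂ _ := by
  refine RAlg.algHom_ext fun g => ?_
  rw [substHom_gen]
  rcases g with (⟨i, l⟩ | ⟨i, l⟩) | ⟨i, l⟩
  · exact sum_one_smul i fun j => yGen j l
  · exact sum_one_smul i fun j => eGen j l
  · exact sum_one_smul i fun j => fGen j l

/-- A family of linear substitutions with `∂_v A + A θ = 0` consists of flat sections for the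
connection `d + θ`. -/
theorem coeffwise_substHom_add {A : Cn N → Matrix (Fin N) (Fin N) ℂ} {B : Cn N → Matrix ιE ιE ℂ}
    {C : Cn N → Matrix ιF ιF ℂ} {z v : Cn N}
    (hA : ∀ i j, DifferentiableAt ℝ (fun z' => A z' i j) z)
    (hB : ∀ i j, DifferentiableAt ℝ (fun z' => B z' i j) z)
    (hC : ∀ i j, DifferentiableAt ℝ (fun z' => C z' i j) z)
    {θA : Matrix (Fin N) (Fin N) ℂ} {θB : Matrix ιE ιE ℂ} {θC : Matrix ιF ιF ℂ}
    (hθA : ∀ i j, fderiv ℝ (fun z' => A z' i j) z v + (A z * θA) i j = 0)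
    (hθB : ∀ i j, fderiv ℝ (fun z' => B z' i j) z v + (B z * θB) i j = 0)
    (hθC : ∀ i j, fderiv ℝ (fun z' => C z' i j) z v + (C z * θC) i j = 0) (r : RAlg N ιE ιF) :
    coeffwise (fun φ => fderiv ℝ φ z v) (fun z' => substHom (A z') (B z') (C z') r) +
      matrixDer θA θB θC (substHom (A z) (B z) (C z) r) = 0 := by
  have hδ := isFirstOrderAt_fderiv z v
  suffices h : Dif (fun z' => substHom (A z') (B z') (C z') r) z ∧
      coeffwise (fun φ => fderiv ℝ φ z v) (fun z' => substHom (A z') (B z') (C z') r) +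
        matrixDer θA θB θC (substHom (A z) (B z) (C z) r) = 0 from h.2
  have key : ∀ {κ : Type} [Fintype κ] (w : κ → RAlg N ιE ιF) (M : Cn N → Matrix κ κ ℂ)
      (θ : Matrix κ κ ℂ) (i : κ), (∀ i j, DifferentiableAt ℝ (fun z' => M z' i j) z) →
      (∀ i j, fderiv ℝ (fun z' => M z' i j) z v + (M z * θ) i j = 0) →
      (∀ i, matrixDer θA θB θC (w i) = ∑ j, θ i j • w j) →
      Dif (fun z' => ∑ j, M z' i j • w j) z ∧
      coeffwise (fun φ => fderiv ℝ φ z v) (fun z' => ∑ j, M z' i j • w j) +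
        matrixDer θA θB θC (∑ j, M z i j • w j) = 0 := by
    intro κ _ w M θ i hM hθ hw
    refine ⟨FinSumAt.sum fun j _ => FinSumAt.smul_const (hM i j) _, ?_⟩
    rw [coeffwise_eq_sum hδ (φ := fun j z' => M z' i j) (fun j => hM i j) EventuallyEq.rfl]
    simp only [map_sum, map_smul, hw, Finset.smul_sum, smul_smul]
    rw [Finset.sum_comm, ← Finset.sum_add_distrib]
    refine Finset.sum_eq_zero fun j _ => ?_
    rw [← Finset.sum_smul, ← add_smul, ← Matrix.mul_apply, hθ, zero_smul]
  induction r using RAlg.induction with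
  | h0 c =>
    simp only [AlgHom.commutes]
    exact ⟨Dif.const _ _, by rw [coeffwise_const hδ, matrixDer_algebraMap, add_zero]⟩
  | hg g =>
    simp only [substHom_gen]
    rcases g with (⟨i, l⟩ | ⟨i, l⟩) | ⟨i, l⟩
    · exact key (fun j => yGen j l) A θA i hA hθA fun i => matrixDer_yGen _ _ _ i l
    · exact key (fun j => eGen j l) B θB i hB hθB fun i => matrixDer_eGen _ _ _ i l
    · exact key (fun j => fGen j l) C θC i hC hθC fun i => matrixDer_fGen _ _ _ i l
  | ha a b h1 h2 =>
    simp only [map_add]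
    refine ⟨h1.1.add h2.1, ?_⟩
    rw [coeffwise_add hδ h1.1 h2.1, add_add_add_comm, h1.2, h2.2, add_zero]
  | hm a b h1 h2 =>
    simp only [map_mul]
    refine ⟨h1.1.mul h2.1, ?_⟩
    rw [coeffwise_mul hδ h1.1 h2.1, matrixDer_mul, add_add_add_comm, ← add_mul, ← mul_add, h1.2,
      h2.2, zero_mul, mul_zero, add_zero]

theorem matrixDer_zero (r : RAlg N ιE ιF) :
    matrixDer (0 : Matrix (Fin N) (Fin N) ℂ) (0 : Matrix ιE ιE ℂ) (0 : Matrix ιF ιF ℂ) r = 0 := by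
  induction r using RAlg.induction with
  | h0 c => exact matrixDer_algebraMap _ _ _ c
  | hg g =>
    rcases g with (⟨i, l⟩ | ⟨i, l⟩) | ⟨i, l⟩
    · exact (matrixDer_yGen _ _ _ i l).trans (by simp)
    · exact (matrixDer_eGen _ _ _ i l).trans (by simp)
    · exact (matrixDer_fGen _ _ _ i l).trans (by simp)
  | ha a b h1 h2 => rw [map_add, h1, h2, add_zero]
  | hm a b h1 h2 => rw [matrixDer_mul, h1, h2, zero_mul, mul_zero, add_zero]

end Subst

end ConnectionLemmas

section FlatData

open Filter Topology

/-! ### Coordinate vector fields and coordinate forms -/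

section Coord

variable {N : ℕ} {X : Type*} [TopologicalSpace X] [ChartedSpace (Cn N) X]
  [IsManifold 𝓘(ℂ, Cn N) ω X]

theorem mdifferentiableAt_chart {y : OpenPartialHomeomorph X (Cn N)}
    (hy : y ∈ IsManifold.maximalAtlas 𝓘(ℂ, Cn N) ω X) {x : X} (hx : x ∈ y.source) :
    MDifferentiableAt 𝓘(ℂ, Cn N) 𝓘(ℂ, Cn N) y x :=
  (contMDiffAt_of_mem_maximalAtlas hy hx).mdifferentiableAt (by simp)

theorem mdifferentiableAt_chart_symm {y : OpenPartialHomeomorph X (Cn N)}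
    (hy : y ∈ IsManifold.maximalAtlas 𝓘(ℂ, Cn N) ω X) {z : Cn N} (hz : z ∈ y.target) :
    MDifferentiableAt 𝓘(ℂ, Cn N) 𝓘(ℂ, Cn N) y.symm z :=
  (contMDiffAt_symm_of_mem_maximalAtlas hy hz).mdifferentiableAt (by simp)

theorem mfderiv_chart_mfderiv_symm {y : OpenPartialHomeomorph X (Cn N)}
    (hy : y ∈ IsManifold.maximalAtlas 𝓘(ℂ, Cn N) ω X) {z : Cn N} (hz : z ∈ y.target) (v : Cn N) :
    mfderiv 𝓘(ℂ, Cn N) 𝓘(ℂ, Cn N) y (y.symm z)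
      (mfderiv 𝓘(ℂ, Cn N) 𝓘(ℂ, Cn N) y.symm z v) = v := by
  have h1 := mfderiv_comp z (mdifferentiableAt_chart hy (y.map_target hz))
    (mdifferentiableAt_chart_symm hy hz)
  have h2 : (y ∘ y.symm) =ᶠ[𝓝 z] id := by
    filter_upwards [y.open_target.mem_nhds hz] with z' hz'
    exact y.right_inv hz'
  rw [h2.mfderiv_eq, mfderiv_id] at h1
  exact (DFunLike.congr_fun h1 v).symm

theorem coordForm_coordVec {y : OpenPartialHomeomorph X (Cn N)}
    (hy : y ∈ IsManifold.maximalAtlas 𝓘(ℂ, Cn N) ω X) {z : Cn N} (hz : z ∈ y.target)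
    (i j : Fin N) : coordForm y (y.symm z) i (coordVec y z j) = if i = j then 1 else 0 := by
  have h := congrFun (mfderiv_chart_mfderiv_symm hy hz (Pi.single j 1)) i
  refine h.trans ?_
  rw [Pi.single_apply]

theorem linearIndependent_coordForm {y : OpenPartialHomeomorph X (Cn N)}
    (hy : y ∈ IsManifold.maximalAtlas 𝓘(ℂ, Cn N) ω X) {z : Cn N} (hz : z ∈ y.target) :
    LinearIndependent ℂ (coordForm y (y.symm z)) := by
  rw [Fintype.linearIndependent_iff]
  intro c hc j
  have h := DFunLike.congr_fun hc (coordVec y z j)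
  rw [sum_apply] at h
  simpa [coordForm_coordVec hy hz] using h

end Coord

variable {N : ℕ} {X : Type*} [TopologicalSpace X] [ChartedSpace (Cn N) X]
  [IsManifold 𝓘(ℂ, Cn N) ω X]
  {FE : Type*} [NormedAddCommGroup FE] [NormedSpace ℂ FE]
  {E : X → Type*} [TopologicalSpace (Bundle.TotalSpace FE E)]
  [∀ x, AddCommGroup (E x)] [∀ x, Module ℂ (E x)] [∀ x, TopologicalSpace (E x)]
  [FiberBundle FE E]
  {FF : Type*} [NormedAddCommGroup FF] [NormedSpace ℂ FF]
  {F : X → Type*} [TopologicalSpace (Bundle.TotalSpace FF F)]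
  [∀ x, AddCommGroup (F x)] [∀ x, Module ℂ (F x)] [∀ x, TopologicalSpace (F x)]
  [FiberBundle FF F]
  {ιE ιF : Type} [Fintype ιE] [Fintype ιF]
  {α β γ : LocalData N FE E FF F ιE ιF}

theorem coordForm_eq_sum {z : Cn N} (hz : z ∈ overlap β α) (i : Fin N) :
    coordForm β.y (α.y.symm z) i = ∑ j, jacobian β α z i j • coordForm α.y (α.y.symm z) j := by
  set x := α.y.symm z with hx
  have hxα : x ∈ α.y.source := α.y.map_target hz.1
  have hαx : α.y x = z := α.y.right_inv hz.1
  have hc : DifferentiableAt ℂ (coordChange β α) (α.y x) := by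
    rw [hαx]; exact (analyticAt_coordChange hz).differentiableAt
  have e : β.y =ᶠ[𝓝 x] coordChange β α ∘ α.y := by
    filter_upwards [α.y.open_source.mem_nhds hxα] with x' hx'
    simp [coordChange, α.y.left_inv hx']
  have h1 := mfderiv_comp x hc.mdifferentiableAt (mdifferentiableAt_chart α.y_mem hxα)
  rw [← e.mfderiv_eq, mfderiv_eq_fderiv, hαx] at h1
  rw [hαx] at hc
  ext v
  rw [sum_apply]
  have h2 : coordForm β.y x i v =
      fderiv ℂ (coordChange β α) z (mfderiv 𝓘(ℂ, Cn N) 𝓘(ℂ, Cn N) α.y x v) i :=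
    congrFun (DFunLike.congr_fun h1 v) i
  have h3 : ∀ u : Cn N, fderiv ℂ (coordChange β α) z u i =
      del (fun z' => coordChange β α z' i) z u := fun u => by
    rw [del_of_differentiableAt (differentiableAt_pi.1 hc i), fderiv_apply hc i]
    rfl
  exact h2.trans ((h3 _).trans ((del_eq_sum _ _ _).trans
    (Finset.sum_congr rfl fun j _ => mul_comm _ _)))

variable {hT' : ∀ x : X, TXDual N x → TXDual N x → ℂ} {hE : ∀ x, E x → E x → ℂ}
  {hF : ∀ x, F x → F x → ℂ}

theorem HMat_change (hT : ∀ x, IsHermitianForm (hT' x)) {z : Cn N} (hz : z ∈ overlap β α) :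
    jacobian β α z * HMat hT' α z * (jacobian β α z).conjTranspose =
      HMat hT' β (coordChange β α z) := by
  unfold HMat
  rw [symm_coordChange hz]
  exact ((hT _).gram_eq _ _ _ fun i => coordForm_eq_sum hz i).symm

theorem HMatE_change (hEh : ∀ x, IsHermitianForm (hE x)) {z : Cn N} (hz : z ∈ overlap β α) :
    frameChangeE β α z * HMatE hE α z * (frameChangeE β α z).conjTranspose =
      HMatE hE β (coordChange β α z) := by
  unfold HMatE
  rw [symm_coordChange hz]
  exact ((hEh _).gram_eq _ _ _ fun i =>
    α.e_frame.coeff_sum_eq (β.e i) (α.y.map_target hz.1)).symm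

theorem HMatF_change (hFh : ∀ x, IsHermitianForm (hF x)) {z : Cn N} (hz : z ∈ overlap β α) :
    frameChangeF β α z * HMatF hF α z * (frameChangeF β α z).conjTranspose =
      HMatF hF β (coordChange β α z) := by
  unfold HMatF
  rw [symm_coordChange hz]
  exact ((hFh _).gram_eq _ _ _ fun i =>
    α.f_frame.coeff_sum_eq (β.f i) (α.y.map_target hz.1)).symm

/-! ### The connection in terms of flat local data -/

/-- The metrics have constant matrices in the coordinates and frames of `β`. -/
structure LocalData.IsFlat (hT' : ∀ x : X, TXDual N x → TXDual N x → ℂ) (hE : ∀ x, E x → E x → ℂ)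
    (hF : ∀ x, F x → F x → ℂ) (β : LocalData N FE E FF F ιE ιF) : Prop where
  constT : ∃ C, ∀ z ∈ β.y.target, HMat hT' β z = C
  constE : ∃ C, ∀ z ∈ β.y.target, HMatE hE β z = C
  constF : ∃ C, ∀ z ∈ β.y.target, HMatF hF β z = C

/-- Coordinate systems that differ by a translation, with equal frames, have the identity as
transition function. -/
theorem trans_eq_id [DecidableEq ιE] [DecidableEq ιF] {x : X} (hα : x ∈ α.y.source)
    (hβ : x ∈ β.y.source)
    (hJ : ∀ z ∈ overlap α β, jacobian α β z = 1) (hgE : ∀ z ∈ overlap α β, frameChangeE α β z = 1)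
    (hgF : ∀ z ∈ overlap α β, frameChangeF α β z = 1) : trans α β x = AlgHom.id ℂ _ := by
  have hz := mem_overlap_of_mem hα hβ
  have key : ∀ (b : ℕ → RAlg N ιE ιF) (_ : ∀ l, shiftDer (b l) = b (l + 1)) (l : ℕ),
      totalD^[l] (fun _ : Cn N => b 0) = fun _ => b l := by
    intro b hb l
    induction l with
    | zero => rfl
    | succ l ih =>
      rw [Function.iterate_succ_apply', ih]
      funext z
      rw [totalD_const, hb]
  refine RAlg.algHom_ext fun g => ?_
  rw [trans_gen]
  rcases g with (⟨i, l⟩ | ⟨i, l⟩) | ⟨i, l⟩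
  · have e : totalD (fun z => algebraMap ℂ (RAlg N ιE ιF) (coordChange α β z i)) =ᶠ[𝓝 (β.y x)]
        fun _ => yGen i 0 := by
      filter_upwards [(isOpen_overlap α β).mem_nhds hz] with z' hz'
      rw [totalD_coordChange hz', hJ z' hz']
      exact sum_one_smul i fun j => yGen j 0
    refine ((totalD_iterate_congr e l).eq_of_nhds).trans ?_
    exact congrFun (key (fun l => yGen i l) (shiftDer_yGen i) l) _
  · have e : (fun z => ∑ j, frameChangeE α β z i j • (eGen j 0 : RAlg N ιE ιF)) =ᶠ[𝓝 (β.y x)]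
        fun _ => eGen i 0 := by
      filter_upwards [(isOpen_overlap α β).mem_nhds hz] with z' hz'
      rw [hgE z' hz']
      exact sum_one_smul i fun j => eGen j 0
    refine ((totalD_iterate_congr e l).eq_of_nhds).trans ?_
    exact congrFun (key (fun l => eGen i l) (shiftDer_eGen i) l) _
  · have e : (fun z => ∑ j, frameChangeF α β z i j • (fGen j 0 : RAlg N ιE ιF)) =ᶠ[𝓝 (β.y x)]
        fun _ => fGen i 0 := by
      filter_upwards [(isOpen_overlap α β).mem_nhds hz] with z' hz'
      rw [hgF z' hz']
      exact sum_one_smul i fun j => fGen j 0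
    refine ((totalD_iterate_congr e l).eq_of_nhds).trans ?_
    exact congrFun (key (fun l => fGen i l) (shiftDer_fGen i) l) _

theorem trans_self {x : X} (hα : x ∈ α.y.source) : trans α α x = AlgHom.id ℂ _ := by
  classical
  exact trans_eq_id hα hα (fun _ hz => jacobian_self hz) (fun _ hz => frameChangeE_self hz)
    (fun _ hz => frameChangeF_self hz)

variable [VectorBundle ℂ FE E] [ContMDiffVectorBundle ω FE E 𝓘(ℂ, Cn N)] [FiniteDimensional ℂ FE]
  [VectorBundle ℂ FF F] [ContMDiffVectorBundle ω FF F 𝓘(ℂ, Cn N)] [FiniteDimensional ℂ FF]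

variable [DecidableEq ιE] [DecidableEq ιF]

theorem mem_overlap_self {z : Cn N} (hz : z ∈ overlap β α) : z ∈ overlap α α :=
  ⟨hz.1, α.y.map_target hz.1⟩

variable (hT : ∀ x, IsHermitianForm (hT' x)) (hEh : ∀ x, IsHermitianForm (hE x))
  (hFh : ∀ x, IsHermitianForm (hF x)) (hβ : β.IsFlat hT' hE hF)
include hT hEh hFh hβ

/-- In terms of a flat `β`, the elements `Y, E, F` for `α` are, up to a linear substitution of the
lower indices, the images of the generators under the transition function. -/
theorem isoAB_trans {z : Cn N} (hz : z ∈ overlap β α) (r : RAlg N ιE ιF) :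
    isoAB hT' hE hF α z (trans β α (α.y.symm z) r) =
      substHom (jacobian β α z) (frameChangeE β α z) (frameChangeF β α z) r := by
  obtain ⟨⟨CT, hCT⟩, ⟨CE, hCE⟩, ⟨CF, hCF⟩⟩ := hβ
  set x := α.y.symm z with hx
  have hxα : x ∈ α.y.source := α.y.map_target hz.1
  have hαx : α.y x = z := α.y.right_inv hz.1
  have hV := isOpen_overlap β α
  have hcm : ∀ z ∈ overlap β α, coordChange β α z ∈ β.y.target := fun z hz => (coordChange_mem hz).1
  -- the inverses of the Jacobian and of the frame changes, in the coordinates of `α`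
  have hJ : ∀ z ∈ overlap β α, jacobian α β (coordChange β α z) * jacobian β α z = 1 :=
    fun z hz => (jacobian_mul (mem_overlap_self hz) hz).trans (jacobian_self (mem_overlap_self hz))
  have hgE : ∀ z ∈ overlap β α, frameChangeE α β (coordChange β α z) * frameChangeE β α z = 1 :=
    fun z hz => (frameChangeE_mul hz).trans (frameChangeE_self (mem_overlap_self hz))
  have hgF : ∀ z ∈ overlap β α, frameChangeF α β (coordChange β α z) * frameChangeF β α z = 1 :=
    fun z hz => (frameChangeF_mul hz).trans (frameChangeF_self (mem_overlap_self hz))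
  have hUT : IsUnit CT := by
    rw [← hCT _ (hcm z hz)]
    exact (hT _).isUnit_gram (linearIndependent_coordForm β.y_mem (hcm z hz))
  have hUE : IsUnit CE := by
    rw [← hCE _ (hcm z hz)]
    exact (hEh _).isUnit_gram (β.e_frame.linearIndependent (β.y.map_target (hcm z hz)))
  have hUF : IsUnit CF := by
    rw [← hCF _ (hcm z hz)]
    exact (hFh _).isUnit_gram (β.f_frame.linearIndependent (β.y.map_target (hcm z hz)))
  -- the elements `Y`, `E`, `F` in terms of the images of the generators
  have hadT : ∀ i l, adaptedGen hT' hE hF α z (.inl (.inl (i, l))) =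
      ∑ t, jacobian α β (coordChange β α z) i t • trans β α x (yGen t l) := by
    intro i l
    refine (adapted_eq hV (fun z hz => analyticAt_jacobian hz) hJ
      (fun z hz => (HMat_change hT hz).trans (hCT _ (hcm z hz))) hUT (fun s => yGen s 0) l hz
      i).trans ?_
    refine Finset.sum_congr rfl fun t _ => ?_
    congr 1
    refine Eq.trans ?_ (trans_gen _ _ _ (.inl (.inl (t, l)))).symm
    rw [hαx]
    refine (totalD_iterate_congr ?_ l).eq_of_nhds
    filter_upwards [hV.mem_nhds hz] with z' hz'
    exact (totalD_coordChange hz' t).symm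
  have hadE : ∀ i l, adaptedGen hT' hE hF α z (.inl (.inr (i, l))) =
      ∑ t, frameChangeE α β (coordChange β α z) i t • trans β α x (eGen t l) := by
    intro i l
    refine (adapted_eq hV (fun z hz => analyticAt_frameChangeE hz) hgE
      (fun z hz => (HMatE_change hEh hz).trans (hCE _ (hcm z hz))) hUE (fun s => eGen s 0) l hz
      i).trans ?_
    refine Finset.sum_congr rfl fun t _ => ?_
    congr 1
    refine Eq.trans ?_ (trans_gen _ _ _ (.inl (.inr (t, l)))).symm
    rw [hαx]
    rfl
  have hadF : ∀ i l, adaptedGen hT' hE hF α z (.inr (i, l)) =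
      ∑ t, frameChangeF α β (coordChange β α z) i t • trans β α x (fGen t l) := by
    intro i l
    refine (adapted_eq hV (fun z hz => analyticAt_frameChangeF hz) hgF
      (fun z hz => (HMatF_change hFh hz).trans (hCF _ (hcm z hz))) hUF (fun s => fGen s 0) l hz
      i).trans ?_
    refine Finset.sum_congr rfl fun t _ => ?_
    congr 1
    refine Eq.trans ?_ (trans_gen _ _ _ (.inr (t, l))).symm
    rw [hαx]
    rfl
  -- a matrix and its inverse cancel in linear combinations
  have hsub : ∀ {κ : Type} [Fintype κ] [DecidableEq κ] (w : κ → RAlg N ιE ιF)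
      (M M' : Matrix κ κ ℂ), M' * M = 1 → ∀ i,
      ∑ t, M' i t • ∑ s, M t s • w s = w i := by
    intro κ _ _ w M M' h i
    simp only [Finset.smul_sum, smul_smul]
    rw [Finset.sum_comm, ← sum_one_smul i w, ← h]
    exact Finset.sum_congr rfl fun s _ => by rw [← Finset.sum_smul, ← Matrix.mul_apply]
  have hinv : ∀ r, trans α β x (trans β α x r) = r := fun r => by
    rw [trans_trans hz.2 hxα hz.2, trans_self hz.2]
    rfl
  -- the homomorphism that defines `isoAB` exists
  have hex : ∃ φ : RAlg N ιE ιF →ₐ[ℂ] RAlg N ιE ιF,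
      ∀ g, φ (adaptedGen hT' hE hF α z g) = gen g := by
    refine ⟨(substHom (jacobian β α z) (frameChangeE β α z) (frameChangeF β α z)).comp
      (trans α β x), ?_⟩
    rintro ((⟨i, l⟩ | ⟨i, l⟩) | ⟨i, l⟩)
    · rw [hadT, AlgHom.comp_apply]
      simp only [map_sum, map_smul, hinv]
      refine Eq.trans (Finset.sum_congr rfl fun t _ => ?_) (hsub (fun s => yGen s l) _ _ (hJ z hz) i)
      exact congrArg _ (substHom_gen _ _ _ _)
    · rw [hadE, AlgHom.comp_apply]
      simp only [map_sum, map_smul, hinv]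
      refine Eq.trans (Finset.sum_congr rfl fun t _ => ?_)
        (hsub (fun s => eGen s l) _ _ (hgE z hz) i)
      exact congrArg _ (substHom_gen _ _ _ _)
    · rw [hadF, AlgHom.comp_apply]
      simp only [map_sum, map_smul, hinv]
      refine Eq.trans (Finset.sum_congr rfl fun t _ => ?_)
        (hsub (fun s => fGen s l) _ _ (hgF z hz) i)
      exact congrArg _ (substHom_gen _ _ _ _)
  have hiso := homOfValues_apply hex
  suffices h : (isoAB hT' hE hF α z).comp (trans β α x) =
      substHom (jacobian β α z) (frameChangeE β α z) (frameChangeF β α z) from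
    DFunLike.congr_fun h r
  have hback : ∀ {κ : Type} [Fintype κ] [DecidableEq κ] (w w' : κ → RAlg N ιE ιF)
      (ad : κ → RAlg N ιE ιF) (M M' : Matrix κ κ ℂ), M' * M = 1 →
      (∀ i, ad i = ∑ t, M' i t • w t) → (∀ i, isoAB hT' hE hF α z (ad i) = w' i) →
      ∀ i, isoAB hT' hE hF α z (w i) = ∑ t, M i t • w' t := by
    intro κ _ _ w w' ad M M' hM had hw i
    rw [← hsub w M' M (mul_eq_one_comm.1 hM) i]
    simp only [← had, map_sum, map_smul, hw]
  refine RAlg.algHom_ext fun g => ?_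
  rw [AlgHom.comp_apply, substHom_gen]
  rcases g with (⟨i, l⟩ | ⟨i, l⟩) | ⟨i, l⟩
  · exact hback (fun t => trans β α x (yGen t l)) (fun t => yGen t l) _ _ _ (hJ z hz)
      (fun i => hadT i l) (fun i => hiso _) i
  · exact hback (fun t => trans β α x (eGen t l)) (fun t => eGen t l) _ _ _ (hgE z hz)
      (fun i => hadE i l) (fun i => hiso _) i
  · exact hback (fun t => trans β α x (fGen t l)) (fun t => fGen t l) _ _ _ (hgF z hz)
      (fun i => hadF i l) (fun i => hiso _) i

omit hT hEh hFh hβ in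
theorem localRep_eq_trans {m : ℕ} (s : ∀ x, Fibre N FE E FF F ιE ιF m x) {z : Cn N}
    (hz : z ∈ overlap β α) :
    localRep s α z = trans β α (α.y.symm z) ((s (α.y.symm z)).1 ⟨β, hz.2⟩) := by
  unfold localRep
  rw [dif_pos (α.y.map_target hz.1)]
  exact (s (α.y.symm z)).2.2 ⟨β, hz.2⟩ ⟨α, α.y.map_target hz.1⟩

/-- A section with constant representative in a flat `β` is parallel. -/
theorem nablaTilde_eq_zero {m : ℕ} (s : ∀ x, Fibre N FE E FF F ιE ιF m x) {c : RAlg N ιE ιF}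
    (hs : ∀ x, ∀ hx : x ∈ β.y.source, (s x).1 ⟨β, hx⟩ = c) {z : Cn N} (hz : z ∈ overlap β α)
    (v : Cn N) : nablaTilde hT' hE hF α s z v = 0 := by
  have hβ' := hβ
  obtain ⟨⟨CT, hCT⟩, ⟨CE, hCE⟩, ⟨CF, hCF⟩⟩ := hβ'
  have hV := isOpen_overlap β α
  have hcm : ∀ z ∈ overlap β α, coordChange β α z ∈ β.y.target := fun z hz => (coordChange_mem hz).1
  have e : ∀ z' ∈ overlap β α, isoAB hT' hE hF α z' (localRep s α z') =
      substHom (jacobian β α z') (frameChangeE β α z') (frameChangeF β α z') c := by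
    intro z' hz'
    rw [localRep_eq_trans s hz', hs, isoAB_trans hT hEh hFh hβ hz']
  unfold nablaTilde
  rw [coeffwise_congr (isFirstOrderAt_fderiv z v) (eventually_of_mem (hV.mem_nhds hz) e), e z hz]
  have hUT : IsUnit CT := by
    rw [← hCT _ (hcm z hz)]
    exact (hT _).isUnit_gram (linearIndependent_coordForm β.y_mem (hcm z hz))
  have hUE : IsUnit CE := by
    rw [← hCE _ (hcm z hz)]
    exact (hEh _).isUnit_gram (β.e_frame.linearIndependent (β.y.map_target (hcm z hz)))
  have hUF : IsUnit CF := by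
    rw [← hCF _ (hcm z hz)]
    exact (hFh _).isUnit_gram (β.f_frame.linearIndependent (β.y.map_target (hcm z hz)))
  -- `dg + g θ = 0`, since `θ = -g⁻¹ ∂g` and `g` is holomorphic
  have hθ : ∀ {κ : Type} [Fintype κ] [DecidableEq κ] {g g' H : Cn N → Matrix κ κ ℂ}
      {C : Matrix κ κ ℂ}, (∀ z ∈ overlap β α, ∀ i j, AnalyticAt ℂ (fun z' => g z' i j) z) →
      (∀ z ∈ overlap β α, ∀ i j, AnalyticAt ℂ (fun z' => g' z' i j) z) →
      (∀ z ∈ overlap β α, g' z * g z = 1) →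
      (∀ z ∈ overlap β α, g z * H z * (g z).conjTranspose = C) → IsUnit C →
      ∀ i j, fderiv ℝ (fun z' => g z' i j) z v + (g z * chernForm H z v) i j = 0 := by
    intro κ _ _ g g' H C h1 h2 h3 h4 h5 i j
    rw [mul_chernForm hV h1 h3 h4 h5 h2 hz v, fderiv_real_eq_del (h1 z hz i j).differentiableAt]
    simp
  refine coeffwise_substHom_add
    (fun i j => (analyticAt_jacobian hz i j).differentiableAt.restrictScalars ℝ)
    (fun i j => (analyticAt_frameChangeE hz i j).differentiableAt.restrictScalars ℝ)
    (fun i j => (analyticAt_frameChangeF hz i j).differentiableAt.restrictScalars ℝ)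
    ?_ ?_ ?_ c
  · exact hθ (fun z hz => analyticAt_jacobian hz)
      (g' := fun z' => jacobian α β (coordChange β α z'))
      (fun z hz i j => (analyticAt_jacobian (coordChange_mem hz) i j).comp
        (analyticAt_coordChange hz))
      (fun z hz => (jacobian_mul (mem_overlap_self hz) hz).trans
        (jacobian_self (mem_overlap_self hz)))
      (fun z hz => (HMat_change hT hz).trans (hCT _ (hcm z hz))) hUT
  · exact hθ (fun z hz => analyticAt_frameChangeE hz)
      (g' := fun z' => frameChangeE α β (coordChange β α z'))
      (fun z hz i j => (analyticAt_frameChangeE (coordChange_mem hz) i j).comp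
        (analyticAt_coordChange hz))
      (fun z hz => (frameChangeE_mul hz).trans (frameChangeE_self (mem_overlap_self hz)))
      (fun z hz => (HMatE_change hEh hz).trans (hCE _ (hcm z hz))) hUE
  · exact hθ (fun z hz => analyticAt_frameChangeF hz)
      (g' := fun z' => frameChangeF α β (coordChange β α z'))
      (fun z hz i j => (analyticAt_frameChangeF (coordChange_mem hz) i j).comp
        (analyticAt_coordChange hz))
      (fun z hz => (frameChangeF_mul hz).trans (frameChangeF_self (mem_overlap_self hz)))
      (fun z hz => (HMatF_change hFh hz).trans (hCF _ (hcm z hz))) hUF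

/-- In a flat `β` the connection `∇̃` is the trivial connection `d`. -/
theorem nablaTilde_of_isFlat {m : ℕ} (s : ∀ x, Fibre N FE E FF F ιE ιF m x) {z : Cn N}
    (hz : z ∈ β.y.target) (v : Cn N) :
    nablaTilde hT' hE hF β s z v = coeffwise (fun φ => fderiv ℝ φ z v) (localRep s β) := by
  have hself : ∀ z ∈ β.y.target, z ∈ overlap β β := fun z hz => ⟨hz, β.y.map_target hz⟩
  have hid : ∀ z ∈ β.y.target, ∀ r, isoAB hT' hE hF β z r = r := by
    intro z hz r
    have h := isoAB_trans hT hEh hFh hβ (hself z hz) r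
    rw [trans_self (β.y.map_target hz), jacobian_self (hself z hz),
      frameChangeE_self (hself z hz), frameChangeF_self (hself z hz), substHom_one] at h
    exact h
  have hθ : ∀ {κ : Type} [Fintype κ] [DecidableEq κ] {H : Cn N → Matrix κ κ ℂ}
      {C : Matrix κ κ ℂ}, (∀ z ∈ β.y.target, H z = C) → chernForm H z v = 0 := by
    intro κ _ _ H C hC
    have : Matrix.of (fun i j => del (fun z' => H z' i j) z v) = 0 := by
      ext i j
      rw [Matrix.of_apply, (isFirstOrderAt_del z v).congr (ψ := fun _ => C i j),
        (isFirstOrderAt_del z v).const, Matrix.zero_apply]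
      filter_upwards [β.y.open_target.mem_nhds hz] with z' hz'
      rw [hC z' hz']
    rw [chernForm, this, Matrix.zero_mul]
  obtain ⟨⟨CT, hCT⟩, ⟨CE, hCE⟩, ⟨CF, hCF⟩⟩ := hβ
  unfold nablaTilde
  rw [hθ hCT, hθ hCE, hθ hCF, matrixDer_zero, add_zero]
  refine coeffwise_congr (isFirstOrderAt_fderiv z v) ?_
  filter_upwards [β.y.open_target.mem_nhds hz] with z' hz'
  exact hid z' hz' _

end FlatData

section FlatPeriodic

open Filter Topology

/-! ### Periodic functions and flat periodic metrics on `ℂ^N` -/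

variable {N : ℕ} {Λ : Submodule ℤ (Cn N)}

/-- A lattice in `ℂ^N` has a bounded fundamental domain. -/
theorem exists_isCompact_translate_mem (Λ : Submodule ℤ (Cn N)) [DiscreteTopology Λ]
    [IsZLattice ℝ Λ] :
    ∃ K : Set (Cn N), IsCompact K ∧ ∀ z, ∃ k ∈ K, z - k ∈ Λ := by
  let b := (Module.Free.chooseBasis ℤ Λ).ofZLatticeBasis ℝ Λ
  have hb : Submodule.span ℤ (Set.range b) = Λ := Module.Basis.ofZLatticeBasis_span ..
  refine ⟨Metric.closedBall 0 (∑ i, ‖b i‖), isCompact_closedBall _ _, fun z =>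
    ⟨ZSpan.fract b z, ?_, ?_⟩⟩
  · rw [mem_closedBall_zero_iff]
    exact ZSpan.norm_fract_le (K := ℝ) b z
  · rw [ZSpan.fract_apply, sub_sub_cancel]
    exact hb.le (ZSpan.floor b z).2

variable [DiscreteTopology Λ] [IsZLattice ℝ Λ]

theorem exists_forall_le_of_periodic {u : Cn N → ℝ} (hu : Continuous u)
    (hper : ∀ z w, z - w ∈ Λ → u z = u w) : ∃ z₀, ∀ z, u z ≤ u z₀ := by
  obtain ⟨K, hK, hKc⟩ := exists_isCompact_translate_mem Λ
  obtain ⟨k₀, hk₀, -⟩ := hKc 0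
  obtain ⟨z₀, -, hmax⟩ := hK.exists_isMaxOn ⟨k₀, hk₀⟩ hu.continuousOn
  refine ⟨z₀, fun z => ?_⟩
  obtain ⟨k, hk, hzk⟩ := hKc z
  rw [hper z k hzk]
  exact hmax hk

/-- Holomorphic functions on a torus are constant, by Liouville's theorem. -/
theorem apply_eq_apply_of_differentiable_of_periodic {f : Cn N → ℂ} (hf : Differentiable ℂ f)
    (hper : ∀ z w, z - w ∈ Λ → f z = f w) (z w : Cn N) : f z = f w := by
  obtain ⟨K, hK, hKc⟩ := exists_isCompact_translate_mem Λ
  refine hf.apply_eq_apply_of_bounded ((hK.image hf.continuous).isBounded.subset ?_) z w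
  rintro _ ⟨z, rfl⟩
  obtain ⟨k, hk, hzk⟩ := hKc z
  exact ⟨k, hk, (hper z k hzk).symm⟩

/-- The second derivative is nonpositive at a local maximum: if it were positive, the point would be
a local minimum as well, and the function constant near it. -/
theorem deriv_deriv_nonpos_of_isLocalMax {a a' : ℝ → ℝ} {c t₀ : ℝ}
    (h1 : ∀ t, HasDerivAt a (a' t) t) (h2 : HasDerivAt a' c t₀) (hmax : IsLocalMax a t₀) :
    c ≤ 0 := by
  by_contra! hc
  have hd : deriv a = a' := funext fun t => (h1 t).deriv
  have hmin : IsLocalMin a t₀ := by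
    refine isLocalMin_of_deriv_deriv_pos ?_ hmax.deriv_eq_zero (h1 t₀).continuousAt
    rwa [hd, h2.deriv]
  have hconst : a =ᶠ[𝓝 t₀] fun _ => a t₀ := by
    filter_upwards [hmin, hmax] with t ht ht'
    exact le_antisymm ht' ht
  have h0 : a' =ᶠ[𝓝 t₀] fun _ => 0 := by
    filter_upwards [hconst.eventuallyEq_nhds] with t ht
    rw [← hd, ht.deriv_eq]
    simp
  have := h0.deriv_eq
  rw [h2.deriv] at this
  simp at this
  exact hc.ne' this

theorem differentiable_of_delBar_eq_zero {φ : Cn N → ℂ} (hφ : Differentiable ℝ φ)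
    (h0 : ∀ z v, delBar φ z v = 0) : Differentiable ℂ φ := by
  intro z
  have hI : ∀ v, fderiv ℝ φ z (Complex.I • v) = Complex.I * fderiv ℝ φ z v := fun v => by
    have := h0 z v
    unfold delBar at this
    linear_combination -Complex.I * 2 * this + fderiv ℝ φ z (Complex.I • v) * Complex.I_mul_I
  let L : Cn N →L[ℂ] ℂ :=
    { toFun := fderiv ℝ φ z
      map_add' := map_add _
      map_smul' := fun c v => by
        rw [map_complex_smul, hI]
        conv_rhs => rw [RingHom.id_apply, ← Complex.re_add_im c, smul_eq_mul]
        ring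
      cont := (fderiv ℝ φ z).cont }
  have hL : L.restrictScalars ℝ = fderiv ℝ φ z := rfl
  exact (hasFDerivAt_of_restrictScalars ℝ (hφ z).hasFDerivAt hL).differentiableAt

theorem delBar_eq_conj_del (φ : Cn N → ℂ) (z v : Cn N) :
    delBar φ z v = starRingEnd ℂ (del (fun z' => starRingEnd ℂ (φ z')) z v) := by
  have h : ∀ v, fderiv ℝ (fun z' => starRingEnd ℂ (φ z')) z v =
      starRingEnd ℂ (fderiv ℝ φ z v) := fun v => by
    have := (Complex.conjCLE).comp_fderiv (f := φ) (x := z)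
    exact congrArg (fun L : Cn N →L[ℝ] ℂ => L v) this
  simp only [del, delBar, h, map_div₀, map_sub, map_mul, Complex.conj_conj, Complex.conj_I]
  rw [map_ofNat]
  ring

theorem fderiv_eq_del_add_delBar (φ : Cn N → ℂ) (z v : Cn N) :
    fderiv ℝ φ z v = del φ z v + delBar φ z v := by
  unfold del delBar
  ring

theorem differentiable_matrix_inv {κ : Type} [Fintype κ] [DecidableEq κ]
    {G : Cn N → Matrix κ κ ℂ} (hG : ∀ i j, Differentiable ℝ fun z => G z i j)
    (hdet : ∀ z, (G z).det ≠ 0) (i j : κ) : Differentiable ℝ fun z => (G z)⁻¹ i j := by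
  have hd : ∀ {H : Cn N → Matrix κ κ ℂ}, (∀ i j, Differentiable ℝ fun z => H z i j) →
      Differentiable ℝ fun z => (H z).det := by
    intro H hH
    simp only [Matrix.det_apply]
    refine Differentiable.fun_sum fun σ _ => ?_
    have h : Differentiable ℝ fun z => ∏ k, H z (σ k) k := fun z =>
      (HasFDerivAt.finsetProd (u := Finset.univ)
        fun k _ => (hH (σ k) k z).hasFDerivAt).differentiableAt
    exact h.const_smul ((Equiv.Perm.sign σ : ℤˣ) : ℤ)
  have h : (fun z => (G z)⁻¹ i j) = fun z => ((G z).det)⁻¹ * (G z).adjugate i j := by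
    funext z
    rw [Matrix.inv_def, Matrix.smul_apply, Ring.inverse_eq_inv', smul_eq_mul]
  rw [h]
  refine ((hd hG).inv hdet).mul ?_
  simp only [Matrix.adjugate_apply]
  refine hd fun k l => ?_
  simp only [Matrix.updateRow_apply]
  split_ifs
  · exact differentiable_const _
  · exact hG k l

section FlatMetric

variable {G : Cn N → Matrix (Fin N) (Fin N) ℂ}

/-- The covariant constancy of the metric: `∂_v G = θ(v) G` and `∂̄_v G = G θ(v)^*`. -/
theorem hasDerivAt_metric (hG : ∀ i j, Differentiable ℝ fun z => G z i j)
    (hsymm : ∀ z, (G z).conjTranspose = G z) (hdet : ∀ z, IsUnit (G z)) (z v : Cn N) (t : ℝ)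
    (i j : Fin N) :
    HasDerivAt (fun t : ℝ => G (z + t • v) i j)
      ((chernForm G (z + t • v) v * G (z + t • v) +
        G (z + t • v) * (chernForm G (z + t • v) v).conjTranspose) i j) t := by
  set x := z + t • v with hx
  have hdel : Matrix.of (fun i j => del (fun z' => G z' i j) x v) = chernForm G x v * G x := by
    rw [chernForm, Matrix.mul_assoc,
      Matrix.nonsing_inv_mul _ ((Matrix.isUnit_iff_isUnit_det _).1 (hdet x)), Matrix.mul_one]
  have hbar : delBar (fun z' => G z' i j) x v =
      (G x * (chernForm G x v).conjTranspose) i j := by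
    have h1 : G x * (chernForm G x v).conjTranspose = (chernForm G x v * G x).conjTranspose := by
      rw [Matrix.conjTranspose_mul, hsymm]
    have h2 : (fun z' => starRingEnd ℂ (G z' i j)) = fun z' => G z' j i := by
      funext z'
      conv_rhs => rw [← hsymm z']
      rfl
    rw [delBar_eq_conj_del, h2, h1, ← hdel]
    rfl
  have hline : HasDerivAt (fun t : ℝ => z + t • v) v t := by
    simpa using ((hasDerivAt_id t).smul_const v).const_add z
  have := ((hG i j) x).hasFDerivAt.comp_hasDerivAt t hline
  rw [fderiv_eq_del_add_delBar, hbar] at this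
  have hij : del (fun z' => G z' i j) x v = (chernForm G x v * G x) i j :=
    congrFun (congrFun hdel i) j
  rw [Matrix.add_apply, ← hij]
  exact this

/-- A flat Hermitian metric on `ℂ^N` that is periodic with respect to a lattice is constant: its
connection form `θ` is holomorphic and periodic, hence constant, and then
`(∂_v∂̄_v) G = θ(v) G θ(v)^*` shows that the diagonal entries of `G` are subharmonic, strictly so
unless `θ = 0`. -/
theorem metric_const_of_flat_of_periodic (hG : ∀ i j, ContDiff ℝ ∞ fun z => G z i j)
    (hsymm : ∀ z, (G z).conjTranspose = G z)
    (hpos : ∀ z (c : Fin N → ℂ), c ≠ 0 →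
      0 < (∑ k, ∑ l, c k * G z k l * starRingEnd ℂ (c l)).re)
    (hdet : ∀ z, IsUnit (G z)) (hper : ∀ z w, z - w ∈ Λ → G z = G w)
    (hflat : ∀ i j z v w, delBar (fun z' => chernForm G z' v i j) z w = 0) (z w : Cn N) :
    G z = G w := by
  have hGd : ∀ i j, Differentiable ℝ fun z => G z i j := fun i j =>
    (hG i j).differentiable (by simp)
  -- the connection form is constant
  have hdeld : ∀ i j v, Differentiable ℝ fun z => del (fun z' => G z' i j) z v := by
    intro i j v
    have h1 : ∀ v, Differentiable ℝ fun z => fderiv ℝ (fun z' => G z' i j) z v := fun v =>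
      (((hG i j).fderiv_right (m := 1) (by norm_cast)).clm_apply contDiff_const).differentiable (by simp)
    simp only [del, div_eq_mul_inv]
    exact ((h1 v).sub ((h1 _).const_mul _)).mul_const _
  have hθd : ∀ i j v, Differentiable ℝ fun z => chernForm G z v i j := by
    intro i j v
    simp only [chernForm, Matrix.mul_apply, Matrix.of_apply]
    exact Differentiable.fun_sum fun k _ => (hdeld i k v).mul
      (differentiable_matrix_inv hGd
        (fun z => ((Matrix.isUnit_iff_isUnit_det _).1 (hdet z)).ne_zero) k j)
  have hθper : ∀ z w v, z - w ∈ Λ → chernForm G z v = chernForm G w v := by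
    intro z w v hzw
    have h1 : ∀ i j, (fun z' => G (z' + (z - w)) i j) = fun z' => G z' i j := by
      intro i j
      funext z'
      rw [hper (z' + (z - w)) z' (by simpa using hzw)]
    have h2 : ∀ i j, fderiv ℝ (fun z' => G z' i j) z = fderiv ℝ (fun z' => G z' i j) w := by
      intro i j
      have h3 := fderiv_comp_add_right (𝕜 := ℝ) (f := fun z' => G z' i j) (x := w) (z - w)
      rw [add_sub_cancel] at h3
      exact h3.symm.trans (congrArg (fun φ => fderiv ℝ φ w) (h1 i j))
    simp only [chernForm, del, h2, hper z w hzw]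
  have hθ : ∀ z v, chernForm G z v = chernForm G 0 v := by
    intro z v
    ext i j
    exact apply_eq_apply_of_differentiable_of_periodic (Λ := Λ)
      (differentiable_of_delBar_eq_zero (hθd i j v) (hflat i j · v ·))
      (fun z w hzw => by rw [hθper z w v hzw]) z 0
  have hθI : ∀ v, chernForm G 0 (Complex.I • v) = Complex.I • chernForm G 0 v := by
    intro v
    simp only [chernForm, del_smul_vec]
    rw [← Matrix.smul_mul]
    rfl
  have hD : ∀ (z v : Cn N) (t : ℝ) i j, HasDerivAt (fun t : ℝ => G (z + t • v) i j)
      ((chernForm G 0 v * G (z + t • v) +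
        G (z + t • v) * (chernForm G 0 v).conjTranspose) i j) t := by
    intro z v t i j
    have := hasDerivAt_metric hGd hsymm hdet z v t i j
    rwa [hθ] at this
  -- the connection form vanishes: otherwise `A_ij ≠ 0` for `A = θ(v)`, and the second
  -- derivatives of `G_ii` are examined at a maximum `z₀`
  have hθ0 : ∀ v, chernForm G 0 v = 0 := by
    intro v
    ext i j
    by_contra hij
    obtain ⟨z₀, hz₀⟩ := exists_forall_le_of_periodic (Λ := Λ) (u := fun z => (G z i i).re)
      (Complex.continuous_re.comp (hG i i).continuous) (fun z w hzw => by rw [hper z w hzw])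
    have key : ∀ v, ((chernForm G 0 v * (chernForm G 0 v * G z₀ +
        G z₀ * (chernForm G 0 v).conjTranspose) + (chernForm G 0 v * G z₀ +
        G z₀ * (chernForm G 0 v).conjTranspose) * (chernForm G 0 v).conjTranspose) i i).re ≤ 0 := by
      intro v
      set A := chernForm G 0 v
      have hre : ∀ {f : ℝ → ℂ} {c : ℂ} {t : ℝ}, HasDerivAt f c t →
          HasDerivAt (fun t => (f t).re) c.re t := fun {f c t} hf =>
        Complex.reCLM.hasFDerivAt.comp_hasDerivAt t hf
      refine deriv_deriv_nonpos_of_isLocalMax (a := fun t : ℝ => (G (z₀ + t • v) i i).re)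
        (t₀ := 0) (fun t => hre (hD z₀ v t i i)) (hre ?_) ?_
      · have h : HasDerivAt (fun t : ℝ => ∑ k, A i k * G (z₀ + t • v) k i +
            ∑ k, G (z₀ + t • v) i k * A.conjTranspose k i) _ 0 :=
          (HasDerivAt.fun_sum fun k _ => (hD z₀ v 0 k i).const_mul (A i k)).add
            (HasDerivAt.fun_sum fun k _ => (hD z₀ v 0 i k).mul_const (A.conjTranspose k i))
        simp only [zero_smul, add_zero] at h
        exact h
      · refine Eventually.of_forall fun t => ?_
        simpa using hz₀ (z₀ + t • v)
    -- the Laplacian on the complex line in direction `v` is the sum over the real directions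
    -- `v` and `i v`, in which the terms `A² G` and `G (A^*)²` cancel
    have hsum := add_nonpos (key v) (key (Complex.I • v))
    rw [hθI] at hsum
    set A := chernForm G 0 v
    have h4 : (A * (A * G z₀ + G z₀ * A.conjTranspose) +
        (A * G z₀ + G z₀ * A.conjTranspose) * A.conjTranspose) +
        ((Complex.I • A) * ((Complex.I • A) * G z₀ + G z₀ * (Complex.I • A).conjTranspose) +
          ((Complex.I • A) * G z₀ + G z₀ * (Complex.I • A).conjTranspose) *
            (Complex.I • A).conjTranspose) = (4 : ℝ) • (A * G z₀ * A.conjTranspose) := by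
      rw [Matrix.conjTranspose_smul]
      simp only [Complex.star_def, Complex.conj_I, Matrix.smul_mul, Matrix.mul_smul,
        Matrix.mul_add, Matrix.add_mul, smul_add, smul_smul, Matrix.mul_assoc, neg_mul, mul_neg,
        Complex.I_mul_I, smul_neg, neg_neg, one_smul, neg_smul]
      module
    have h5 : ((A * G z₀ * A.conjTranspose) i i).re ≤ 0 := by
      rw [← Complex.add_re, ← Matrix.add_apply, h4, Matrix.smul_apply, Complex.smul_re,
        smul_eq_mul] at hsum
      linarith
    have h6 := hpos z₀ (A i) fun h => hij (congrFun h j)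
    refine absurd h5 (not_le.2 ?_)
    rw [Finset.sum_comm] at h6
    simpa only [Matrix.mul_apply, Finset.sum_mul, Matrix.conjTranspose_apply,
      Complex.star_def] using h6
  ext i j
  refine is_const_of_fderiv_eq_zero (hGd i j) (fun z => ?_) z w
  ext v
  have h1 := hD z v 0 i j
  have hline : HasDerivAt (fun t : ℝ => z + t • v) v 0 := by
    simpa using ((hasDerivAt_id (0 : ℝ)).smul_const v).const_add z
  have h2 := ((hGd i j) (z + (0 : ℝ) • v)).hasFDerivAt.comp_hasDerivAt 0 hline
  have h3 := h2.unique h1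
  simpa [hθ0] using h3

end FlatMetric

end FlatPeriodic

section InducedMetrics

/-! ### The metrics induced on `T^*` and on the sums of copies of `T` and `T^*` -/

namespace IsHermitianForm

variable {V : Type*} [AddCommGroup V] [Module ℂ V] {q : V → V → ℂ} (hq : IsHermitianForm q)
include hq

theorem apply_self_nonneg (v : V) : 0 ≤ (q v v).re := by
  by_cases hv : v = 0
  · have := hq.smul_left 0 v v
    rw [zero_smul, zero_mul] at this
    rw [hv] at this ⊢
    rw [this, Complex.zero_re]
  · exact (hq.pos v hv).le

theorem exists_eq_apply [FiniteDimensional ℂ V] (a : V →ₗ[ℂ] ℂ) : ∃ u, ∀ v, a v = q v u := by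
  let b := Module.finBasis ℂ V
  let L : V →ₗ[ℂ] Fin (Module.finrank ℂ V) → ℂ :=
    { toFun := fun u i => q u (b i)
      map_add' := fun u v => funext fun i => hq.add_left u v _
      map_smul' := fun c u => funext fun i => hq.smul_left c u _ }
  have hL : Function.Injective L := by
    refine (injective_iff_map_eq_zero L).2 fun u hu => ?_
    by_contra hne
    have h1 := hq.pos u hne
    have h2 := hq.sum_right (b.repr u) b u
    rw [b.sum_repr] at h2
    have h3 : ∀ i, q u (b i) = 0 := congrFun hu
    simp [h2, h3] at h1
  obtain ⟨u, hu⟩ := (LinearMap.injective_iff_surjective_of_finrank_eq_finrank (by simp)).1 hL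
    fun i => starRingEnd ℂ (a (b i))
  refine ⟨u, fun v => ?_⟩
  have h1 : ∀ i, a (b i) = q (b i) u := fun i => by
    have h2 : q u (b i) = starRingEnd ℂ (a (b i)) := congrFun hu i
    rw [← hq.conj_symm, h2, Complex.conj_conj]
  rw [← b.sum_repr v, hq.sum_left, map_sum]
  exact Finset.sum_congr rfl fun i _ => by rw [map_smul, smul_eq_mul, h1]

end IsHermitianForm

variable {N : ℕ} {X : Type*} [TopologicalSpace X] [ChartedSpace (Cn N) X]

namespace HermitianMetric

variable (h : HermitianMetric N X)

theorem isHermitianForm (x : X) : IsHermitianForm fun u v => h.form x u v where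
  add_left u v w := by rw [map_add, LinearMap.add_apply]
  smul_left c u w := by rw [map_smul, LinearMap.smul_apply, smul_eq_mul]
  conj_symm := h.conj_symm x
  pos := h.pos x

theorem form_left_injective {x : X} {u u' : TX N x} (huu : ∀ v, h.form x v u = h.form x v u') :
    u = u' := by
  by_contra hne
  have := h.pos x (u - u') (sub_ne_zero.2 hne)
  rw [map_sub, huu, sub_self] at this
  simp at this

theorem exists_riesz (x : X) (a : TXDual N x) : ∃ u, ∀ v, a v = h.form x v u := by
  have : FiniteDimensional ℂ (TX N x) := inferInstanceAs (FiniteDimensional ℂ (Cn N))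
  exact (h.isHermitianForm x).exists_eq_apply (a : TX N x →ₗ[ℂ] ℂ)

theorem apply_eq_form_riesz (x : X) (a : TXDual N x) (v : TX N x) :
    a v = h.form x v (h.riesz x a) := by
  have hu := h.exists_riesz x a
  rw [riesz, dif_pos hu]
  exact hu.choose_spec v

theorem dual_eq_apply_riesz (x : X) (a b : TXDual N x) : h.dual x a b = a (h.riesz x b) :=
  (h.apply_eq_form_riesz x a _).symm

theorem isHermitianForm_dual (x : X) : IsHermitianForm (h.dual x) where
  add_left a b c := by simp only [dual_eq_apply_riesz, add_apply]
  smul_left c a b := by simp only [dual_eq_apply_riesz, smul_apply, smul_eq_mul]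
  conj_symm a b := h.conj_symm x _ _
  pos a ha := by
    refine h.pos x _ fun h0 => ha ?_
    ext v
    rw [h.apply_eq_form_riesz, h0, map_zero]
    rfl

theorem isHermitianForm_sum (a b : ℕ) (x : X) : IsHermitianForm (h.sum a b x) where
  add_left u v w := by
    simp only [sum, Prod.fst_add, Prod.snd_add, add_apply, map_add, LinearMap.add_apply,
      ContinuousLinearMap.comp_add, (h.isHermitianForm_dual x).add_left, Finset.sum_add_distrib]
    ring
  smul_left c u w := by
    simp only [sum, Prod.smul_fst, Prod.smul_snd, smul_apply, map_smul, LinearMap.smul_apply,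
      ContinuousLinearMap.comp_smul, (h.isHermitianForm_dual x).smul_left, smul_eq_mul, mul_add,
      Finset.mul_sum]
  conj_symm u v := by
    simp only [sum, map_add, map_sum, h.conj_symm, (h.isHermitianForm_dual x).conj_symm]
  pos u hu := by
    have h1 : ∀ k, 0 ≤ (h.form x (u.1 (Pi.single k 1)) (u.1 (Pi.single k 1))).re := fun k =>
      (h.isHermitianForm x).apply_self_nonneg _
    have h2 : ∀ k, 0 ≤ (h.dual x ((ContinuousLinearMap.proj k : Cn b →L[ℂ] ℂ).comp u.2)
        ((ContinuousLinearMap.proj k : Cn b →L[ℂ] ℂ).comp u.2)).re := fun k =>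
      (h.isHermitianForm_dual x).apply_self_nonneg _
    simp only [sum, Complex.add_re, Complex.re_sum]
    by_contra hle
    have h3 := Finset.sum_nonneg fun k (_ : k ∈ Finset.univ) => h1 k
    have h4 := Finset.sum_nonneg fun k (_ : k ∈ Finset.univ) => h2 k
    have h5 := (Finset.sum_eq_zero_iff_of_nonneg fun k _ => h1 k).1
      (le_antisymm (by linarith) h3)
    have h6 := (Finset.sum_eq_zero_iff_of_nonneg fun k _ => h2 k).1
      (le_antisymm (by linarith) h4)
    refine hu (Prod.ext ?_ ?_)
    · have h7 : ∀ k, u.1 (Pi.single k 1) = 0 := fun k => by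
        by_contra hne
        exact (h.pos x _ hne).ne' (h5 k (Finset.mem_univ k))
      refine ContinuousLinearMap.ext fun v => ?_
      rw [pi_eq_sum_univ' v, map_sum]
      exact Finset.sum_eq_zero fun k _ => by rw [map_smul, h7, smul_zero]
    · have h7 : ∀ k, (ContinuousLinearMap.proj k : Cn b →L[ℂ] ℂ).comp u.2 = 0 := fun k => by
        by_contra hne
        exact ((h.isHermitianForm_dual x).pos _ hne).ne' (h6 k (Finset.mem_univ k))
      refine ContinuousLinearMap.ext fun v => funext fun k => ?_
      exact DFunLike.congr_fun (h7 k) v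

/-- An isometry of tangent spaces is compatible with the identification of forms and vectors. -/
theorem riesz_comp {x x' : X} (Q : TX N x ≃L[ℂ] TX N x')
    (hQ : ∀ u v, h.form x' (Q u) (Q v) = h.form x u v) (a : TXDual N x) :
    h.riesz x' (a.comp (Q.symm : TX N x' →L[ℂ] TX N x)) = Q (h.riesz x a) := by
  refine h.form_left_injective fun v => ?_
  rw [← h.apply_eq_form_riesz, ← Q.apply_symm_apply v, hQ, ← h.apply_eq_form_riesz]
  simp

theorem dual_comp {x x' : X} (Q : TX N x ≃L[ℂ] TX N x')
    (hQ : ∀ u v, h.form x' (Q u) (Q v) = h.form x u v) (a b : TXDual N x) :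
    h.dual x' (a.comp (Q.symm : TX N x' →L[ℂ] TX N x))
      (b.comp (Q.symm : TX N x' →L[ℂ] TX N x)) = h.dual x a b := by
  rw [dual, h.riesz_comp Q hQ, h.riesz_comp Q hQ, hQ, dual]

theorem sum_comp {x x' : X} (Q : TX N x ≃L[ℂ] TX N x')
    (hQ : ∀ u v, h.form x' (Q u) (Q v) = h.form x u v) {a b : ℕ} (u v : SumBundle N a b x) :
    h.sum a b x'
      ((Q : TX N x →L[ℂ] TX N x').comp u.1, u.2.comp (Q.symm : TX N x' →L[ℂ] TX N x))
      ((Q : TX N x →L[ℂ] TX N x').comp v.1, v.2.comp (Q.symm : TX N x' →L[ℂ] TX N x)) =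
      h.sum a b x u v := by
  simp only [sum]
  congr 1
  · exact Finset.sum_congr rfl fun k _ => hQ _ _
  · exact Finset.sum_congr rfl fun k _ => h.dual_comp Q hQ
      ((ContinuousLinearMap.proj k).comp u.2) ((ContinuousLinearMap.proj k).comp v.2)

end HermitianMetric

end InducedMetrics

section FlatCharts

open Filter Topology

/-! ### Coordinates and frames that come from the universal covering -/

variable {N : ℕ} {X : Type*} [TopologicalSpace X] [ChartedSpace (Cn N) X]
  [IsManifold 𝓘(ℂ, Cn N) ω X]

/-- The section of `T^{⊕ a}` that is `c ⊗ v` for a holomorphic vector field `v` is holomorphic. -/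
theorem contMDiffAt_smulRight_of_section {a : ℕ} {v : ∀ x : X, TX N x} {x₀ : X}
    (hv : ContMDiffAt 𝓘(ℂ, Cn N) (𝓘(ℂ, Cn N).prod 𝓘(ℂ, Cn N)) ω
      (fun x => Bundle.TotalSpace.mk' (Cn N) x (v x)) x₀) (c : Cn a →L[ℂ] ℂ) :
    ContMDiffAt 𝓘(ℂ, Cn N) (𝓘(ℂ, Cn N).prod 𝓘(ℂ, Cn a →L[ℂ] Cn N)) ω
      (fun x => Bundle.TotalSpace.mk' (Cn a →L[ℂ] Cn N) (E := fun x : X => Cn a →L[ℂ] TX N x) x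
        (c.smulRight (v x))) x₀ := by
  rw [contMDiffAt_hom_bundle]
  refine ⟨contMDiffAt_id, ?_⟩
  rw [Bundle.contMDiffAt_section] at hv
  have h1 := ((ContinuousLinearMap.smulRightL ℂ (Cn a) (Cn N) c).contMDiff (n := ω)).contMDiffAt.comp x₀ hv
  refine h1.congr_of_eventuallyEq ?_
  filter_upwards [(trivializationAt (Cn N) (TX N) x₀).open_baseSet.mem_nhds
    (FiberBundle.mem_baseSet_trivializationAt' x₀)] with x hx
  ext w
  simp [ContinuousLinearMap.inCoordinates]
  rw [Bundle.Trivialization.linearMapAt_apply, if_pos hx]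
  exact Or.inl rfl

/-- The section of `(T^*)^{⊕ b}` that is `η ⊗ w` for a holomorphic one-form `η` is holomorphic. -/
theorem contMDiffAt_smulRight_of_form {b : ℕ} {η : ∀ x : X, TXDual N x} {x₀ : X}
    (hη : ContMDiffAt 𝓘(ℂ, Cn N) 𝓘(ℂ, Cn N →L[ℂ] ℂ) ω
      (fun x => (η x).comp ((trivializationAt (Cn N) (TX N) x₀).symmL ℂ x)) x₀) (w : Cn b) :
    ContMDiffAt 𝓘(ℂ, Cn N) (𝓘(ℂ, Cn N).prod 𝓘(ℂ, Cn N →L[ℂ] Cn b)) ω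
      (fun x => Bundle.TotalSpace.mk' (Cn N →L[ℂ] Cn b) (E := fun x : X => TX N x →L[ℂ] Cn b) x
        ((η x).smulRight w)) x₀ := by
  rw [contMDiffAt_hom_bundle]
  refine ⟨contMDiffAt_id, ?_⟩
  have h1 := ((ContinuousLinearMap.smulRightL ℂ (Cn N) (Cn b)).flip w).contMDiff (n := ω) |>.contMDiffAt.comp x₀ hη
  refine h1.congr_of_eventuallyEq ?_
  filter_upwards [(trivializationAt (Cn N) (TX N) x₀).open_baseSet.mem_nhds
    (FiberBundle.mem_baseSet_trivializationAt' x₀)] with x hx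
  ext w
  simp [ContinuousLinearMap.inCoordinates]

theorem contMDiffAt_prod_section {a b : ℕ} {u : ∀ x : X, Cn a →L[ℂ] TX N x}
    {v : ∀ x : X, TX N x →L[ℂ] Cn b} {x₀ : X}
    (hu : ContMDiffAt 𝓘(ℂ, Cn N) (𝓘(ℂ, Cn N).prod 𝓘(ℂ, Cn a →L[ℂ] Cn N)) ω
      (fun x => Bundle.TotalSpace.mk' (Cn a →L[ℂ] Cn N) (E := fun x : X => Cn a →L[ℂ] TX N x) x
        (u x)) x₀)
    (hv : ContMDiffAt 𝓘(ℂ, Cn N) (𝓘(ℂ, Cn N).prod 𝓘(ℂ, Cn N →L[ℂ] Cn b)) ω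
      (fun x => Bundle.TotalSpace.mk' (Cn N →L[ℂ] Cn b) (E := fun x : X => TX N x →L[ℂ] Cn b) x
        (v x)) x₀) :
    ContMDiffAt 𝓘(ℂ, Cn N) (𝓘(ℂ, Cn N).prod 𝓘(ℂ, SumFibre N a b)) ω
      (fun x => Bundle.TotalSpace.mk' (SumFibre N a b) (E := SumBundle N a b) x (u x, v x)) x₀ := by
  rw [Bundle.contMDiffAt_section] at hu hv ⊢
  exact hu.prodMk_space hv

/-- `p` exhibits `X` as the quotient of `ℂ^N` by `Λ`. -/
def IsTorusCover (Λ : Submodule ℤ (Cn N)) (p : Cn N → X) : Prop :=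
  Function.Surjective p ∧ IsLocalDiffeomorph 𝓘(ℂ, Cn N) 𝓘(ℂ, Cn N) ω p ∧
    ∀ z w, p z = p w ↔ z - w ∈ Λ

namespace IsTorusCover

variable {Λ : Submodule ℤ (Cn N)} {p : Cn N → X} (hp : IsTorusCover Λ p)
include hp

theorem surjective : Function.Surjective p := hp.1

theorem isLocalDiffeomorph : IsLocalDiffeomorph 𝓘(ℂ, Cn N) 𝓘(ℂ, Cn N) ω p := hp.2.1

theorem apply_eq_iff (z w : Cn N) : p z = p w ↔ z - w ∈ Λ := hp.2.2 z w

theorem exists_chart (w : Cn N) : ∃ y ∈ IsManifold.maximalAtlas 𝓘(ℂ, Cn N) ω X,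
    w ∈ y.target ∧ ∀ z ∈ y.target, y.symm z = p z := by
  obtain ⟨Φ, hw, hΦ⟩ := hp.isLocalDiffeomorph w
  refine ⟨Φ.toOpenPartialHomeomorph.symm, ?_, hw, fun z hz => (hΦ hz).symm⟩
  exact Φ.toOpenPartialHomeomorph.symm.mem_maximalAtlas_of_contMDiffOn Φ.contMDiffOn_invFun
    Φ.contMDiffOn_toFun

theorem mdifferentiableAt (w : Cn N) : MDifferentiableAt 𝓘(ℂ, Cn N) 𝓘(ℂ, Cn N) p w :=
  hp.isLocalDiffeomorph.contMDiff.mdifferentiable (by simp) w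

/-- The differential of the covering map is invariant under the deck transformations, which are
translations. -/
theorem mfderiv_eq {z w : Cn N} (h : p z = p w) (v : Cn N) :
    (mfderiv 𝓘(ℂ, Cn N) 𝓘(ℂ, Cn N) p z v : Cn N) = mfderiv 𝓘(ℂ, Cn N) 𝓘(ℂ, Cn N) p w v := by
  have h1 : p ∘ (fun z' => z' + (w - z)) = p := by
    funext z'
    refine (hp.apply_eq_iff _ _).2 ?_
    rw [add_sub_cancel_left]
    exact (hp.apply_eq_iff _ _).1 h.symm
  have h2 : HasMFDerivAt 𝓘(ℂ, Cn N) 𝓘(ℂ, Cn N) (fun z' : Cn N => z' + (w - z)) z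
      (ContinuousLinearMap.id ℂ (Cn N)) :=
    ((hasFDerivAt_id z).add_const (w - z)).hasMFDerivAt
  have h3 : HasMFDerivAt 𝓘(ℂ, Cn N) 𝓘(ℂ, Cn N) p (z + (w - z)) (mfderiv 𝓘(ℂ, Cn N) 𝓘(ℂ, Cn N) p w) := by
    rw [add_sub_cancel]
    exact (hp.mdifferentiableAt w).hasMFDerivAt
  have h4 := h3.comp z h2
  rw [h1] at h4
  exact DFunLike.congr_fun (hasMFDerivAt_unique (hp.mdifferentiableAt z).hasMFDerivAt h4) v

/-- The identification of `ℂ^N` with the tangent space at `x`: the differential of the covering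
map, at any preimage of `x`. -/
def tangentIso (x : X) : Cn N ≃L[ℂ] TX N x :=
  (hp.isLocalDiffeomorph.mfderivToContinuousLinearEquiv (by simp)
    (Function.surjInv hp.surjective x) : Cn N ≃L[ℂ] Cn N)

theorem tangentIso_apply (w v : Cn N) :
    hp.tangentIso (p w) v = mfderiv 𝓘(ℂ, Cn N) 𝓘(ℂ, Cn N) p w v :=
  hp.mfderiv_eq (Function.surjInv_eq hp.surjective (p w)) v

variable {y : OpenPartialHomeomorph X (Cn N)}
  (hy : y ∈ IsManifold.maximalAtlas 𝓘(ℂ, Cn N) ω X) (hyp : ∀ z ∈ y.target, y.symm z = p z)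
include hy hyp

theorem mfderiv_chart_symm {z : Cn N} (hz : z ∈ y.target) (v : Cn N) :
    mfderiv 𝓘(ℂ, Cn N) 𝓘(ℂ, Cn N) y.symm z v = hp.tangentIso (y.symm z) v := by
  have h1 : y.symm =ᶠ[𝓝 z] p := by
    filter_upwards [y.open_target.mem_nhds hz] with z' hz' using hyp z' hz'
  have h2 : (mfderiv 𝓘(ℂ, Cn N) 𝓘(ℂ, Cn N) y.symm z : Cn N →L[ℂ] Cn N) =
      mfderiv 𝓘(ℂ, Cn N) 𝓘(ℂ, Cn N) p z := h1.mfderiv_eq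
  refine (DFunLike.congr_fun h2 v).trans ?_
  rw [hyp z hz]
  exact (hp.tangentIso_apply z v).symm

theorem mfderiv_chart {x : X} (hx : x ∈ y.source) :
    mfderiv 𝓘(ℂ, Cn N) 𝓘(ℂ, Cn N) y x = ((hp.tangentIso x).symm : TX N x →L[ℂ] Cn N) := by
  refine ContinuousLinearMap.ext fun v => ?_
  have h1 := mfderiv_chart_mfderiv_symm hy (y.map_source hx) ((hp.tangentIso x).symm v)
  have h2 := hp.mfderiv_chart_symm hy hyp (y.map_source hx) ((hp.tangentIso x).symm v)
  have h3 := (congrArg (mfderiv 𝓘(ℂ, Cn N) 𝓘(ℂ, Cn N) y (y.symm (y x))) h2).symm.trans h1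
  rw [y.left_inv hx] at h3
  rwa [ContinuousLinearEquiv.apply_symm_apply] at h3

theorem contMDiffAt_tangentIso {x : X} (hx : x ∈ y.source) (v : Cn N) :
    ContMDiffAt 𝓘(ℂ, Cn N) (𝓘(ℂ, Cn N).prod 𝓘(ℂ, Cn N)) ω
      (fun x => Bundle.TotalSpace.mk' (Cn N) (E := TX N) x (hp.tangentIso x v)) x := by
  have h1 : ContMDiff 𝓘(ℂ, Cn N) (𝓘(ℂ, Cn N).prod 𝓘(ℂ, Cn N)) ω
      (fun w : Cn N => (⟨w, v⟩ : TangentBundle 𝓘(ℂ, Cn N) (Cn N))) :=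
    contMDiff_vectorSpace_iff_contDiff.2 contDiff_const
  have h2 := (hp.isLocalDiffeomorph.contMDiff.contMDiff_tangentMap (m := ω) le_rfl).comp h1
  have h3 := h2.contMDiffAt.comp x (contMDiffAt_of_mem_maximalAtlas hy hx)
  refine h3.congr_of_eventuallyEq ?_
  filter_upwards [y.open_source.mem_nhds hx] with x' hx'
  have h4 : p (y x') = x' := by rw [← hyp _ (y.map_source hx'), y.left_inv hx']
  have h5 := hp.tangentIso_apply (y x') v
  show _ = (⟨p (y x'), mfderiv 𝓘(ℂ, Cn N) 𝓘(ℂ, Cn N) p (y x') v⟩ :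
    TangentBundle 𝓘(ℂ, Cn N) X)
  rw [← h5, h4]

theorem contMDiffAt_tangentIso_symm {x₀ : X} (hx : x₀ ∈ y.source) (i : Fin N) :
    ContMDiffAt 𝓘(ℂ, Cn N) 𝓘(ℂ, Cn N →L[ℂ] ℂ) ω
      (fun x => ((ContinuousLinearMap.proj i : Cn N →L[ℂ] ℂ).comp
        ((hp.tangentIso x).symm : TX N x →L[ℂ] Cn N)).comp
          ((trivializationAt (Cn N) (TX N) x₀).symmL ℂ x)) x₀ := by
  have h1 := (contMDiffAt_of_mem_maximalAtlas hy hx).mfderiv_const (m := ω) le_rfl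
  have h2 := (((ContinuousLinearMap.compL ℂ (Cn N) (Cn N) ℂ)
    (ContinuousLinearMap.proj i)).contMDiff (n := ω)).contMDiffAt.comp x₀ h1
  refine h2.congr_of_eventuallyEq ?_
  filter_upwards [y.open_source.mem_nhds hx] with x' hx'
  ext v
  simp [inTangentCoordinates, ContinuousLinearMap.inCoordinates]
  rw [hp.mfderiv_chart hy hyp hx']
  rfl


omit hy hyp

section Frame

variable (a b c d : ℕ)

/-- The frame of `T^{⊕ a} ⊕ (T^*)^{⊕ b}` that consists of the standard vector fields and the
standard one-forms of `ℂ^N` in each summand. -/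
def frame : SumIdx N a b → (x : X) → SumBundle N a b x
  | .inl (k, i), x =>
    ((ContinuousLinearMap.proj k : Cn a →L[ℂ] ℂ).smulRight (hp.tangentIso x (Pi.single i 1)), 0)
  | .inr (k, i), x =>
    (0, ((ContinuousLinearMap.proj i : Cn N →L[ℂ] ℂ).comp
      ((hp.tangentIso x).symm : TX N x →L[ℂ] Cn N)).smulRight (Pi.single k 1 : Cn b))

/-- The coordinates with respect to `frame`, which show that `frame` is a basis in each fibre. -/
def frameCoord (x : X) : SumBundle N a b x →ₗ[ℂ] (SumIdx N a b → ℂ) where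
  toFun u := Sum.elim (fun t => (hp.tangentIso x).symm (u.1 (Pi.single t.1 1)) t.2)
    (fun t => u.2 (hp.tangentIso x (Pi.single t.2 1)) t.1)
  map_add' u v := by
    funext t
    rcases t with t | t <;> simp
  map_smul' c u := by
    funext t
    rcases t with t | t <;> simp

theorem frameCoord_frame (x : X) (j : SumIdx N a b) :
    hp.frameCoord a b x (hp.frame a b j x) = Pi.single j 1 := by
  funext t
  rcases j with ⟨k, i⟩ | ⟨k, i⟩ <;> rcases t with ⟨k', i'⟩ | ⟨k', i'⟩
  · by_cases hk : k = k' <;> simp [frameCoord, frame, Pi.single_apply, hk, eq_comm]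
  · simp [frameCoord, frame]
  · simp [frameCoord, frame]
  · by_cases hk : k = k' <;> simp [frameCoord, frame, Pi.single_apply, hk, eq_comm]

theorem frameCoord_injective (x : X) : Function.Injective (hp.frameCoord a b x) := by
  refine (injective_iff_map_eq_zero _).2 fun u hu => Prod.ext ?_ ?_
  · refine ContinuousLinearMap.ext fun v => ?_
    rw [pi_eq_sum_univ' v, map_sum]
    refine Finset.sum_eq_zero fun k _ => ?_
    have h1 : (hp.tangentIso x).symm (u.1 (Pi.single k 1)) = 0 :=
      funext fun i => congrFun hu (.inl (k, i))
    rw [map_smul, (map_eq_zero_iff _ (hp.tangentIso x).symm.injective).1 h1, smul_zero]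
  · have h1 : u.2.comp (hp.tangentIso x : Cn N →L[ℂ] TX N x) = 0 := by
      refine ContinuousLinearMap.ext fun v => ?_
      rw [pi_eq_sum_univ' v, map_sum]
      refine Finset.sum_eq_zero fun i _ => ?_
      have h2 : u.2 (hp.tangentIso x (Pi.single i 1)) = 0 :=
        funext fun k => congrFun hu (.inr (k, i))
      rw [map_smul]
      exact (congrArg _ h2).trans (smul_zero _)
    refine ContinuousLinearMap.ext fun v => ?_
    have h2 := DFunLike.congr_fun h1 ((hp.tangentIso x).symm v)
    simpa using h2

include hy hyp in
theorem isLocalFrameOn_frame :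
    IsLocalFrameOn 𝓘(ℂ, Cn N) (SumFibre N a b) ω (hp.frame a b) y.source where
  linearIndependent {x} _ := by
    refine LinearIndependent.of_comp (hp.frameCoord a b x) ?_
    have h1 : hp.frameCoord a b x ∘ (fun j => hp.frame a b j x) = fun j => Pi.single j 1 :=
      funext (hp.frameCoord_frame a b x)
    rw [h1]
    exact Pi.linearIndependent_single_one _ _
  generating {x} _ := by
    intro u _
    have h1 : u = ∑ j, hp.frameCoord a b x u j • hp.frame a b j x := by
      refine hp.frameCoord_injective a b x ?_
      simp only [map_sum, map_smul, frameCoord_frame]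
      exact pi_eq_sum_univ' _
    rw [h1]
    exact Submodule.sum_mem _ fun j _ => Submodule.smul_mem _ _ (Submodule.subset_span ⟨j, rfl⟩)
  contMDiffOn j x hx := by
    refine ContMDiffAt.contMDiffWithinAt ?_
    have hzl : ContMDiffAt 𝓘(ℂ, Cn N) (𝓘(ℂ, Cn N).prod 𝓘(ℂ, Cn a →L[ℂ] Cn N)) ω
        (fun x => Bundle.TotalSpace.mk' (Cn a →L[ℂ] Cn N)
          (E := fun x : X => Cn a →L[ℂ] TX N x) x 0) x :=
      (Bundle.contMDiff_zeroSection ℂ _).contMDiffAt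
    have hzr : ContMDiffAt 𝓘(ℂ, Cn N) (𝓘(ℂ, Cn N).prod 𝓘(ℂ, Cn N →L[ℂ] Cn b)) ω
        (fun x => Bundle.TotalSpace.mk' (Cn N →L[ℂ] Cn b)
          (E := fun x : X => TX N x →L[ℂ] Cn b) x 0) x :=
      (Bundle.contMDiff_zeroSection ℂ _).contMDiffAt
    rcases j with ⟨k, i⟩ | ⟨k, i⟩
    · exact contMDiffAt_prod_section
        (contMDiffAt_smulRight_of_section (hp.contMDiffAt_tangentIso hy hyp hx _) _) hzr
    · exact contMDiffAt_prod_section hzl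
        (contMDiffAt_smulRight_of_form (hp.contMDiffAt_tangentIso_symm hy hyp hx i) _)

/-- The coordinate system is a local inverse of `p`, and the frames are the standard ones. -/
def IsStandard (β : LocalData N (SumFibre N a b) (SumBundle (X := X) N a b)
    (SumFibre N c d) (SumBundle (X := X) N c d) (SumIdx N a b) (SumIdx N c d)) : Prop :=
  (∀ z ∈ β.y.target, β.y.symm z = p z) ∧ β.e = hp.frame a b ∧ β.f = hp.frame c d

theorem exists_isStandard (w : Cn N) : ∃ β, hp.IsStandard a b c d β ∧ w ∈ β.y.target := by
  obtain ⟨y, hy, hw, hyp⟩ := hp.exists_chart w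
  exact ⟨⟨y, hy, hp.frame a b, hp.isLocalFrameOn_frame hy hyp a b, hp.frame c d,
    hp.isLocalFrameOn_frame hy hyp c d⟩, ⟨hyp, rfl, rfl⟩, hw⟩

end Frame

end IsTorusCover

end FlatCharts

section FlatTorus

open Filter Topology

/-! ### Flat metrics on tori are constant in standard coordinates and frames -/

theorem chernForm_congr {κ : Type} [Fintype κ] [DecidableEq κ] {N : ℕ}
    {H H' : Cn N → Matrix κ κ ℂ} {z : Cn N} (h : H =ᶠ[𝓝 z] H') (v : Cn N) :
    chernForm H z v = chernForm H' z v := by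
  unfold chernForm
  rw [h.eq_of_nhds]
  congr 2
  funext i j
  refine (isFirstOrderAt_del z v).congr ?_
  filter_upwards [h] with z' hz'
  rw [hz']

theorem delBar_congr {N : ℕ} {φ ψ : Cn N → ℂ} {z : Cn N} (h : φ =ᶠ[𝓝 z] ψ) (v : Cn N) :
    delBar φ z v = delBar ψ z v := by
  unfold delBar
  rw [h.fderiv_eq]

variable {N : ℕ} {X : Type*} [TopologicalSpace X] [ChartedSpace (Cn N) X]
  [IsManifold 𝓘(ℂ, Cn N) ω X]

namespace IsTorusCover

variable {Λ : Submodule ℤ (Cn N)} {p : Cn N → X} (hp : IsTorusCover Λ p)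
  [DiscreteTopology Λ] [IsZLattice ℝ Λ] {h : HermitianMetric N X} (hFlat : h.IsFlat)
include hp hFlat

/-- A flat metric is constant in the standard vector fields of `ℂ^N`. -/
theorem form_tangentIso_const (x x' : X) (i j : Fin N) :
    h.form x (hp.tangentIso x (Pi.single i 1)) (hp.tangentIso x (Pi.single j 1)) =
      h.form x' (hp.tangentIso x' (Pi.single i 1)) (hp.tangentIso x' (Pi.single j 1)) := by
  set G' : X → Matrix (Fin N) (Fin N) ℂ := fun x => Matrix.of fun i j =>
    h.form x (hp.tangentIso x (Pi.single i 1)) (hp.tangentIso x (Pi.single j 1)) with hG'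
  set G : Cn N → Matrix (Fin N) (Fin N) ℂ := fun z => G' (p z) with hG
  have hgram : ∀ {y : OpenPartialHomeomorph X (Cn N)}
      (_ : y ∈ IsManifold.maximalAtlas 𝓘(ℂ, Cn N) ω X) (_ : ∀ z ∈ y.target, y.symm z = p z),
      ∀ z ∈ y.target, G z = h.gram y z := by
    intro y hy hyp z hz
    ext i j
    have h1 : ∀ i, coordVec y z i = hp.tangentIso (y.symm z) (Pi.single i 1) := fun i =>
      hp.mfderiv_chart_symm hy hyp hz _
    rw [HermitianMetric.gram, Matrix.of_apply, h1, h1, hG]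
    simp only
    rw [← hyp z hz]
    rfl
  have hind : ∀ x, LinearIndependent ℂ fun i : Fin N => hp.tangentIso x (Pi.single i 1) :=
    fun x => (Pi.linearIndependent_single_one (Fin N) ℂ).map'
      ((hp.tangentIso x).toLinearEquiv : Cn N →ₗ[ℂ] TX N x) (LinearEquiv.ker _)
  have key : ∀ z w, G z = G w := by
    refine metric_const_of_flat_of_periodic (Λ := Λ) ?_ ?_ ?_ ?_ ?_ ?_
    · intro i j
      refine contDiff_iff_contDiffAt.2 fun w => ?_
      obtain ⟨y, hy, hw, hyp⟩ := hp.exists_chart w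
      refine ((h.smooth y hy i j).contDiffAt (y.open_target.mem_nhds hw)).congr_of_eventuallyEq ?_
      filter_upwards [y.open_target.mem_nhds hw] with z hz
      rw [hgram hy hyp z hz]
      rfl
    · intro z
      ext i j
      exact h.conj_symm _ _ _
    · intro z c hc
      have h1 : ∑ k, c k • hp.tangentIso (p z) (Pi.single k 1) ≠ 0 := fun h0 =>
        hc (funext (Fintype.linearIndependent_iff.1 (hind (p z)) c h0))
      have h2 := (h.isHermitianForm (p z)).pos _ h1
      rw [(h.isHermitianForm (p z)).sum_left] at h2
      simp only [(h.isHermitianForm (p z)).sum_right, Finset.mul_sum] at h2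
      convert h2 using 4 with k _ l _
      simp only [hG, hG', Matrix.of_apply]
      ring
    · exact fun z => (h.isHermitianForm (p z)).isUnit_gram (hind (p z))
    · intro z w hzw
      rw [hG]
      simp only
      rw [(hp.apply_eq_iff z w).2 hzw]
    · intro i j z v w
      obtain ⟨y, hy, hz, hyp⟩ := hp.exists_chart z
      refine (delBar_congr ?_ w).trans (hFlat y hy z hz i j v w)
      filter_upwards [y.open_target.mem_nhds hz] with z' hz'
      refine congrFun (congrFun (chernForm_congr ?_ v) i) j
      filter_upwards [y.open_target.mem_nhds hz'] with z'' hz''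
      exact hgram hy hyp z'' hz''
  obtain ⟨z, rfl⟩ := hp.surjective x
  obtain ⟨z', rfl⟩ := hp.surjective x'
  exact congrFun (congrFun (key z z') i) j

/-- Translations of the torus are isometries for a flat metric. -/
theorem form_transport (x x' : X) (u v : TX N x) :
    h.form x' ((hp.tangentIso x).symm.trans (hp.tangentIso x') u)
      ((hp.tangentIso x).symm.trans (hp.tangentIso x') v) = h.form x u v := by
  have key : ∀ x (u v : Cn N), h.form x (hp.tangentIso x u) (hp.tangentIso x v) =
      ∑ k, ∑ l, u k * (starRingEnd ℂ (v l) *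
        h.form x (hp.tangentIso x (Pi.single k 1)) (hp.tangentIso x (Pi.single l 1))) := by
    intro x u v
    have h1 : ∀ u : Cn N, hp.tangentIso x u = ∑ k, u k • hp.tangentIso x (Pi.single k 1) := by
      intro u
      conv_lhs => rw [pi_eq_sum_univ' u, map_sum]
      simp only [map_smul]
    rw [h1 u, h1 v, (h.isHermitianForm x).sum_left]
    simp only [(h.isHermitianForm x).sum_right, Finset.mul_sum]
  obtain ⟨u, rfl⟩ := (hp.tangentIso x).surjective u
  obtain ⟨v, rfl⟩ := (hp.tangentIso x).surjective v
  simp only [ContinuousLinearEquiv.trans_apply, ContinuousLinearEquiv.symm_apply_apply]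
  rw [key, key]
  simp only [hp.form_tangentIso_const hFlat x' x]

theorem sum_frame_const (a b : ℕ) (x x' : X) (i j : SumIdx N a b) :
    h.sum a b x' (hp.frame a b i x') (hp.frame a b j x') =
      h.sum a b x (hp.frame a b i x) (hp.frame a b j x) := by
  set Q := (hp.tangentIso x).symm.trans (hp.tangentIso x') with hQ
  have h1 : ∀ i, hp.frame a b i x' = ((Q : TX N x →L[ℂ] TX N x').comp (hp.frame a b i x).1,
      (hp.frame a b i x).2.comp (Q.symm : TX N x' →L[ℂ] TX N x)) := by
    intro i
    rcases i with ⟨k, i⟩ | ⟨k, i⟩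
    · refine Prod.ext ?_ ?_
      · ext v : 1
        simp [frame, hQ]
      · ext v : 1
        simp [frame]
    · refine Prod.ext ?_ ?_
      · ext v : 1
        simp [frame]
      · ext v : 1
        simp [frame, hQ]
  rw [h1, h1, h.sum_comp Q (hp.form_transport hFlat x x')]

variable {a b c d : ℕ} {α β : LocalData N (SumFibre N a b) (SumBundle (X := X) N a b)
    (SumFibre N c d) (SumBundle (X := X) N c d) (SumIdx N a b) (SumIdx N c d)}

/-- All metrics are constant in standard data, since translations of the torus preserve both the
metrics and the standard frames. -/
theorem isFlat_of_isStandard (hβ : hp.IsStandard a b c d β) :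
    β.IsFlat h.dual (h.sum a b) (h.sum c d) := by
  obtain ⟨hy, he, hf⟩ := hβ
  set Q := fun x => (hp.tangentIso (p 0)).symm.trans (hp.tangentIso x) with hQ
  refine ⟨⟨Matrix.of fun i j => h.dual (p 0)
    ((ContinuousLinearMap.proj i : Cn N →L[ℂ] ℂ).comp
      ((hp.tangentIso (p 0)).symm : TX N (p 0) →L[ℂ] Cn N))
    ((ContinuousLinearMap.proj j : Cn N →L[ℂ] ℂ).comp
      ((hp.tangentIso (p 0)).symm : TX N (p 0) →L[ℂ] Cn N)), fun z hz => ?_⟩,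
    ⟨Matrix.of fun i j => h.sum a b (p 0) (hp.frame a b i (p 0)) (hp.frame a b j (p 0)),
      fun z _ => ?_⟩,
    ⟨Matrix.of fun i j => h.sum c d (p 0) (hp.frame c d i (p 0)) (hp.frame c d j (p 0)),
      fun z _ => ?_⟩⟩
  · ext i j
    have h1 : ∀ i, coordForm β.y (β.y.symm z) i = ((ContinuousLinearMap.proj i : Cn N →L[ℂ] ℂ).comp
        ((hp.tangentIso (p 0)).symm : TX N (p 0) →L[ℂ] Cn N)).comp
          ((Q (β.y.symm z)).symm : TX N (β.y.symm z) →L[ℂ] TX N (p 0)) := by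
      intro i
      unfold coordForm
      rw [hp.mfderiv_chart β.y_mem hy (β.y.map_target hz)]
      refine ContinuousLinearMap.ext fun v => ?_
      simp [hQ]
    rw [HMat, Matrix.of_apply, h1, h1, h.dual_comp (Q _) (hp.form_transport hFlat _ _),
      Matrix.of_apply]
  · ext i j
    rw [HMatE, Matrix.of_apply, he, hp.sum_frame_const hFlat a b (p 0), Matrix.of_apply]
  · ext i j
    rw [HMatF, Matrix.of_apply, hf, hp.sum_frame_const hFlat c d (p 0), Matrix.of_apply]

omit hFlat [DiscreteTopology Λ] [IsZLattice ℝ Λ]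

/-- Two local inverses of `p` differ locally by a translation. -/
theorem jacobian_eq_one (hα : hp.IsStandard a b c d α) (hβ : hp.IsStandard a b c d β) {z : Cn N}
    (hz : z ∈ overlap α β) : jacobian α β z = 1 := by
  have h1 : fderiv ℂ (coordChange α β) z = ContinuousLinearMap.id ℂ (Cn N) := by
    have h2 := mfderiv_comp z (mdifferentiableAt_chart α.y_mem hz.2)
      (mdifferentiableAt_chart_symm β.y_mem hz.1)
    rw [mfderiv_eq_fderiv] at h2
    refine h2.trans (ContinuousLinearMap.ext fun v => ?_)
    have h3 := hp.mfderiv_chart_symm β.y_mem hβ.1 hz.1 v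
    have h4 := hp.mfderiv_chart α.y_mem hα.1 hz.2
    refine (congrArg (mfderiv 𝓘(ℂ, Cn N) 𝓘(ℂ, Cn N) α.y (β.y.symm z)) h3).trans ?_
    rw [h4]
    exact ContinuousLinearEquiv.symm_apply_apply _ _
  have hd : DifferentiableAt ℂ (coordChange α β) z := (analyticAt_coordChange hz).differentiableAt
  have h5 : ∀ i, HasFDerivAt (fun z' => coordChange α β z' i)
      ((ContinuousLinearMap.proj i : Cn N →L[ℂ] ℂ).comp (fderiv ℂ (coordChange α β) z)) z :=
    hasFDerivAt_pi'.1 hd.hasFDerivAt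
  ext i j
  rw [jacobian, Matrix.of_apply, del_of_differentiableAt (h5 i).differentiableAt, (h5 i).fderiv, h1]
  simp [Matrix.one_apply, Pi.single_apply]

theorem trans_eq_id_of_isStandard (hα : hp.IsStandard a b c d α) (hβ : hp.IsStandard a b c d β)
    {x : X} (hxα : x ∈ α.y.source) (hxβ : x ∈ β.y.source) : trans α β x = AlgHom.id ℂ _ := by
  refine trans_eq_id hxα hxβ (fun z hz => hp.jacobian_eq_one hα hβ hz) (fun z hz => ?_)
    fun z hz => ?_
  · rw [← frameChangeE_self (α := β) (z := z) ⟨hz.1, β.y.map_target hz.1⟩]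
    unfold frameChangeE
    rw [hα.2.1.trans hβ.2.1.symm]
  · rw [← frameChangeF_self (α := β) (z := z) ⟨hz.1, β.y.map_target hz.1⟩]
    unfold frameChangeF
    rw [hα.2.2.trans hβ.2.2.symm]

end IsTorusCover

end FlatTorus

section Sections

open Filter Topology

/-! ### Sections over a torus in a flat atlas -/

variable {N : ℕ} {X : Type*} [TopologicalSpace X] [ChartedSpace (Cn N) X]
  [IsManifold 𝓘(ℂ, Cn N) ω X]
  {FE : Type*} [NormedAddCommGroup FE] [NormedSpace ℂ FE]
  {E : X → Type*} [TopologicalSpace (Bundle.TotalSpace FE E)]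
  [∀ x, AddCommGroup (E x)] [∀ x, Module ℂ (E x)] [∀ x, TopologicalSpace (E x)]
  [FiberBundle FE E]
  {FF : Type*} [NormedAddCommGroup FF] [NormedSpace ℂ FF]
  {F : X → Type*} [TopologicalSpace (Bundle.TotalSpace FF F)]
  [∀ x, AddCommGroup (F x)] [∀ x, Module ℂ (F x)] [∀ x, TopologicalSpace (F x)]
  [FiberBundle FF F]
  [FiniteDimensional ℂ FE] [VectorBundle ℂ FE E] [ContMDiffVectorBundle ω FE E 𝓘(ℂ, Cn N)]
  [FiniteDimensional ℂ FF] [VectorBundle ℂ FF F] [ContMDiffVectorBundle ω FF F 𝓘(ℂ, Cn N)]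
  {ιE ιF : Type} [Fintype ιE] [Fintype ιF] [DecidableEq ιE] [DecidableEq ιF]

/-- A set `𝒮` of local data whose coordinate systems are local inverses of `p`, with transition
functions of `A_m(E, F)` equal to the identity. It trivializes `A_m(E, F)` globally. -/
structure IsTrivializing (p : Cn N → X) (𝒮 : Set (LocalData N FE E FF F ιE ιF)) : Prop where
  symm_apply {β} (hβ : β ∈ 𝒮) {z : Cn N} (hz : z ∈ β.y.target) : β.y.symm z = p z
  trans_eq {α β} (hα : α ∈ 𝒮) (hβ : β ∈ 𝒮) {x : X} (hxα : x ∈ α.y.source) (hxβ : x ∈ β.y.source) :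
    trans α β x = AlgHom.id ℂ _
  exists_mem (w : Cn N) : ∃ β ∈ 𝒮, w ∈ β.y.target

variable {p : Cn N → X} {𝒮 : Set (LocalData N FE E FF F ιE ιF)} {m : ℕ}

namespace IsTrivializing

variable (h𝒮 : IsTrivializing p 𝒮) (hp : Function.Surjective p)
include h𝒮 hp

theorem exists_mem_source (x : X) : ∃ β ∈ 𝒮, x ∈ β.y.source := by
  obtain ⟨w, rfl⟩ := hp x
  obtain ⟨β, hβ, hw⟩ := h𝒮.exists_mem w
  exact ⟨β, hβ, h𝒮.symm_apply hβ hw ▸ β.y.map_target hw⟩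

/-- An element of `𝒮` that is defined at `x`. -/
def data (x : X) : LocalData N FE E FF F ιE ιF := (h𝒮.exists_mem_source hp x).choose

theorem data_mem (x : X) : h𝒮.data hp x ∈ 𝒮 := (h𝒮.exists_mem_source hp x).choose_spec.1

theorem mem_data_source (x : X) : x ∈ (h𝒮.data hp x).y.source :=
  (h𝒮.exists_mem_source hp x).choose_spec.2

/-- The representative of an element of the fibre of `A_m(E, F)` at `x` in the elements
of `𝒮`. -/
def rep {x : X} (r : Fibre N FE E FF F ιE ιF m x) : RAlg N ιE ιF :=
  r.1 ⟨h𝒮.data hp x, h𝒮.mem_data_source hp x⟩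

theorem apply_eq_rep {x : X} (r : Fibre N FE E FF F ιE ιF m x)
    {β : LocalData N FE E FF F ιE ιF} (hβ : β ∈ 𝒮) (hx : x ∈ β.y.source) :
    r.1 ⟨β, hx⟩ = h𝒮.rep hp r := by
  rw [r.2.2 ⟨h𝒮.data hp x, h𝒮.mem_data_source hp x⟩ ⟨β, hx⟩,
    h𝒮.trans_eq (h𝒮.data_mem hp x) hβ (h𝒮.mem_data_source hp x) hx]
  rfl

theorem rep_injective (x : X) :
    Function.Injective (h𝒮.rep hp : Fibre N FE E FF F ιE ιF m x → RAlg N ιE ιF) := by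
  intro r r' hr
  refine Subtype.ext (funext fun γ => ?_)
  rw [r.2.2 ⟨h𝒮.data hp x, h𝒮.mem_data_source hp x⟩ γ,
    r'.2.2 ⟨h𝒮.data hp x, h𝒮.mem_data_source hp x⟩ γ]
  exact congrArg _ hr

/-- Every element of `R_m` represents an element of the fibre at `x`; its representatives in all
local data are compatible by the cocycle condition. -/
theorem exists_rep_eq {c : RAlg N ιE ιF} (hc : c ∈ Rm N ιE ιF m) (x : X) :
    ∃ r : Fibre N FE E FF F ιE ιF m x, h𝒮.rep hp r = c := by
  refine ⟨⟨fun γ => trans (h𝒮.data hp x) γ.1 x c, fun γ => trans_mem_Rm _ _ _ hc,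
    fun α β => (trans_trans (h𝒮.mem_data_source hp x) α.2 β.2 c).symm⟩, ?_⟩
  show trans (h𝒮.data hp x) (h𝒮.data hp x) x c = c
  rw [trans_self (h𝒮.mem_data_source hp x), AlgHom.id_apply]

variable (s : ∀ x, Fibre N FE E FF F ιE ιF m x)

theorem localRep_eq {β : LocalData N FE E FF F ιE ιF} (hβ : β ∈ 𝒮) {z : Cn N}
    (hz : z ∈ β.y.target) : localRep s β z = h𝒮.rep hp (s (p z)) := by
  unfold localRep
  rw [dif_pos (β.y.map_target hz), h𝒮.apply_eq_rep hp _ hβ, h𝒮.symm_apply hβ hz]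

theorem rep_eventuallyEq {β : LocalData N FE E FF F ιE ιF} (hβ : β ∈ 𝒮) {z : Cn N}
    (hz : z ∈ β.y.target) : (fun z => h𝒮.rep hp (s (p z))) =ᶠ[𝓝 z] localRep s β := by
  filter_upwards [β.y.open_target.mem_nhds hz] with z' hz'
  exact (h𝒮.localRep_eq hp s hβ hz').symm

variable {s}

theorem isHolomorphicSection_of_const {c : RAlg N ιE ιF} (hs : ∀ x, h𝒮.rep hp (s x) = c) :
    IsHolomorphicSection s := by
  refine fun α => Hol.holomorphicOn fun z hz => ?_
  obtain ⟨β, hβ, hx⟩ := h𝒮.exists_mem_source hp (α.y.symm z)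
  have hzβ : z ∈ overlap β α := ⟨hz, hx⟩
  refine (hol_trans hzβ c).congr ?_
  filter_upwards [(isOpen_overlap β α).mem_nhds hzβ] with z' hz'
  rw [localRep_eq_trans s hz', h𝒮.apply_eq_rep hp _ hβ, hs]

theorem isParallel_of_const {hT' : ∀ x : X, TXDual N x → TXDual N x → ℂ}
    {hE : ∀ x, E x → E x → ℂ} {hF : ∀ x, F x → F x → ℂ} (hT : ∀ x, IsHermitianForm (hT' x))
    (hEh : ∀ x, IsHermitianForm (hE x)) (hFh : ∀ x, IsHermitianForm (hF x))
    (hflat : ∀ β ∈ 𝒮, β.IsFlat hT' hE hF) {c : RAlg N ιE ιF} (hs : ∀ x, h𝒮.rep hp (s x) = c) :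
    IsParallel hT' hE hF s := by
  intro α z hz v
  obtain ⟨β, hβ, hx⟩ := h𝒮.exists_mem_source hp (α.y.symm z)
  exact nablaTilde_eq_zero hT hEh hFh (hflat β hβ) s
    (fun x hx => (h𝒮.apply_eq_rep hp (s x) hβ hx).trans (hs x)) ⟨hz, hx⟩ v

theorem const_of_forall_linear (hs : ∀ (l : RAlg N ιE ιF →ₗ[ℂ] ℂ) (z w : Cn N),
    l (h𝒮.rep hp (s (p z))) = l (h𝒮.rep hp (s (p w)))) (x x' : X) :
    h𝒮.rep hp (s x) = h𝒮.rep hp (s x') := by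
  obtain ⟨z, rfl⟩ := hp x
  obtain ⟨w, rfl⟩ := hp x'
  rw [← sub_eq_zero, ← Module.forall_dual_apply_eq_zero_iff ℂ]
  intro l
  rw [map_sub, hs l z w, sub_self]

/-- A holomorphic section is constant in the global trivialization: its coefficients are
holomorphic functions on a torus. -/
theorem const_of_isHolomorphicSection {Λ : Submodule ℤ (Cn N)} [DiscreteTopology Λ]
    [IsZLattice ℝ Λ] (hΛ : ∀ z w, z - w ∈ Λ → p z = p w) (hs : IsHolomorphicSection s) (x x' : X) :
    h𝒮.rep hp (s x) = h𝒮.rep hp (s x') := by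
  refine h𝒮.const_of_forall_linear hp (fun l => ?_) x x'
  refine apply_eq_apply_of_differentiable_of_periodic (Λ := Λ) (fun z => ?_)
    fun z w hzw => by rw [hΛ z w hzw]
  obtain ⟨β, hβ, hz⟩ := h𝒮.exists_mem z
  obtain ⟨O, hO, hzO, n, φ, w, hφ, hw⟩ := hs β z hz
  have h1 : DifferentiableAt ℂ (fun z' => ∑ k, φ k z' * l (w k)) z :=
    DifferentiableAt.fun_sum fun k _ => ((hφ k).differentiableAt (hO.mem_nhds hzO)).mul_const _
  refine h1.congr_of_eventuallyEq ?_
  filter_upwards [h𝒮.rep_eventuallyEq hp s hβ hz, hO.mem_nhds hzO] with z' h2 h3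
  rw [h2, hw z' h3, map_sum]
  exact Finset.sum_congr rfl fun k _ => by rw [map_smul, smul_eq_mul]

/-- A parallel section is constant in the global trivialization. -/
theorem const_of_isParallel {hT' : ∀ x : X, TXDual N x → TXDual N x → ℂ}
    {hE : ∀ x, E x → E x → ℂ} {hF : ∀ x, F x → F x → ℂ} (hT : ∀ x, IsHermitianForm (hT' x))
    (hEh : ∀ x, IsHermitianForm (hE x)) (hFh : ∀ x, IsHermitianForm (hF x))
    (hflat : ∀ β ∈ 𝒮, β.IsFlat hT' hE hF) (hsm : IsSmoothSection s)
    (hs : IsParallel hT' hE hF s) (x x' : X) : h𝒮.rep hp (s x) = h𝒮.rep hp (s x') := by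
  refine h𝒮.const_of_forall_linear hp (fun l => ?_) x x'
  have key : ∀ z, DifferentiableAt ℝ (fun z' => l (h𝒮.rep hp (s (p z')))) z ∧
      fderiv ℝ (fun z' => l (h𝒮.rep hp (s (p z')))) z = 0 := by
    intro z
    obtain ⟨β, hβ, hz⟩ := h𝒮.exists_mem z
    have h1 : (fun z' => l (h𝒮.rep hp (s (p z')))) =ᶠ[𝓝 z] fun z' => l (localRep s β z') := by
      filter_upwards [h𝒮.rep_eventuallyEq hp s hβ hz] with z' h2
      rw [h2]
    have h2 : Dif (localRep s β) z := (hsm β).dif hz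
    refine ⟨(h2.differentiableAt l).congr_of_eventuallyEq h1, ?_⟩
    ext v
    rw [h1.fderiv_eq, ← coeffwise_apply (isFirstOrderAt_fderiv z v) h2 l,
      ← nablaTilde_of_isFlat hT hEh hFh (hflat β hβ) s hz v, hs β z hz v, map_zero]
    rfl
  exact is_const_of_fderiv_eq_zero (fun z => (key z).1) fun z => (key z).2

theorem isHolomorphicSection_iff_isParallel {Λ : Submodule ℤ (Cn N)} [DiscreteTopology Λ]
    [IsZLattice ℝ Λ] (hΛ : ∀ z w, z - w ∈ Λ → p z = p w)
    {hT' : ∀ x : X, TXDual N x → TXDual N x → ℂ}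
    {hE : ∀ x, E x → E x → ℂ} {hF : ∀ x, F x → F x → ℂ} (hT : ∀ x, IsHermitianForm (hT' x))
    (hEh : ∀ x, IsHermitianForm (hE x)) (hFh : ∀ x, IsHermitianForm (hF x))
    (hflat : ∀ β ∈ 𝒮, β.IsFlat hT' hE hF) (hsm : IsSmoothSection s) :
    IsHolomorphicSection s ↔ IsParallel hT' hE hF s :=
  ⟨fun hs => h𝒮.isParallel_of_const hp hT hEh hFh hflat
      fun x => h𝒮.const_of_isHolomorphicSection hp hΛ hs x (p 0),
    fun hs => h𝒮.isHolomorphicSection_of_const hp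
      fun x => h𝒮.const_of_isParallel hp hT hEh hFh hflat hsm hs x (p 0)⟩

theorem bijective_restriction {Λ : Submodule ℤ (Cn N)} [DiscreteTopology Λ]
    [IsZLattice ℝ Λ] (hΛ : ∀ z w, z - w ∈ Λ → p z = p w) (x : X) :
    Function.Bijective (restriction N FE E FF F ιE ιF m x) := by
  refine ⟨fun s t hst => ?_, fun r => ?_⟩
  · refine Subtype.ext (funext fun x' => h𝒮.rep_injective hp x' ?_)
    rw [h𝒮.const_of_isHolomorphicSection hp hΛ s.2 x' x,
      h𝒮.const_of_isHolomorphicSection hp hΛ t.2 x' x]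
    exact congrArg _ hst
  · have hc : h𝒮.rep hp r ∈ Rm N ιE ιF m := r.2.1 _
    choose s hs using h𝒮.exists_rep_eq hp hc
    exact ⟨⟨s, h𝒮.isHolomorphicSection_of_const hp hs⟩, h𝒮.rep_injective hp x (hs x)⟩

end IsTrivializing

end Sections

end JetBundle
end

open JetBundle
theorem corollary5p3 (N m a b c d : ℕ) (X : Type*) [TopologicalSpace X] [ChartedSpace (Cn N) X]
    [IsManifold 𝓘(ℂ, Cn N) ω X] (hX : IsComplexTorus N X) (h : HermitianMetric N X)
    (hKahler : h.IsKahler) (hFlat : h.IsFlat) :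
    (∀ s : ∀ x, Fibre N (SumFibre N a b) (SumBundle (X := X) N a b)
          (SumFibre N c d) (SumBundle (X := X) N c d) (SumIdx N a b) (SumIdx N c d) m x,
        IsSmoothSection s →
          (IsHolomorphicSection s ↔ IsParallel h.dual (h.sum a b) (h.sum c d) s)) ∧
      ∀ x : X, Function.Bijective (restriction N (SumFibre N a b) (SumBundle (X := X) N a b)
        (SumFibre N c d) (SumBundle (X := X) N c d) (SumIdx N a b) (SumIdx N c d) m x) := by
  obtain ⟨Λ, hΛd, hΛl, p, hp⟩ := hX
  have hp : IsTorusCover Λ p := hp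
  have hΛ : ∀ z w, z - w ∈ Λ → p z = p w := fun z w => (hp.apply_eq_iff z w).2
  have h𝒮 : IsTrivializing p {β | hp.IsStandard a b c d β} :=
    ⟨fun hβ _ hz => hβ.1 _ hz, fun hα hβ _ => hp.trans_eq_id_of_isStandard hα hβ,
      hp.exists_isStandard a b c d⟩
  exact ⟨fun s hsm => h𝒮.isHolomorphicSection_iff_isParallel hp.surjective hΛ
      h.isHermitianForm_dual (h.isHermitianForm_sum a b) (h.isHermitianForm_sum c d)
      (fun β hβ => hp.isFlat_of_isStandard hFlat hβ) hsm,
    fun x => h𝒮.bijective_restriction hp.surjective hΛ x⟩
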